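/- Let $n\ge 2$, $d\ge 1$, let $R=\mathbf C[x_1,\dots,x_n]$ with $\deg x_i=1$, $\mathfrak m=(x_1,\dots,x_n)$, and let $f\in R$ be homogeneous of degree $d$ such that $\dim\operatorname{Sing} f^{-1}(0)\le 1$, where $\operatorname{Sing} f^{-1}(0)=\{f=\partial f/\partial x_1=\dots=\partial f/\partial x_n=0\}\subset\mathbf C^n$. For a graded $R$-module $A$ write $A(p)_k=A_{k+p}$. Let $\Omega^j$ be the graded $R$-module of algebraic differential $j$-forms on $\mathbf C^n$ (with $\deg dx_i=1$), and let ${}^sK^\bullet_f$ be the shifted Koszul complex, with terms ${}^sK^j_f=\Omega^{j+n}(jd)$ and differential $df\wedge$. Put $$M=H^0({}^sK_f^\bullet)=\Omega^n/df\wedge\Omega^{n-1},\qquad N=H^{-1}({}^sK_f^\bullet),\qquad M'=H^0_{\mathfrak m}M=\{a\in M\mid \mathfrak m^ka=0\text{ for }k\gg0\},\qquad M''=M/M',$$ and, for a finitely generated graded $R$-module $A$ and $i\in\mathbf Z$, let $D_i(A)=\operatorname{Ext}_R^{n-i}(A,\Omega^n)$, a graded $R$-module computed by any resolution of $A$ by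 graded free modules of finite rank. Then there are canonical isomorphisms of graded $R$-modules $$D_0(M')=D_0(M)=M'(nd),\qquad D_1(M'')=D_1(M)=N(nd),\qquad D_1(N)=M''(nd),$$ and $D_i(M)$ vanishes for $i\ne0,1$, $D_i(M')$ for $i\ne 0$, and $D_i(M'')$ and $D_i(N)$ for $i\neq 1$. Here $D_0(M)\to D_0(M')$ and $D_1(M'')\to D_1(M)$ are induced by the inclusion $M'\to M$ and the projection $M\to M''$. The other isomorphisms are induced by the morphisms ${}^sK_f^\bullet\to M$ and $N[1]\to{}^sK_f^\bullet$ in the derived category that are the identity on $H^0$ and on $H^{-1}$ respectively, together with the self-duality $\mathbf R\mathrm{Hom}_R({}^sK_f^\bullet,\Omega^n[n])={}^sK_f^\bullet(nd)$ given by the wedge product: they are $D_0(M)\to H^0({}^sK_f^\bullet)(nd)=M(nd)$, which is injective with image $M'(nd)$; $D_1(M)\to H^{-1}({}^sK_f^\bullet)(nd)=N(nd)$; and $M(nd)\to D_1(N)$, which is surjective with kernel $M'(nd)$. Hence each of $M'$, $M''$, $N$ is a Cohen–Macaulay $R$-module, of dimension $0$, $1$, $1$ respectively if it is nonzero. Up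 to a shift of the grading by $nd$, $M'$ is self-dual: $D_0(M')\cong M'(nd)$; and $M''$ and $N$ are dual to each other: $D_1(M'')\cong N(nd)$ and $D_1(N)\cong M''(nd)$. -/

import Mathlib

noncomputable section

namespace KoszulDuality

open scoped DirectSum

/-- The polynomial ring `R = ℂ[x₁, …, xₙ]`. -/
abbrev PolyRing (n : ℕ) : Type := MvPolynomial (Fin n) ℂ

/-- The homogeneous polynomials of degree `k`, for `k : ℤ` (only `0` if `k < 0`). -/
def polyDeg (n : ℕ) (k : ℤ) : AddSubgroup (PolyRing n) where
  carrier := {p | ∀ m, p.coeff m ≠ 0 → (m.degree : ℤ) = k}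
  zero_mem' := by simp
  add_mem' := by
    intro p q hp hq m hm
    by_cases h : p.coeff m = 0
    · exact hq m (by simpa [h] using hm)
    · exact hp m h
  neg_mem' := by
    intro p hp m hm
    exact hp m (by simpa using hm)

/-- A family of additive projections onto the members of `deg` shows that the module is their
internal direct sum. -/
theorem isInternal_of_proj {A : Type} [AddCommGroup A] (deg : ℤ → AddSubgroup A)
    (π : ℤ → A →+ A) (hmem : ∀ k a, π k a ∈ deg k) (hid : ∀ k, ∀ a ∈ deg k, π k a = a)
    (hne : ∀ k l, k ≠ l → ∀ a ∈ deg l, π k a = 0)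
    (hfin : ∀ a, {k | π k a ≠ 0}.Finite) (hinj : ∀ a, (∀ k, π k a = 0) → a = 0) :
    DirectSum.IsInternal deg := by
  classical
  have key : ∀ (x : ⨁ i, deg i) (k : ℤ),
      π k (DirectSum.coeAddMonoidHom deg x) = (x k : A) := by
    intro x k
    induction x using DirectSum.induction_on with
    | zero => simp
    | of i y =>
      rw [DirectSum.coeAddMonoidHom_of]
      by_cases h : k = i
      · subst h
        simp [hid k y y.2]
      · rw [hne k i h y y.2, DirectSum.of_eq_of_ne _ _ _ h]; rfl
    | add x y hx hy => simp [hx, hy]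
  constructor
  · intro x y hxy
    refine DFinsupp.ext fun k => Subtype.ext ?_
    change ((x k : deg k) : A) = ((y k : deg k) : A)
    rw [← key, ← key, hxy]
  · intro a
    refine ⟨∑ k ∈ (hfin a).toFinset, DirectSum.of (fun i => deg i) k ⟨π k a, hmem k a⟩, ?_⟩
    rw [← sub_eq_zero]
    apply hinj
    intro k
    rw [map_sub, key, sub_eq_zero, DirectSum.sum_apply, AddSubgroup.val_finsetSum]
    rw [Finset.sum_eq_single k]
    · simp
    · intro b _ hb
      rw [DirectSum.of_eq_of_ne _ _ _ hb.symm]; rfl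
    · intro hk
      simp at hk
      simp [hk]

/-- A `ℤ`-graded module over `R = ℂ[x₁, …, xₙ]`, where `deg xᵢ = 1`. -/
structure GrMod (n : ℕ) where
  carrier : Type
  [addCommGroup : AddCommGroup carrier]
  [module : Module (PolyRing n) carrier]
  /-- `deg k` is the set of homogeneous elements of degree `k` (including `0`) -/
  deg : ℤ → AddSubgroup carrier
  isInternal : DirectSum.IsInternal deg
  smul_mem : ∀ (i k : ℤ) (p : PolyRing n) (a : carrier),
    p ∈ polyDeg n i → a ∈ deg k → p • a ∈ deg (i + k)

instance (n : ℕ) : CoeSort (GrMod n) Type := ⟨GrMod.carrier⟩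

attribute [instance] GrMod.addCommGroup GrMod.module

variable {n : ℕ}

namespace GrMod

/-- The projection to the homogeneous component of degree `k`. -/
def proj (A : GrMod n) (k : ℤ) : A →+ A :=
  letI := A.isInternal.chooseDecomposition
  (A.deg k).subtype.comp ((DFinsupp.evalAddMonoidHom k).comp
    (DirectSum.decomposeAddEquiv A.deg).toAddMonoidHom)

theorem proj_mem (A : GrMod n) (k : ℤ) (a : A) : A.proj k a ∈ A.deg k := by
  simp [proj]

theorem proj_same (A : GrMod n) (k : ℤ) (a : A) (h : a ∈ A.deg k) : A.proj k a = a := by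
  let := A.isInternal.chooseDecomposition
  exact DirectSum.decompose_of_mem_same A.deg h

theorem proj_ne (A : GrMod n) (k l : ℤ) (hkl : k ≠ l) (a : A) (h : a ∈ A.deg l) :
    A.proj k a = 0 := by
  let := A.isInternal.chooseDecomposition
  exact DirectSum.decompose_of_mem_ne A.deg h hkl.symm

theorem proj_fin (A : GrMod n) (a : A) : {k | A.proj k a ≠ 0}.Finite := by
  classical
  let := A.isInternal.chooseDecomposition
  refine (Finset.finite_toSet (DirectSum.decompose A.deg a).support).subset ?_
  intro k hk
  simp only [Finset.mem_coe, DFinsupp.mem_support_toFun]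
  intro h
  apply hk
  change ((DirectSum.decompose A.deg a k : A.deg k) : A) = 0
  exact congrArg Subtype.val h

theorem sum_proj (A : GrMod n) (a : A) : ∑ k ∈ (A.proj_fin a).toFinset, A.proj k a = a := by
  classical
  let := A.isInternal.chooseDecomposition
  conv_rhs => rw [← DirectSum.sum_support_decompose A.deg a]
  refine Finset.sum_subset_zero_on_sdiff ?_ ?_ (fun k _ => rfl)
  · intro k hk
    simp only [Set.Finite.mem_toFinset, Set.mem_ofPred_eq] at hk
    simp only [DFinsupp.mem_support_toFun]
    intro h
    exact hk (congrArg Subtype.val h)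
  · intro k hk
    simp only [Finset.mem_sdiff, Set.Finite.mem_toFinset, Set.mem_ofPred_eq, not_not] at hk
    exact hk.2

theorem eq_zero_of_proj (A : GrMod n) (a : A) (h : ∀ k, A.proj k a = 0) : a = 0 := by
  rw [← A.sum_proj a]
  exact Finset.sum_eq_zero fun k _ => h k

/-- Maps that raise the degree by `s` commute with the projections. -/
theorem proj_map {A B : GrMod n} (g : A →+ B) (s : ℤ)
    (hg : ∀ k, ∀ a ∈ A.deg k, g a ∈ B.deg (k + s)) (k : ℤ) (a : A) :
    B.proj (k + s) (g a) = g (A.proj k a) := by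
  classical
  conv_lhs => rw [← A.sum_proj a]
  rw [map_sum, map_sum]
  by_cases h : A.proj k a = 0
  · rw [h, map_zero]
    refine Finset.sum_eq_zero fun l hl => ?_
    by_cases hkl : k = l
    · subst hkl; simp [h]
    · exact B.proj_ne _ (l + s) (by omega) _ (hg l _ (A.proj_mem l a))
  · rw [Finset.sum_eq_single k]
    · exact B.proj_same _ _ (hg k _ (A.proj_mem k a))
    · intro l _ hl
      exact B.proj_ne _ (l + s) (by omega) _ (hg l _ (A.proj_mem l a))
    · intro hk
      simp [h] at hk

/-- The shifted graded module `A(p)`, with `A(p)_k = A_{k+p}`. -/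
def shift (A : GrMod n) (p : ℤ) : GrMod n where
  carrier := A
  deg k := A.deg (k + p)
  isInternal := by
    refine isInternal_of_proj _ (fun k => A.proj (k + p)) (fun k a => A.proj_mem _ a)
      (fun k a h => A.proj_same _ a h) (fun k l hkl a h => A.proj_ne _ _ (by omega) a h) ?_ ?_
    · intro a
      refine ((A.proj_fin a).preimage (f := fun k => k + p) ?_)
      intro x _ y _ h
      simpa using h
    · intro a h
      refine A.eq_zero_of_proj a fun k => ?_
      simpa using h (k - p)
  smul_mem i k q a hq ha := by
    rw [add_assoc]
    exact A.smul_mem i (k + p) q a hq ha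

/-- A submodule is homogeneous if it contains the homogeneous components of its elements. -/
def IsHomogeneous (A : GrMod n) (S : Submodule (PolyRing n) A) : Prop :=
  ∀ k, ∀ a ∈ S, A.proj k a ∈ S

/-- A homogeneous submodule, as a graded module. -/
def sub (A : GrMod n) (S : Submodule (PolyRing n) A) (hS : A.IsHomogeneous S) : GrMod n where
  carrier := S
  deg k := (A.deg k).comap S.subtype.toAddMonoidHom
  isInternal := by
    refine isInternal_of_proj _
      (fun k => ((A.proj k).comp S.subtype.toAddMonoidHom).codRestrict S fun a => hS k a a.2)
      (fun k a => A.proj_mem k a) (fun k a h => Subtype.ext (A.proj_same k a h))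
      (fun k l hkl a h => Subtype.ext (A.proj_ne k l hkl a h)) ?_ ?_
    · intro a
      refine (A.proj_fin a).subset fun k hk h => hk (Subtype.ext h)
    · intro a h
      exact Subtype.ext (A.eq_zero_of_proj a fun k => congrArg Subtype.val (h k))
  smul_mem i k p a hp ha := A.smul_mem i k p a hp ha

/-- The quotient by a homogeneous submodule, as a graded module: its homogeneous elements of
degree `k` are the classes of those of `A`. -/
def quot (A : GrMod n) (S : Submodule (PolyRing n) A) (hS : A.IsHomogeneous S) : GrMod n where
  carrier := A ⧸ S
  deg k := (A.deg k).map S.mkQ.toAddMonoidHom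
  isInternal := by
    refine isInternal_of_proj _
      (fun k => QuotientAddGroup.map S.toAddSubgroup S.toAddSubgroup (A.proj k)
        fun a ha => hS k a ha) ?_ ?_ ?_ ?_ ?_
    · intro k a
      obtain ⟨a, rfl⟩ := Submodule.Quotient.mk_surjective S a
      exact ⟨A.proj k a, A.proj_mem k a, rfl⟩
    · rintro k _ ⟨a, ha, rfl⟩
      exact congrArg (Submodule.Quotient.mk (p := S)) (A.proj_same k a ha)
    · rintro k l hkl _ ⟨a, ha, rfl⟩
      exact congrArg (Submodule.Quotient.mk (p := S)) (A.proj_ne k l hkl a ha)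
    · intro a
      obtain ⟨a, rfl⟩ := Submodule.Quotient.mk_surjective S a
      refine (A.proj_fin a).subset fun k hk h => hk ?_
      exact congrArg (Submodule.Quotient.mk (p := S)) h
    · intro a h
      obtain ⟨a, rfl⟩ := Submodule.Quotient.mk_surjective S a
      rw [Submodule.Quotient.mk_eq_zero, ← A.sum_proj a]
      refine Submodule.sum_mem _ fun k _ => ?_
      exact (Submodule.Quotient.mk_eq_zero S).1 (h k)
  smul_mem := by
    rintro i k p _ hp ⟨a, ha, rfl⟩
    exact ⟨p • a, A.smul_mem i k p a hp ha, rfl⟩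

theorem isHomogeneous_bot (A : GrMod n) : A.IsHomogeneous ⊥ := by
  intro k a ha
  rw [Submodule.mem_bot] at ha ⊢
  simp [ha]

theorem isHomogeneous_ker {A B : GrMod n} (g : A →ₗ[PolyRing n] B)
    (hg : ∀ k, ∀ a ∈ A.deg k, g a ∈ B.deg k) : A.IsHomogeneous (LinearMap.ker g) := by
  intro k a ha
  have := proj_map g.toAddMonoidHom 0 (by simpa using hg) k a
  rw [LinearMap.mem_ker] at ha ⊢
  change g (A.proj k a) = 0
  exact this.symm.trans (by simp [ha])

theorem isHomogeneous_range {A B : GrMod n} (g : A →ₗ[PolyRing n] B)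
    (hg : ∀ k, ∀ a ∈ A.deg k, g a ∈ B.deg k) : B.IsHomogeneous (LinearMap.range g) := by
  rintro k _ ⟨a, rfl⟩
  have := proj_map g.toAddMonoidHom 0 (by simpa using hg) k a
  rw [add_zero] at this
  exact ⟨A.proj k a, this.symm⟩

/-- The subquotient `Z / (B ∩ Z)` for homogeneous submodules `Z` and `B`. -/
def subquot (A : GrMod n) (Z B : Submodule (PolyRing n) A) (hZ : A.IsHomogeneous Z)
    (hB : A.IsHomogeneous B) : GrMod n :=
  (A.sub Z hZ).quot (B.submoduleOf Z) (by
    intro k a ha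
    have := proj_map (A := A.sub Z hZ) (B := A) Z.subtype.toAddMonoidHom 0
      (fun k a ha => by rw [add_zero]; exact ha) k a
    rw [add_zero] at this
    change Z.subtype ((A.sub Z hZ).proj k a) ∈ B
    have h2 := hB k _ ha
    exact (congrArg (· ∈ B) this).mp h2)

/-- The class of an element of `Z` in the subquotient `Z / (B ∩ Z)`. -/
def subquotMk (A : GrMod n) (Z B : Submodule (PolyRing n) A) (hZ : A.IsHomogeneous Z)
    (hB : A.IsHomogeneous B) : Z →ₗ[PolyRing n] A.subquot Z B hZ hB :=
  (B.submoduleOf Z).mkQ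

/-- An isomorphism of graded modules: `R`-linear, bijective and compatible with the gradings. -/
structure Iso (A B : GrMod n) extends A ≃ₗ[PolyRing n] B where
  mem_deg_iff : ∀ k a, toLinearEquiv a ∈ B.deg k ↔ a ∈ A.deg k

end GrMod

/-- The projection of a polynomial to its homogeneous part of degree `k : ℤ`. -/
def polyProj (n : ℕ) (k : ℤ) : PolyRing n →+ PolyRing n :=
  if 0 ≤ k then (MvPolynomial.homogeneousComponent k.toNat).toAddMonoidHom else 0

theorem coeff_polyProj (k : ℤ) (p : PolyRing n) (m : Fin n →₀ ℕ) :
    (polyProj n k p).coeff m = if (m.degree : ℤ) = k then p.coeff m else 0 := by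
  unfold polyProj
  by_cases hk : 0 ≤ k
  · simp only [hk, if_true]
    change MvPolynomial.coeff m (MvPolynomial.homogeneousComponent k.toNat p) = _
    rw [MvPolynomial.coeff_homogeneousComponent]
    have : (m.degree = k.toNat) ↔ ((m.degree : ℤ) = k) := by omega
    simp [this]
  · have : (m.degree : ℤ) ≠ k := by omega
    simp [hk, this]

theorem polyProj_mem (k : ℤ) (p : PolyRing n) : polyProj n k p ∈ polyDeg n k := by
  intro m hm
  rw [coeff_polyProj] at hm
  by_contra h
  simp [h] at hm

theorem polyProj_same (k : ℤ) (p : PolyRing n) (h : p ∈ polyDeg n k) : polyProj n k p = p := by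
  ext m
  rw [coeff_polyProj]
  by_cases hm : p.coeff m = 0
  · simp [hm]
  · simp [h m hm]

theorem polyProj_ne (k l : ℤ) (hkl : k ≠ l) (p : PolyRing n) (h : p ∈ polyDeg n l) :
    polyProj n k p = 0 := by
  ext m
  rw [coeff_polyProj]
  by_cases hm : p.coeff m = 0
  · simp [hm]
  · simp [h m hm, hkl.symm]

theorem polyProj_fin (p : PolyRing n) : {k | polyProj n k p ≠ 0}.Finite := by
  classical
  refine (Finset.finite_toSet (p.support.image fun m => (m.degree : ℤ))).subset ?_
  intro k hk
  obtain ⟨m, hm⟩ := MvPolynomial.ne_zero_iff.1 hk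
  rw [coeff_polyProj] at hm
  simp only [Finset.coe_image, Set.mem_image, Finset.mem_coe, MvPolynomial.mem_support_iff]
  by_cases h : (m.degree : ℤ) = k
  · exact ⟨m, by simpa [h] using hm, h⟩
  · simp [h] at hm

theorem eq_zero_of_polyProj (p : PolyRing n) (h : ∀ k, polyProj n k p = 0) : p = 0 := by
  ext m
  have := congrArg (MvPolynomial.coeff m) (h m.degree)
  simpa [coeff_polyProj] using this

theorem polyDeg_mul (i k : ℤ) (p q : PolyRing n) (hp : p ∈ polyDeg n i) (hq : q ∈ polyDeg n k) :
    p * q ∈ polyDeg n (i + k) := by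
  classical
  intro m hm
  rw [MvPolynomial.coeff_mul] at hm
  obtain ⟨⟨a, b⟩, hab, hne⟩ := Finset.exists_ne_zero_of_sum_ne_zero hm
  rw [Finset.HasAntidiagonal.mem_antidiagonal] at hab
  have h1 := hp a (left_ne_zero_of_mul hne)
  have h2 := hq b (right_ne_zero_of_mul hne)
  rw [← hab, map_add, Nat.cast_add]
  dsimp at h1 h2 ⊢
  rw [h1, h2]

theorem mem_polyDeg_of_isHomogeneous {d : ℕ} {p : PolyRing n} (h : p.IsHomogeneous d) :
    p ∈ polyDeg n d := by
  intro m hm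
  have := h hm
  rw [Finsupp.degree_eq_weight_one]
  exact_mod_cast this

theorem C_mem_polyDeg (c : ℂ) : (MvPolynomial.C c : PolyRing n) ∈ polyDeg n 0 :=
  mem_polyDeg_of_isHomogeneous (MvPolynomial.isHomogeneous_C _ c)

namespace GrMod

/-- A free module with a finite basis `b`, graded so that `b i` has degree `δ i`. -/
def ofBasis {ι A : Type} [Finite ι] [AddCommGroup A] [Module (PolyRing n) A]
    (b : Module.Basis ι (PolyRing n) A) (δ : ι → ℤ) : GrMod n where
  carrier := A
  deg k :=
    { carrier := {a | ∀ i, b.repr a i ∈ polyDeg n (k - δ i)}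
      zero_mem' := fun i => by simp [zero_mem]
      add_mem' := fun {x y} hx hy i => by simpa using add_mem (hx i) (hy i)
      neg_mem' := fun {x} hx i => by simpa using hx i }
  isInternal := by
    have := Fintype.ofFinite ι
    let π : ℤ → A →+ A := fun k =>
      { toFun := fun a => b.equivFun.symm fun i => polyProj n (k - δ i) (b.repr a i)
        map_zero' := by
          simp only [map_zero, Finsupp.coe_zero, Pi.zero_apply]
          exact map_zero b.equivFun.symm
        map_add' := fun x y => by
          rw [← map_add]
          congr 1
          ext1 i
          simp }
    have hπ : ∀ k a i, b.repr (π k a) i = polyProj n (k - δ i) (b.repr a i) := by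
      intro k a i
      change b.equivFun (b.equivFun.symm _) i = _
      rw [LinearEquiv.apply_symm_apply]
    refine isInternal_of_proj _ π ?_ ?_ ?_ ?_ ?_
    · intro k a i
      rw [hπ]
      exact polyProj_mem _ _
    · intro k a h
      refine b.ext_elem fun i => ?_
      rw [hπ]
      exact polyProj_same _ _ (h i)
    · intro k l hkl a h
      refine b.ext_elem fun i => ?_
      rw [hπ, map_zero]
      exact polyProj_ne _ (l - δ i) (by omega) _ (h i)
    · intro a
      refine (Set.finite_iUnion fun i => (polyProj_fin (b.repr a i)).preimage
        (f := fun k => k - δ i) (by intro x _ y _ h; simpa using h)).subset ?_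
      intro k hk
      by_contra hn
      apply hk
      refine b.ext_elem fun i => ?_
      rw [hπ, map_zero]
      by_contra h
      exact hn (Set.mem_iUnion.2 ⟨i, h⟩)
    · intro a h
      refine b.ext_elem fun i => ?_
      rw [map_zero]
      refine eq_zero_of_polyProj _ fun k => ?_
      have := hπ (k + δ i) a i
      rw [h (k + δ i), add_sub_cancel_right] at this
      simpa using this.symm
  smul_mem i k p a hp ha j := by
    rw [map_smul, Finsupp.smul_apply, smul_eq_mul, add_sub_assoc]
    exact polyDeg_mul _ _ _ _ hp (ha j)

/-- The graded free module `⨁ᵢ R(-δᵢ)`, whose `i`-th basis vector has degree `δ i`. -/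
def free {r : ℕ} (δ : Fin r → ℤ) : GrMod n :=
  ofBasis (Pi.basisFun (PolyRing n) (Fin r)) δ

/-- The standard basis of `⨁ᵢ R(-δᵢ)`. -/
def freeBasis {r : ℕ} (δ : Fin r → ℤ) : Module.Basis (Fin r) (PolyRing n) (free (n := n) δ) :=
  Pi.basisFun (PolyRing n) (Fin r)

theorem mem_deg_free {r : ℕ} (δ : Fin r → ℤ) (k : ℤ) (v : free (n := n) δ) :
    v ∈ (free (n := n) δ).deg k ↔ ∀ i, (freeBasis δ).repr v i ∈ polyDeg n (k - δ i) :=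
  Iff.rfl

theorem freeBasis_mem {r : ℕ} (δ : Fin r → ℤ) (i : Fin r) :
    freeBasis (n := n) δ i ∈ (free δ).deg (δ i) := by
  classical
  rw [mem_deg_free]
  intro j
  rw [Module.Basis.repr_self, Finsupp.single_apply]
  split_ifs with h
  · subst h
    rw [sub_self]
    exact C_mem_polyDeg 1
  · exact zero_mem _

theorem free_map_mem {r : ℕ} (δ : Fin r → ℤ) (B : GrMod n) (s : ℤ) (g : free (n := n) δ →ₗ[PolyRing n] B)
    (hg : ∀ i, g (freeBasis δ i) ∈ B.deg (δ i + s)) (k : ℤ) (v : free (n := n) δ)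
    (hv : v ∈ (free δ).deg k) : g v ∈ B.deg (k + s) := by
  rw [← (freeBasis δ).sum_repr v, map_sum]
  refine sum_mem fun i _ => ?_
  rw [map_smul]
  have := B.smul_mem _ _ _ _ (hv i) (hg i)
  rwa [show k - δ i + (δ i + s) = k + s by ring] at this

/-- The graded module `Hom_R(F, B)` for a graded free module `F` of finite rank; the elements of
degree `k` are the maps that raise degrees by `k`. -/
def homFree {r : ℕ} (δ : Fin r → ℤ) (B : GrMod n) : GrMod n where
  carrier := free (n := n) δ →ₗ[PolyRing n] B
  deg k :=
    { carrier := {g | ∀ e, ∀ v ∈ (free (n := n) δ).deg e, g v ∈ B.deg (e + k)}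
      zero_mem' := fun e v _ => zero_mem _
      add_mem' := fun hx hy e v hv => add_mem (hx e v hv) (hy e v hv)
      neg_mem' := fun hx e v hv => neg_mem (hx e v hv) }
  isInternal := by
    let π : ℤ → (free (n := n) δ →ₗ[PolyRing n] B) →+ (free (n := n) δ →ₗ[PolyRing n] B) := fun k =>
      { toFun := fun g => (freeBasis δ).constr ℕ fun i => B.proj (δ i + k) (g (freeBasis δ i))
        map_zero' := by
          refine (freeBasis δ).ext fun i => ?_
          rw [Module.Basis.constr_basis]
          simp
        map_add' := fun x y => by
          refine (freeBasis δ).ext fun i => ?_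
          rw [LinearMap.add_apply]
          iterate 3 rw [Module.Basis.constr_basis]
          simp }
    have hπ : ∀ k g i, π k g (freeBasis δ i) = B.proj (δ i + k) (g (freeBasis δ i)) :=
      fun k g i => Module.Basis.constr_basis _ _ _ _
    refine isInternal_of_proj _ π ?_ ?_ ?_ ?_ ?_
    · intro k g
      refine free_map_mem δ B k _ fun i => ?_
      rw [hπ]
      exact B.proj_mem _ _
    · intro k g h
      refine (freeBasis δ).ext fun i => ?_
      rw [hπ]
      exact B.proj_same _ _ (h _ _ (freeBasis_mem δ i))
    · intro k l hkl g h
      refine (freeBasis δ).ext fun i => ?_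
      rw [hπ]
      exact B.proj_ne _ (δ i + l) (by omega) _ (h _ _ (freeBasis_mem δ i))
    · intro g
      refine (Set.finite_iUnion fun i => (B.proj_fin (g (freeBasis δ i))).preimage
        (f := fun k => δ i + k) (by intro x _ y _ h; simpa using h)).subset ?_
      intro k hk
      by_contra hn
      apply hk
      refine (freeBasis δ).ext fun i => ?_
      rw [hπ]
      by_contra h
      exact hn (Set.mem_iUnion.2 ⟨i, h⟩)
    · intro g h
      refine (freeBasis δ).ext fun i => ?_
      refine B.eq_zero_of_proj _ fun k => ?_
      have := hπ (k - δ i) g i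
      rw [h (k - δ i), add_sub_cancel] at this
      exact this.symm
  smul_mem i k p g hp hg e v hv := by
    have := B.smul_mem i (e + k) p (g v) hp (hg e v hv)
    rwa [show i + (e + k) = e + (i + k) by ring] at this

/-- The homogeneous maximal ideal `𝔪 = (x₁, …, xₙ)` of `R`. -/
def _root_.KoszulDuality.maxIdeal (n : ℕ) : Ideal (PolyRing n) :=
  Ideal.span (Set.range MvPolynomial.X)

/-- `H⁰_𝔪 A`, the submodule of the elements killed by a power of `𝔪`. -/
def torsion (A : GrMod n) : Submodule (PolyRing n) A where
  carrier := {a | ∃ N : ℕ, ∀ p ∈ maxIdeal n ^ N, p • a = 0}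
  zero_mem' := ⟨0, by simp⟩
  add_mem' := by
    rintro x y ⟨N, hN⟩ ⟨K, hK⟩
    refine ⟨N + K, fun p hp => ?_⟩
    rw [smul_add, hN p (Ideal.pow_le_pow_right (Nat.le_add_right N K) hp),
      hK p (Ideal.pow_le_pow_right (Nat.le_add_left K N) hp), add_zero]
  smul_mem' := by
    rintro c x ⟨N, hN⟩
    exact ⟨N, fun p hp => by rw [smul_comm, hN p hp, smul_zero]⟩

open scoped Pointwise in
theorem isHomogeneous_torsion (A : GrMod n) : A.IsHomogeneous A.torsion := by
  rintro k a ⟨N, hN⟩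
  refine ⟨N, fun p hp => ?_⟩
  unfold maxIdeal at hp hN
  rw [Ideal.span, Submodule.span_pow] at hp hN
  refine Submodule.span_induction (p := fun p _ => p • A.proj k a = 0) ?_ ?_ ?_ ?_ hp
  · intro q hq
    have hq2 : q ∈ polyDeg n N := by
      clear hN hp
      induction N generalizing q with
      | zero =>
        rw [pow_zero, Set.mem_one] at hq
        subst hq
        exact C_mem_polyDeg 1
      | succ N ih =>
        rw [pow_succ] at hq
        obtain ⟨u, hu, _, ⟨i, rfl⟩, rfl⟩ := hq
        have := polyDeg_mul _ _ _ _ (ih u hu)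
          (mem_polyDeg_of_isHomogeneous (MvPolynomial.isHomogeneous_X ℂ i))
        exact_mod_cast this
    have h := proj_map (A := A) (B := A) (DistribSMul.toAddMonoidHom A q) N
      (fun k a ha => by
        have := A.smul_mem _ _ _ _ hq2 ha
        rw [add_comm] at this
        exact this) k a
    refine h.symm.trans ?_
    change A.proj _ (q • a) = 0
    rw [hN q (Submodule.subset_span hq), map_zero]
  · rw [zero_smul]
  · intro x y _ _ hx hy
    rw [add_smul, hx, hy, add_zero]
  · intro c x _ hx
    rw [smul_assoc, hx, smul_zero]

end GrMod

/-- The basis `dx₁, …, dxₙ` of the module of Kähler differentials of `R` over `ℂ`. -/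
def dx (n : ℕ) : Module.Basis (Fin n) (PolyRing n) (KaehlerDifferential ℂ (PolyRing n)) :=
  KaehlerDifferential.mvPolynomialBasis ℂ (Fin n)

/-- The graded module `Ωʲ` of algebraic differential `j`-forms on `ℂⁿ`, where
`deg xᵢ = deg dxᵢ = 1`. -/
def forms (n j : ℕ) : GrMod n :=
  GrMod.ofBasis (A := ⋀[PolyRing n]^j (KaehlerDifferential ℂ (PolyRing n)))
    ((dx n).exteriorPower j) fun _ => j

/-- The wedge product `Ωⁱ × Ωʲ → Ωᵏ`, where `i + j = k`. -/
def wedge {i j k : ℕ} (h : i + j = k) (ω : forms n i) (η : forms n j) : forms n k :=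
  ⟨(ω : ⋀[PolyRing n]^i (KaehlerDifferential ℂ (PolyRing n))).1 *
    (η : ⋀[PolyRing n]^j (KaehlerDifferential ℂ (PolyRing n))).1, by
    rw [ExteriorAlgebra.exteriorPower, ← h, pow_add]
    exact Submodule.mul_mem_mul ω.2 η.2⟩

/-- The differential `df`, as a 1-form. -/
def diffForm (f : PolyRing n) : forms n 1 :=
  ⟨ExteriorAlgebra.ι (PolyRing n) (KaehlerDifferential.D ℂ (PolyRing n) f), by
    rw [ExteriorAlgebra.exteriorPower, pow_one]
    exact LinearMap.mem_range_self _ _⟩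

/-- The differential `df ∧ : Ωʲ → Ωʲ⁺¹` of the Koszul complex. -/
def dfWedge (f : PolyRing n) (j : ℕ) : forms n j →ₗ[PolyRing n] forms n (j + 1) where
  toFun ω := wedge (add_comm 1 j) (diffForm f) ω
  map_add' _ _ := Subtype.ext (mul_add _ _ _)
  map_smul' _ _ := Subtype.ext (mul_smul_comm _ _ _)

theorem pderiv_mem_polyDeg {d : ℕ} {f : PolyRing n} (hf : f.IsHomogeneous d) (i : Fin n) :
    MvPolynomial.pderiv i f ∈ polyDeg n (d - 1) := by
  intro m hm
  rw [MvPolynomial.coeff_pderiv] at hm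
  have h := mem_polyDeg_of_isHomogeneous hf _ (left_ne_zero_of_mul hm)
  rw [map_add, Finsupp.degree_single] at h
  push_cast at h
  omega

theorem iotaMulti_mem {j : ℕ} (v : Fin j → Fin n) :
    (exteriorPower.ιMulti (PolyRing n) j (fun a => dx n (v a)) : forms n j) ∈ (forms n j).deg j := by
  intro s
  rw [sub_self]
  rw [exteriorPower.basis_repr_apply, exteriorPower.ιMultiDual_apply_ιMulti]
  have : (Matrix.of fun a c => (dx n).coord (Set.powersetCard.ofFinEmbEquiv.symm s c) (dx n (v a)))
      = (MvPolynomial.C : ℂ →+* PolyRing n).mapMatrix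
        (Matrix.of fun a c => if v a = Set.powersetCard.ofFinEmbEquiv.symm s c then 1 else 0) := by
    ext1 a c
    simp [Finsupp.single_apply, apply_ite MvPolynomial.C]
  rw [this, ← RingHom.map_det]
  exact C_mem_polyDeg _

theorem dfWedge_mem {d : ℕ} {f : PolyRing n} (hf : f.IsHomogeneous d) (j : ℕ) (k : ℤ) (ω : forms n j)
    (hω : ω ∈ (forms n j).deg k) : dfWedge f j ω ∈ (forms n (j + 1)).deg (k + d) := by
  classical
  have hsum := ((dx n).exteriorPower j).sum_repr ω
  have hdf : KaehlerDifferential.D ℂ (PolyRing n) f =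
      ∑ i, MvPolynomial.pderiv i f • dx n i := by
    rw [← (dx n).sum_repr (KaehlerDifferential.D ℂ (PolyRing n) f)]
    simp [dx, KaehlerDifferential.mvPolynomialBasis_repr_apply]
  have hω' : dfWedge f j ω = ∑ s, ∑ i, (((dx n).exteriorPower j).repr ω s *
      MvPolynomial.pderiv i f) • (exteriorPower.ιMulti (PolyRing n) (j + 1) (fun a => dx n
        ((Fin.cons i (Set.powersetCard.ofFinEmbEquiv.symm s) : Fin (j + 1) → Fin n) a)) :
        forms n (j + 1)) := by
    conv_lhs => rw [← hsum]
    refine (map_sum (dfWedge f j) _ _).trans (Finset.sum_congr rfl fun s _ => ?_)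
    refine (map_smul (dfWedge f j) _ _).trans ?_
    simp_rw [mul_smul]
    rw [← Finset.smul_sum]
    congr 1
    refine Subtype.ext ?_
    change ExteriorAlgebra.ι (PolyRing n) (KaehlerDifferential.D ℂ (PolyRing n) f) *
      (((dx n).exteriorPower j s : ⋀[PolyRing n]^j (KaehlerDifferential ℂ (PolyRing n))) :
        ExteriorAlgebra (PolyRing n) (KaehlerDifferential ℂ (PolyRing n))) =
      Submodule.subtype _ (∑ i, MvPolynomial.pderiv i f •
        exteriorPower.ιMulti (PolyRing n) (j + 1) (fun a => dx n
        ((Fin.cons i (Set.powersetCard.ofFinEmbEquiv.symm s) : Fin (j + 1) → Fin n) a)))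
    rw [map_sum, hdf, map_sum, Finset.sum_mul, exteriorPower.basis_apply]
    refine Finset.sum_congr rfl fun i _ => ?_
    rw [map_smul, map_smul, smul_mul_assoc]
    congr 1
    rw [Submodule.subtype_apply, exteriorPower.ιMulti_family]
    rw [exteriorPower.ιMulti_apply_coe, exteriorPower.ιMulti_apply_coe,
      ExteriorAlgebra.ιMulti_succ_apply]
    rfl
  rw [hω']
  refine sum_mem fun s _ => sum_mem fun i _ => ?_
  have := (forms n (j + 1)).smul_mem _ _ _ _
    (polyDeg_mul _ _ _ _ (hω s) (pderiv_mem_polyDeg hf i))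
    (iotaMulti_mem (Fin.cons i (Set.powersetCard.ofFinEmbEquiv.symm s) : Fin (j + 1) → Fin n))
  rwa [show k - (j : ℤ) + (d - 1) + ((j + 1 : ℕ) : ℤ) = k + d by push_cast; ring] at this

/-- The term `Ωʲ` of the Koszul complex of a polynomial of degree `d`, with the grading of the
shifted Koszul complex: it is the term `Ωʲ((j - n)d)` in complex degree `j - n`. -/
def koszulTerm (n d j : ℕ) : GrMod n :=
  (forms n j).shift (((j : ℤ) - n) * d)

/-- The Koszul differential `df ∧`, as a map between the terms of the shifted complex. -/
def koszulD (f : PolyRing n) (d j : ℕ) : koszulTerm n d j →ₗ[PolyRing n] koszulTerm n d (j + 1) :=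
  dfWedge f j

theorem koszulD_mem {d : ℕ} {f : PolyRing n} (hf : f.IsHomogeneous d) (j : ℕ) (k : ℤ)
    (ω : koszulTerm n d j) (hω : ω ∈ (koszulTerm n d j).deg k) :
    koszulD f d j ω ∈ (koszulTerm n d (j + 1)).deg k := by
  have := dfWedge_mem hf j _ ω hω
  rw [show k + ((j : ℤ) - n) * d + d = k + (((j + 1 : ℕ) : ℤ) - n) * d by push_cast; ring] at this
  exact this

/-- The cocycles of the Koszul complex in `Ωʲ`. -/
def koszulZ (f : PolyRing n) (d j : ℕ) : Submodule (PolyRing n) (koszulTerm n d j) :=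
  LinearMap.ker (koszulD f d j)

/-- The coboundaries of the Koszul complex in `Ωʲ`. -/
def koszulB (f : PolyRing n) (d : ℕ) : (j : ℕ) → Submodule (PolyRing n) (koszulTerm n d j)
  | 0 => ⊥
  | j + 1 => LinearMap.range (koszulD f d j)

theorem koszulB_homogeneous {d : ℕ} {f : PolyRing n} (hf : f.IsHomogeneous d) (j : ℕ) :
    (koszulTerm n d j).IsHomogeneous (koszulB f d j) := by
  cases j with
  | zero => exact GrMod.isHomogeneous_bot _
  | succ j => exact GrMod.isHomogeneous_range _ (koszulD_mem hf j)

/-- The cohomology of the Koszul complex at `Ωʲ`, i.e. the cohomology `H^{j-n}` of the shifted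
complex, as a graded module. -/
def koszulH {d : ℕ} {f : PolyRing n} (hf : f.IsHomogeneous d) (j : ℕ) : GrMod n :=
  (koszulTerm n d j).subquot (koszulZ f d j) (koszulB f d j)
    (GrMod.isHomogeneous_ker _ (koszulD_mem hf j)) (koszulB_homogeneous hf j)

/-- The class of a cocycle in the cohomology of the Koszul complex. -/
def koszulClass {d : ℕ} {f : PolyRing n} (hf : f.IsHomogeneous d) (j : ℕ) :
    koszulZ f d j →ₗ[PolyRing n] koszulH hf j :=
  GrMod.subquotMk _ _ _ _ _

/-- `M`, the cohomology in degree `0` of the shifted Koszul complex. -/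
def modM {d : ℕ} {f : PolyRing n} (hf : f.IsHomogeneous d) : GrMod n := koszulH hf n

/-- `N`, the cohomology in degree `-1` of the shifted Koszul complex. -/
def modN {d : ℕ} {f : PolyRing n} (hf : f.IsHomogeneous d) : GrMod n := koszulH hf (n - 1)

/-- `M' = H⁰_𝔪 M`. -/
def modM' {d : ℕ} {f : PolyRing n} (hf : f.IsHomogeneous d) : GrMod n :=
  (modM hf).sub (modM hf).torsion (modM hf).isHomogeneous_torsion

/-- `M'' = M / M'`. -/
def modM'' {d : ℕ} {f : PolyRing n} (hf : f.IsHomogeneous d) : GrMod n :=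
  (modM hf).quot (modM hf).torsion (modM hf).isHomogeneous_torsion

/-- The inclusion `M' → M`. -/
def inclM' {d : ℕ} {f : PolyRing n} (hf : f.IsHomogeneous d) : modM' hf →ₗ[PolyRing n] modM hf :=
  (modM hf).torsion.subtype

/-- The projection `M → M''`. -/
def projM'' {d : ℕ} {f : PolyRing n} (hf : f.IsHomogeneous d) : modM hf →ₗ[PolyRing n] modM'' hf :=
  (modM hf).torsion.mkQ

/-- A resolution of a graded module by graded free modules of finite rank. -/
structure FreeResolution (A : GrMod n) where
  rank : ℕ → ℕ
  /-- the degrees of the basis vectors -/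
  degs : ∀ j, Fin (rank j) → ℤ
  d : ∀ j, GrMod.free (n := n) (degs (j + 1)) →ₗ[PolyRing n] GrMod.free (n := n) (degs j)
  aug : GrMod.free (n := n) (degs 0) →ₗ[PolyRing n] A
  d_mem : ∀ j k, ∀ v ∈ (GrMod.free (degs (j + 1))).deg k, d j v ∈ (GrMod.free (degs j)).deg k
  aug_mem : ∀ k, ∀ v ∈ (GrMod.free (degs 0)).deg k, aug v ∈ A.deg k
  aug_surjective : Function.Surjective aug
  exact_zero : LinearMap.ker aug = LinearMap.range (d 0)
  exact_succ : ∀ j, LinearMap.ker (d j) = LinearMap.range (d (j + 1))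

/-- A homogeneous surjection from a graded free module of finite rank. -/
theorem exists_cover (A : GrMod n) [Module.Finite (PolyRing n) A] :
    ∃ (r : ℕ) (δ : Fin r → ℤ) (ε : GrMod.free (n := n) δ →ₗ[PolyRing n] A),
      (∀ k, ∀ v ∈ (GrMod.free δ).deg k, ε v ∈ A.deg k) ∧ Function.Surjective ε := by
  classical
  obtain ⟨S, hS⟩ := (Module.Finite.fg_top : (⊤ : Submodule (PolyRing n) A).FG)
  let T : Finset (ℤ × A) :=
    S.biUnion fun s => (A.proj_fin s).toFinset.image fun k => (k, A.proj k s)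
  have hT : ∀ t ∈ T, t.2 ∈ A.deg t.1 := by
    intro t ht
    simp only [T, Finset.mem_biUnion, Finset.mem_image] at ht
    obtain ⟨s, _, k, _, rfl⟩ := ht
    exact A.proj_mem k s
  let e := T.equivFin.symm
  let δ : Fin T.card → ℤ := fun i => (e i).1.1
  let ε : GrMod.free (n := n) δ →ₗ[PolyRing n] A := (GrMod.freeBasis δ).constr ℕ fun i => (e i).1.2
  have hε : ∀ i, ε (GrMod.freeBasis δ i) = (e i).1.2 := fun i => Module.Basis.constr_basis _ _ _ _
  refine ⟨T.card, δ, ε, ?_, ?_⟩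
  · intro k v hv
    have := GrMod.free_map_mem δ A 0 ε (fun i => by
      rw [hε, add_zero]; exact hT _ (e i).2) k v hv
    rwa [add_zero] at this
  · rw [← LinearMap.range_eq_top, ← top_le_iff, ← hS, Submodule.span_le]
    intro s hs
    rw [← A.sum_proj s]
    refine Submodule.sum_mem _ fun k hk => ?_
    have hmem : (k, A.proj k s) ∈ T :=
      Finset.mem_biUnion.2 ⟨s, hs, Finset.mem_image.2 ⟨k, hk, rfl⟩⟩
    refine ⟨GrMod.freeBasis δ (e.symm ⟨_, hmem⟩), ?_⟩
    rw [hε, Equiv.apply_symm_apply]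

/-- Every finitely generated graded module has a graded free resolution. -/
theorem FreeResolution.nonempty (A : GrMod n) [hA : Module.Finite (PolyRing n) A] :
    Nonempty (FreeResolution A) := by
  let G := {A : GrMod n // Module.Finite (PolyRing n) A}
  choose r δ ε hε hsurj using fun B : G => @exists_cover n B.1 B.2
  let next : G → G := fun B =>
    ⟨(GrMod.free (δ B)).sub (LinearMap.ker (ε B)) (GrMod.isHomogeneous_ker (ε B) (hε B)), by
      have : Module.Finite (PolyRing n) (GrMod.free (n := n) (δ B)) :=
        Module.Finite.of_basis (GrMod.freeBasis (δ B))
      exact inferInstanceAs (Module.Finite (PolyRing n) (LinearMap.ker (ε B)))⟩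
  let seq : ℕ → G := fun j => Nat.rec ⟨A, hA⟩ (fun _ B => next B) j
  let incl : ∀ j, (seq (j + 1)).1 →ₗ[PolyRing n] GrMod.free (n := n) (δ (seq j)) := fun j =>
    (LinearMap.ker (ε (seq j))).subtype
  have hincl : ∀ j, Function.Injective (incl j) := fun j => Subtype.val_injective
  have hrange : ∀ j, LinearMap.range ((incl j).comp (ε (seq (j + 1)))) =
      LinearMap.ker (ε (seq j)) := by
    intro j
    rw [LinearMap.range_comp, LinearMap.range_eq_top.2 (hsurj (seq (j + 1))), Submodule.map_top]
    exact Submodule.range_subtype _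
  exact ⟨{
    rank := fun j => r (seq j)
    degs := fun j => δ (seq j)
    d := fun j => (incl j).comp (ε (seq (j + 1)))
    aug := ε (seq 0)
    d_mem := fun j k v hv => hε (seq (j + 1)) k v hv
    aug_mem := hε (seq 0)
    aug_surjective := hsurj (seq 0)
    exact_zero := (hrange 0).symm
    exact_succ := fun j => by
      rw [hrange (j + 1), LinearMap.ker_comp, LinearMap.ker_eq_bot.2 (hincl j)]
      rfl }⟩

instance (n d j : ℕ) : Module.Finite (PolyRing n) (koszulTerm n d j) :=
  Module.Finite.of_basis (M := ⋀[PolyRing n]^j (KaehlerDifferential ℂ (PolyRing n)))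
    ((dx n).exteriorPower j)

instance {d : ℕ} {f : PolyRing n} (hf : f.IsHomogeneous d) (j : ℕ) :
    Module.Finite (PolyRing n) (koszulH hf j) :=
  inferInstanceAs (Module.Finite (PolyRing n)
    (koszulZ f d j ⧸ (koszulB f d j).submoduleOf (koszulZ f d j)))

instance {d : ℕ} {f : PolyRing n} (hf : f.IsHomogeneous d) : Module.Finite (PolyRing n) (modM hf) :=
  inferInstanceAs (Module.Finite (PolyRing n) (koszulH hf n))

instance {d : ℕ} {f : PolyRing n} (hf : f.IsHomogeneous d) : Module.Finite (PolyRing n) (modN hf) :=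
  inferInstanceAs (Module.Finite (PolyRing n) (koszulH hf (n - 1)))

instance {d : ℕ} {f : PolyRing n} (hf : f.IsHomogeneous d) : Module.Finite (PolyRing n) (modM' hf) :=
  inferInstanceAs (Module.Finite (PolyRing n) (modM hf).torsion)

instance {d : ℕ} {f : PolyRing n} (hf : f.IsHomogeneous d) : Module.Finite (PolyRing n) (modM'' hf) :=
  inferInstanceAs (Module.Finite (PolyRing n) (modM hf ⧸ (modM hf).torsion))

namespace FreeResolution

variable {A : GrMod n}

/-- The `j`-th term of a resolution. -/
abbrev X (P : FreeResolution A) (j : ℕ) : GrMod n := GrMod.free (P.degs j)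

/-- The graded module `Hom_R(P_j, Ωⁿ)`. -/
def dualTerm (P : FreeResolution A) (j : ℕ) : GrMod n := GrMod.homFree (P.degs j) (forms n n)

/-- The differential `Hom_R(P_j, Ωⁿ) → Hom_R(P_{j+1}, Ωⁿ)`. -/
def dualD (P : FreeResolution A) (j : ℕ) : P.dualTerm j →ₗ[PolyRing n] P.dualTerm (j + 1) :=
  LinearMap.lcomp (PolyRing n) (forms n n) (P.d j)

theorem dualD_mem (P : FreeResolution A) (j : ℕ) (k : ℤ) (α : P.dualTerm j)
    (hα : α ∈ (P.dualTerm j).deg k) : P.dualD j α ∈ (P.dualTerm (j + 1)).deg k :=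
  fun e v hv => hα e _ (P.d_mem j e v hv)

/-- The cocycles in `Hom_R(P_j, Ωⁿ)`. -/
def extZ (P : FreeResolution A) (j : ℕ) : Submodule (PolyRing n) (P.dualTerm j) :=
  LinearMap.ker (P.dualD j)

/-- The coboundaries in `Hom_R(P_j, Ωⁿ)`. -/
def extB (P : FreeResolution A) : (j : ℕ) → Submodule (PolyRing n) (P.dualTerm j)
  | 0 => ⊥
  | j + 1 => LinearMap.range (P.dualD j)

theorem extB_homogeneous (P : FreeResolution A) (j : ℕ) :
    (P.dualTerm j).IsHomogeneous (P.extB j) := by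
  cases j with
  | zero => exact GrMod.isHomogeneous_bot _
  | succ j => exact GrMod.isHomogeneous_range _ (P.dualD_mem j)

/-- The graded module `Extʲ_R(A, Ωⁿ)`, computed by the resolution `P` of `A`. -/
def ext (P : FreeResolution A) (j : ℕ) : GrMod n :=
  (P.dualTerm j).subquot (P.extZ j) (P.extB j)
    (GrMod.isHomogeneous_ker _ (P.dualD_mem j)) (P.extB_homogeneous j)

/-- The class in `Extʲ_R(A, Ωⁿ)` of a cocycle. -/
def extClass (P : FreeResolution A) (j : ℕ) : P.extZ j →ₗ[PolyRing n] P.ext j :=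
  GrMod.subquotMk _ _ _ _ _

/-- The value of a cocycle at an element of `P_j`. -/
def eval (P : FreeResolution A) {j : ℕ} (α : P.extZ j) (v : P.X j) : forms n n :=
  (show P.X j →ₗ[PolyRing n] forms n n from α.1) v

/-- The dual `D_i(A) = Ext^{n-i}_R(A, Ωⁿ)`, for `i ≤ n`. -/
abbrev D (P : FreeResolution A) (i : ℕ) : GrMod n := P.ext (n - i)

end FreeResolution

/-- `θ` is a morphism of complexes between resolutions of `A` and `B` that lifts `g : A → B`. -/
structure IsLift {A B : GrMod n} (P : FreeResolution A) (Q : FreeResolution B)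
    (g : A →ₗ[PolyRing n] B) (θ : ∀ j, P.X j →ₗ[PolyRing n] Q.X j) : Prop where
  aug : ∀ v, Q.aug (θ 0 v) = g (P.aug v)
  comm : ∀ j v, Q.d j (θ (j + 1) v) = θ j (P.d j v)

/-- `φ` is a morphism of complexes from the Koszul complex to a resolution `P` of `M`, which
induces the identity of `M = H⁰`. Its component `Ωⁱ → P_j` is given for `i + j = n`. -/
structure IsLiftFromKoszul {d : ℕ} {f : PolyRing n} (hf : f.IsHomogeneous d)
    (P : FreeResolution (modM hf))
    (φ : ∀ i j, i + j = n → (forms n i →ₗ[PolyRing n] P.X j)) : Prop where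
  aug : ∀ ω : koszulZ f d n, P.aug (φ n 0 rfl ω.1) = koszulClass hf n ω
  comm : ∀ i j (h : i + 1 + j = n) (ω : forms n i),
    P.d j (φ i (j + 1) (by omega) ω) = φ (i + 1) j h (dfWedge f i ω)

/-- `ψ` is a morphism of complexes from `Q[1]`, where `Q` is a resolution of `N`, to the Koszul
complex, which induces the identity of `N = H⁻¹`. Its component `Q_j → Ωⁱ` is given for
`i + j = n - 1`. -/
structure IsLiftToKoszul {d : ℕ} {f : PolyRing n} (hf : f.IsHomogeneous d)
    (Q : FreeResolution (modN hf))
    (ψ : ∀ i j, i + j + 1 = n → (Q.X j →ₗ[PolyRing n] forms n i)) : Prop where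
  aug : ∀ (h : n - 1 + 0 + 1 = n) (v : Q.X 0), ∃ ω : koszulZ f d (n - 1),
    ω.1 = ψ (n - 1) 0 h v ∧ koszulClass hf (n - 1) ω = Q.aug v
  comm : ∀ i j (h : i + (j + 1) + 1 = n) (v : Q.X (j + 1)),
    dfWedge f i (ψ i (j + 1) h v) = ψ (i + 1) j (by omega) (Q.d j v)
  comm_last : ∀ j (h : 0 + j + 1 = n) (v : Q.X (j + 1)), ψ 0 j h (Q.d j v) = 0

/-- The ideal of the scheme `Sing f⁻¹(0) = {f = ∂f/∂x₁ = ⋯ = ∂f/∂xₙ = 0}`. -/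
def singIdeal (f : PolyRing n) : Ideal (PolyRing n) :=
  Ideal.span (insert f (Set.range fun i => MvPolynomial.pderiv i f))

/-- The depth of a module over a local ring: the supremum of the lengths of the regular sequences
in the maximal ideal. -/
def depth (A : Type) [CommRing A] [IsLocalRing A] (M : Type) [AddCommGroup M] [Module A M] : ℕ∞ :=
  ⨆ (l : List A) (_ : ∀ a ∈ l, a ∈ IsLocalRing.maximalIdeal A)
    (_ : RingTheory.Sequence.IsRegular M l), (l.length : ℕ∞)

/-- A (finitely generated) module is Cohen-Macaulay if the depth of its localization at every
maximal ideal of its support equals the dimension of the localization. -/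
def IsCohenMacaulay (A : Type) [CommRing A] (M : Type) [AddCommGroup M] [Module A M] : Prop :=
  ∀ p ∈ Module.support A M, p.asIdeal.IsMaximal →
    Module.supportDim (Localization.AtPrime p.asIdeal) (LocalizedModule.AtPrime p.asIdeal M) =
      (depth (Localization.AtPrime p.asIdeal) (LocalizedModule.AtPrime p.asIdeal M) : WithBot ℕ∞)

end KoszulDuality

end

open KoszulDuality

/-! Write Eʲ(A) for Extʲ(A, Ωⁿ) and J for the ideal of Sing f⁻¹(0). The theorem follows from
vanishing of Ext and from one exact triangle.

Vanishing. The variables form a regular sequence, so Rees' theorem below n and the bound on the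
projective dimension above n give Eʲ(R/𝔪) = 0 for j ≠ n; dévissage extends this to finitely
generated modules killed by a power of 𝔪 (`extVanish_of_pow_maxIdeal`). As dim R/J ≤ 1, a general
linear form ℓ satisfies 𝔪ᵏ ⊆ J + (ℓ) (`exists_linear_form`). Contraction with ∂/∂xᵢ is a homotopy
for multiplication by ∂f/∂xᵢ, so, with Euler's formula, J kills the Koszul cohomology. On a finitely
generated graded module A killed by J, kernel and cokernel of ℓ are killed by 𝔪ᵏ; multiplication by
ℓ on Eʲ(A) factors through Eʲ(ℓA) and is therefore surjective for j ≠ n - 1, n, and the graded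
Nakayama lemma gives Eʲ(A) = 0 (`extVanish_of_linear_form`). If ℓ is injective on A, this includes j
= n.

Exactness. If the Koszul complex is exact below Ωⁱ, its truncation is a free resolution of length i
of Ωⁱ/df∧Ωⁱ⁻¹, and a module E with Eʲ(E) = 0 for all j ≤ i has no nonzero map to this cokernel
(`map_eq_zero_of_extVanish`). For E = Hⁱ this gives by induction exactness at Ωⁱ for i < n - 1
(`koszul_exact`); for E the kernel of ℓ on N it shows that ℓ is injective on N (`modN_regular`).

Duality. Hence only M and N survive, and the cone of N[1] → Koszul complex resolves M
(`cone_koszul_isRes`). Dualizing it, and identifying the Koszul complex with its dual by the wedge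
product, gives Eⁿ⁻¹(M) = N, because Eⁿ⁻²(N) = Eⁿ⁻³(N) = 0, and an exact sequence 0 → Eⁿ(M) → M →
Eⁿ⁻¹(N) → 0, up to shifts. Here Eⁿ(M) = Eⁿ(M') is killed by a power of 𝔪, while ℓ is injective on
Eⁿ⁻¹(N); so the image of Eⁿ(M) is exactly M', and Eⁿ⁻¹(N) = M''. The remaining isomorphisms come
from 0 → M' → M → M'' → 0.

Gradings. All lifts of a given map are homotopic, and the degree-zero component of a lift is again a
lift; so the isomorphisms can be computed with any lift, and their degrees with a homogeneous one.

Cohen–Macaulayness. At the maximal ideal of a point z, ℓ - ℓ(z) is a nonzerodivisor on M'' and N. -/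

noncomputable section

namespace KoszulDuality

/-! ### Complexes of projective modules, resolutions and lifts -/

variable {R : Type} [CommRing R]

/-- A complex `⋯ → X 1 → X 0` of projective modules. -/
structure ProjComplex (R : Type) [CommRing R] where
  X : ℕ → Type
  [addCommGroup : ∀ j, AddCommGroup (X j)]
  [module : ∀ j, Module R (X j)]
  [projective : ∀ j, Module.Projective R (X j)]
  d : ∀ j, X (j + 1) →ₗ[R] X j
  d_d : ∀ j x, d j (d (j + 1) x) = 0

attribute [instance] ProjComplex.addCommGroup ProjComplex.module ProjComplex.projective

namespace ProjComplex

section Cohomology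

variable (C : ProjComplex R) (W : Type) [AddCommGroup W] [Module R W]

/-- The differential of the complex `Hom(C, W)`. -/
def dualD (j : ℕ) : (C.X j →ₗ[R] W) →ₗ[R] (C.X (j + 1) →ₗ[R] W) :=
  LinearMap.lcomp R W (C.d j)

/-- The cocycles of `Hom(C, W)`. -/
def Z (j : ℕ) : Submodule R (C.X j →ₗ[R] W) :=
  LinearMap.ker (C.dualD W j)

/-- The coboundaries of `Hom(C, W)`. -/
def B : (j : ℕ) → Submodule R (C.X j →ₗ[R] W)
  | 0 => ⊥
  | j + 1 => LinearMap.range (C.dualD W j)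

/-- The cohomology of `Hom(C, W)`. -/
abbrev H (j : ℕ) : Type := C.Z W j ⧸ (C.B W j).submoduleOf (C.Z W j)

/-- The class of a cocycle. -/
def cls (j : ℕ) : C.Z W j →ₗ[R] C.H W j := ((C.B W j).submoduleOf (C.Z W j)).mkQ

variable {C W}

theorem mem_Z {j : ℕ} {α : C.X j →ₗ[R] W} : α ∈ C.Z W j ↔ ∀ x, α (C.d j x) = 0 :=
  LinearMap.ext_iff

theorem mem_B_zero {α : C.X 0 →ₗ[R] W} : α ∈ C.B W 0 ↔ α = 0 := Iff.rfl

theorem mem_B_succ {j : ℕ} {α : C.X (j + 1) →ₗ[R] W} :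
    α ∈ C.B W (j + 1) ↔ ∃ β : C.X j →ₗ[R] W, ∀ x, α x = β (C.d j x) := by
  constructor
  · rintro ⟨β, rfl⟩
    exact ⟨β, fun _ => rfl⟩
  · rintro ⟨β, h⟩
    exact ⟨β, LinearMap.ext fun x => (h x).symm⟩

theorem cls_surjective (j : ℕ) : Function.Surjective (C.cls W j) := Submodule.mkQ_surjective _

theorem cls_eq_zero {j : ℕ} {α : C.Z W j} : C.cls W j α = 0 ↔ α.1 ∈ C.B W j :=
  (Submodule.Quotient.mk_eq_zero _).trans Iff.rfl

theorem cls_eq {j : ℕ} {α β : C.Z W j} : C.cls W j α = C.cls W j β ↔ α.1 - β.1 ∈ C.B W j := by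
  rw [← sub_eq_zero, ← map_sub, cls_eq_zero]; rfl

variable (C W)

/-- `Hom(C, W)` is exact in degree `j`. -/
def Acyclic (j : ℕ) : Prop := C.Z W j ≤ C.B W j

variable {C W}

theorem acyclic_iff_subsingleton {j : ℕ} : C.Acyclic W j ↔ Subsingleton (C.H W j) := by
  rw [Submodule.Quotient.subsingleton_iff, Submodule.submoduleOf_eq_top]
  rfl

theorem Acyclic.cls_eq_zero {j : ℕ} (h : C.Acyclic W j) (a : C.H W j) : a = 0 := by
  have := acyclic_iff_subsingleton.1 h
  exact Subsingleton.elim _ _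

end Cohomology

/-- Morphisms of complexes. -/
structure Hom (C D : ProjComplex R) where
  f : ∀ j, C.X j →ₗ[R] D.X j
  comm : ∀ j x, D.d j (f (j + 1) x) = f j (C.d j x)

namespace Hom

variable {C D E : ProjComplex R} {W : Type} [AddCommGroup W] [Module R W]

theorem comp_mem_Z (θ : Hom C D) {j : ℕ} {α : D.X j →ₗ[R] W} (h : α ∈ D.Z W j) :
    α ∘ₗ θ.f j ∈ C.Z W j := by
  rw [mem_Z] at h ⊢
  intro x
  rw [LinearMap.comp_apply, ← θ.comm, h]

theorem comp_mem_B (θ : Hom C D) {j : ℕ} {α : D.X j →ₗ[R] W} (h : α ∈ D.B W j) :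
    α ∘ₗ θ.f j ∈ C.B W j := by
  cases j with
  | zero =>
    rw [mem_B_zero] at h ⊢
    rw [h, LinearMap.zero_comp]
  | succ j =>
    rw [mem_B_succ] at h ⊢
    obtain ⟨β, h⟩ := h
    exact ⟨β ∘ₗ θ.f j, fun x => by simp [h, θ.comm]⟩

variable (W) in
/-- The map of cocycles induced by a morphism of complexes. -/
def mapZ (θ : Hom C D) (j : ℕ) : D.Z W j →ₗ[R] C.Z W j :=
  (LinearMap.lcomp R W (θ.f j)).restrict fun _ h => θ.comp_mem_Z h

@[simp]
theorem mapZ_apply (θ : Hom C D) (j : ℕ) (α : D.Z W j) (x : C.X j) :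
    (θ.mapZ W j α).1 x = α.1 (θ.f j x) := rfl

variable (W) in
/-- The map of cohomology induced by a morphism of complexes. -/
def map (θ : Hom C D) (j : ℕ) : D.H W j →ₗ[R] C.H W j :=
  Submodule.mapQ _ _ (θ.mapZ W j) fun _ h => θ.comp_mem_B h

@[simp]
theorem map_cls (θ : Hom C D) (j : ℕ) (α : D.Z W j) :
    θ.map W j (D.cls W j α) = C.cls W j (θ.mapZ W j α) := rfl

/-- The identity. -/
def id (C : ProjComplex R) : Hom C C := ⟨fun _ => LinearMap.id, fun _ _ => rfl⟩

/-- The composition. -/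
def comp (θ : Hom C D) (η : Hom D E) : Hom C E :=
  ⟨fun j => η.f j ∘ₗ θ.f j, fun j x => by simp [η.comm, θ.comm]⟩

theorem map_id (j : ℕ) (a : C.H W j) : (id C).map W j a = a := by
  obtain ⟨α, rfl⟩ := cls_surjective j a
  rfl

theorem map_comp (θ : Hom C D) (η : Hom D E) (j : ℕ) (a : E.H W j) :
    (θ.comp η).map W j a = θ.map W j (η.map W j a) := by
  obtain ⟨α, rfl⟩ := cls_surjective j a
  rfl

/-- The multiplication by a scalar. -/
def smul (C : ProjComplex R) (r : R) : Hom C C :=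
  ⟨fun _ => r • LinearMap.id, fun _ _ => by simp⟩

theorem map_smul (r : R) (j : ℕ) (a : C.H W j) : (smul C r).map W j a = r • a := by
  obtain ⟨α, rfl⟩ := cls_surjective j a
  rw [map_cls, ← _root_.map_smul]
  congr 1
  ext x
  simp [smul]

end Hom

/-- `ε` makes `C` a resolution of `A`. -/
structure IsRes (C : ProjComplex R) {A : Type} [AddCommGroup A] [Module R A]
    (ε : C.X 0 →ₗ[R] A) : Prop where
  surj : Function.Surjective ε
  aug_d : ∀ x, ε (C.d 0 x) = 0
  exact_zero : ∀ x, ε x = 0 → ∃ y, C.d 0 y = x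
  exact_succ : ∀ j x, C.d j x = 0 → ∃ y, C.d (j + 1) y = x

section Lift

/-- Projectivity in elementwise form: `q` need not be surjective, it only has to reach the image of
`g`. -/
theorem exists_lift {P M N : Type} [AddCommGroup P] [Module R P] [Module.Projective R P]
    [AddCommGroup M] [Module R M] [AddCommGroup N] [Module R N] (g : P →ₗ[R] N) (q : M →ₗ[R] N)
    (h : ∀ x, ∃ y, q y = g x) : ∃ l : P →ₗ[R] M, ∀ x, q (l x) = g x := by
  obtain ⟨l, hl⟩ := Module.projective_lifting_property q.rangeRestrict
    (g.codRestrict (LinearMap.range q) h) q.surjective_rangeRestrict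
  exact ⟨l, fun x => congrArg Subtype.val (LinearMap.congr_fun hl x)⟩

variable {C D : ProjComplex R} {A B : Type} [AddCommGroup A] [Module R A] [AddCommGroup B]
  [Module R B] {δ : D.X 0 →ₗ[R] B}

/-- Maps to a resolution lift to morphisms of complexes. -/
theorem exists_hom (hD : IsRes D δ) (g : C.X 0 →ₗ[R] B) (hg : ∀ x, g (C.d 0 x) = 0) :
    ∃ θ : Hom C D, ∀ x, δ (θ.f 0 x) = g x := by
  -- The recursion carries two consecutive components and their commuting square, since the next
  -- component is a lift that depends on this square.
  let S : ℕ → Type := fun j => {p : (C.X j →ₗ[R] D.X j) × (C.X (j + 1) →ₗ[R] D.X (j + 1)) //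
    ∀ x, D.d j (p.2 x) = p.1 (C.d j x)}
  obtain ⟨θ0, h0⟩ := exists_lift g δ fun x => hD.surj _
  obtain ⟨θ1, h1⟩ := exists_lift (θ0 ∘ₗ C.d 0) (D.d 0) fun x =>
    hD.exact_zero _ (by rw [LinearMap.comp_apply, h0, hg])
  have step : ∀ j (p : S j), ∃ q : S (j + 1), q.1.1 = p.1.2 := by
    rintro j ⟨⟨u, v⟩, h⟩
    obtain ⟨w, hw⟩ := exists_lift (v ∘ₗ C.d (j + 1)) (D.d (j + 1)) fun x =>
      hD.exact_succ _ _ (by rw [LinearMap.comp_apply, h, C.d_d, map_zero])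
    exact ⟨⟨(v, w), hw⟩, rfl⟩
  choose next hnext using step
  let s : ∀ j, S j := fun j => Nat.rec ⟨(θ0, θ1), h1⟩ next j
  have hs : ∀ j, (s (j + 1)).1.1 = (s j).1.2 := fun j => hnext j (s j)
  refine ⟨⟨fun j => (s j).1.1, fun j x => ?_⟩, h0⟩
  rw [hs]
  exact (s j).2 x

variable {W : Type} [AddCommGroup W] [Module R W]

/-- The homotopy is built by degree: once `s` is known in degree `j`, the difference of `θ` and `s ∘
d` in degree `j + 1` consists of cycles, and these lift through the exact complex `D`. -/
theorem exists_homotopy (hD : IsRes D δ) (θ : Hom C D) (h : ∀ x, δ (θ.f 0 x) = 0) :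
    ∃ s : ∀ j, C.X j →ₗ[R] D.X (j + 1), (∀ x, θ.f 0 x = D.d 0 (s 0 x)) ∧
      ∀ j x, θ.f (j + 1) x = D.d (j + 1) (s (j + 1) x) + s j (C.d j x) := by
  let S : ℕ → Type := fun j => {s : C.X j →ₗ[R] D.X (j + 1) //
    ∀ x, D.d j (θ.f (j + 1) x - s (C.d j x)) = 0}
  obtain ⟨s0, h0⟩ := exists_lift (θ.f 0) (D.d 0) fun x => hD.exact_zero _ (h x)
  have step : ∀ j (s : S j), ∃ t : S (j + 1),
      ∀ x, θ.f (j + 1) x = D.d (j + 1) (t.1 x) + s.1 (C.d j x) := by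
    rintro j ⟨s, hs⟩
    obtain ⟨t, ht⟩ := exists_lift (θ.f (j + 1) - s ∘ₗ C.d j) (D.d (j + 1)) fun x =>
      hD.exact_succ _ _ (hs x)
    simp only [LinearMap.sub_apply, LinearMap.comp_apply] at ht
    refine ⟨⟨t, fun x => ?_⟩, fun x => ?_⟩
    · rw [map_sub, ht, θ.comm, C.d_d, map_zero, sub_zero, sub_self]
    · rw [ht, sub_add_cancel]
  choose next hnext using step
  let s : ∀ j, S j := fun j => Nat.rec ⟨s0, fun x => by
    rw [map_sub, h0, θ.comm, sub_self]⟩ next j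
  exact ⟨fun j => (s j).1, fun x => (h0 x).symm, fun j => hnext j (s j)⟩

/-- Morphisms to a resolution that agree on the augmentation induce the same map. -/
theorem map_eq_of_aug_eq (hD : IsRes D δ) (θ η : Hom C D)
    (h : ∀ x, δ (θ.f 0 x) = δ (η.f 0 x)) (j : ℕ) : θ.map W j = η.map W j := by
  -- The difference of the two morphisms vanishes on the augmentation, hence is null-homotopic;
  -- composing the homotopy with a cocycle gives the required primitive.
  let ρ : Hom C D := ⟨fun j => θ.f j - η.f j, fun j x => by simp [θ.comm, η.comm]⟩
  obtain ⟨s, h0, hs⟩ := exists_homotopy hD ρ fun x => by simp [ρ, h]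
  refine LinearMap.ext fun a => ?_
  obtain ⟨⟨α, hα⟩, rfl⟩ := cls_surjective j a
  rw [Hom.map_cls, Hom.map_cls, cls_eq]
  have hα' := mem_Z.1 hα
  have key : ∀ x, ((θ.mapZ W j ⟨α, hα⟩).1 - (η.mapZ W j ⟨α, hα⟩).1) x = α (ρ.f j x) := fun x =>
    (map_sub α _ _).symm
  cases j with
  | zero =>
    rw [mem_B_zero]
    ext x
    rw [key, h0, hα']; rfl
  | succ j =>
    rw [mem_B_succ]
    exact ⟨α ∘ₗ s j, fun x => by rw [key, hs, map_add, hα', zero_add]; rfl⟩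

theorem map_eq_zero_of_aug (hD : IsRes D δ) (θ : Hom C D)
    (h : ∀ x, δ (θ.f 0 x) = 0) (j : ℕ) (a : D.H W j) : θ.map W j a = 0 := by
  let o : Hom C D := ⟨fun j => 0, fun j x => by simp⟩
  rw [map_eq_of_aug_eq hD θ o (fun x => by simp [o, h])]
  obtain ⟨α, rfl⟩ := cls_surjective j a
  rw [Hom.map_cls, cls_eq_zero]
  convert Submodule.zero_mem _
  ext x
  simp [o]

/-- A scalar that kills the module kills the cohomology of its resolutions. -/
theorem smul_eq_zero (hD : IsRes D δ) {r : R} (hr : ∀ b : B, r • b = 0) (j : ℕ) (a : D.H W j) :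
    r • a = 0 := by
  rw [← Hom.map_smul]
  exact map_eq_zero_of_aug hD _ (fun x => by simp [Hom.smul, hr]) j a

/-- Resolutions of isomorphic modules have the same cohomology. -/
theorem map_bijective {γ : C.X 0 →ₗ[R] A} (hC : IsRes C γ) (hD : IsRes D δ) (e : A ≃ₗ[R] B)
    (θ : Hom C D) (hθ : ∀ x, δ (θ.f 0 x) = e (γ x)) (j : ℕ) :
    Function.Bijective (θ.map W j) := by
  obtain ⟨η, hη⟩ := exists_hom (C := D) hC (e.symm.toLinearMap ∘ₗ δ) (by simp [hD.aug_d])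
  simp only [LinearMap.comp_apply, LinearEquiv.coe_coe] at hη
  have h1 : ∀ a, θ.map W j (η.map W j a) = a := fun a => by
    rw [← Hom.map_comp, map_eq_of_aug_eq hC (θ.comp η) (Hom.id C), Hom.map_id]
    intro x
    simp [Hom.comp, Hom.id, hη, hθ]
  have h2 : ∀ a, η.map W j (θ.map W j a) = a := fun a => by
    rw [← Hom.map_comp, map_eq_of_aug_eq hD (η.comp θ) (Hom.id D), Hom.map_id]
    intro x
    simp [Hom.comp, Hom.id, hη, hθ]
  exact ⟨fun a b hab => by rw [← h2 a, hab, h2], fun b => ⟨_, h1 b⟩⟩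

theorem acyclic_of_equiv {γ : C.X 0 →ₗ[R] A} (hC : IsRes C γ) (hD : IsRes D δ) (e : A ≃ₗ[R] B)
    {j : ℕ} (h : C.Acyclic W j) : D.Acyclic W j := by
  obtain ⟨θ, hθ⟩ := exists_hom (C := C) hD (e.toLinearMap ∘ₗ γ) (by simp [hC.aug_d])
  rw [acyclic_iff_subsingleton] at h ⊢
  exact (map_bijective hC hD e θ hθ j).injective.subsingleton

end Lift

/-- The surjection from the free module on the elements of a module. -/
abbrev freeCover (B : ModuleCat.{0} R) : (B →₀ R) →ₗ[R] B :=
  Finsupp.linearCombination R _root_.id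

/-- The iterated kernels of the surjections from the free modules on all elements. -/
def syzygies (A : ModuleCat.{0} R) : ℕ → ModuleCat.{0} R
  | 0 => A
  | j + 1 => ModuleCat.of R (LinearMap.ker (freeCover (syzygies A j)))

/-- Every module has a resolution. -/
theorem exists_isRes (A : Type) [AddCommGroup A] [Module R A] :
    ∃ (C : ProjComplex R) (ε : C.X 0 →ₗ[R] A), IsRes C ε := by
  have hsurj : ∀ B : ModuleCat.{0} R, Function.Surjective (freeCover B) := fun B =>
    Finsupp.linearCombination_id_surjective R B
  let incl : ∀ j, syzygies (ModuleCat.of R A) (j + 1) →ₗ[R]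
      (syzygies (ModuleCat.of R A) j →₀ R) := fun j =>
    (LinearMap.ker (freeCover (syzygies (ModuleCat.of R A) j))).subtype
  have hincl : ∀ j, Function.Injective (incl j) := fun j => Subtype.val_injective
  have hε : ∀ j x, freeCover _ (incl j x) = 0 := fun j x => x.2
  have hker : ∀ j x, freeCover _ x = 0 → ∃ y, incl j y = x := fun j x hx => ⟨⟨x, hx⟩, rfl⟩
  refine ⟨{
    X := fun j => syzygies (ModuleCat.of R A) j →₀ R
    d := fun j => incl j ∘ₗ freeCover _
    d_d := fun j x => by
      rw [LinearMap.comp_apply, LinearMap.comp_apply, hε, map_zero] },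
    freeCover (ModuleCat.of R A), ?_, ?_, ?_, ?_⟩
  · exact hsurj _
  · intro x
    exact hε 0 _
  · intro x hx
    obtain ⟨y, hy⟩ := hker 0 x hx
    obtain ⟨z, rfl⟩ := hsurj _ y
    exact ⟨z, hy⟩
  · intro j x hx
    have : freeCover _ x = 0 := hincl j (hx.trans (map_zero _).symm)
    obtain ⟨y, hy⟩ := hker _ x this
    obtain ⟨z, rfl⟩ := hsurj _ y
    exact ⟨z, hy⟩

end ProjComplex

end KoszulDuality

end

/-! ### Shifts and mapping cones -/

noncomputable section

namespace KoszulDuality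

variable {R : Type} [CommRing R]

namespace ProjComplex

/-- The terms of the shifted complex. -/
def shX (C : ProjComplex R) : ℕ → Type
  | 0 => PUnit
  | j + 1 => C.X j

instance (C : ProjComplex R) : ∀ j, AddCommGroup (C.shX j)
  | 0 => inferInstanceAs (AddCommGroup PUnit)
  | j + 1 => C.addCommGroup j

instance (C : ProjComplex R) : ∀ j, Module R (C.shX j)
  | 0 => inferInstanceAs (Module R PUnit)
  | j + 1 => C.module j

instance (C : ProjComplex R) : ∀ j, Module.Projective R (C.shX j)
  | 0 => inferInstanceAs (Module.Projective R PUnit)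
  | j + 1 => C.projective j

/-- The differential of the shifted complex. -/
def shD (C : ProjComplex R) : ∀ j, C.shX (j + 1) →ₗ[R] C.shX j
  | 0 => 0
  | j + 1 => C.d j

/-- The complex shifted by one, with `0` in degree `0`. -/
def sh (C : ProjComplex R) : ProjComplex R where
  X := C.shX
  d := C.shD
  d_d
    | 0, _ => rfl
    | j + 1, x => C.d_d j x

theorem sh_zero (C : ProjComplex R) (x : C.sh.X 0) : x = 0 := Subsingleton.elim (α := PUnit) _ _

/-- The identification of the terms of a complex with those of the shifted complex. -/
def toSh (C : ProjComplex R) (j : ℕ) : C.X j ≃ₗ[R] C.sh.X (j + 1) := LinearEquiv.refl R (C.X j)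

theorem sh_d (C : ProjComplex R) (j : ℕ) (x : C.X (j + 1)) :
    C.sh.d (j + 1) (C.toSh (j + 1) x) = C.toSh j (C.d j x) := rfl

theorem toSh_symm_d (C : ProjComplex R) (j : ℕ) (x : C.sh.X (j + 2)) :
    (C.toSh j).symm (C.sh.d (j + 1) x) = C.d j ((C.toSh (j + 1)).symm x) := rfl

variable {C D L P : ProjComplex R} {W : Type} [AddCommGroup W] [Module R W]

theorem sh_acyclic_zero : C.sh.Acyclic W 0 := fun α _ => by
  rw [mem_B_zero]
  ext x
  rw [sh_zero C x, map_zero, map_zero]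

theorem sh_acyclic_succ {j : ℕ} (h : C.Acyclic W j) : C.sh.Acyclic W (j + 1) := by
  intro α hα
  have := h (x := α ∘ₗ (C.toSh j).toLinearMap) (mem_Z.2 fun x => mem_Z.1 hα (C.toSh (j + 1) x))
  rw [mem_B_succ]
  -- The coboundaries of degree 1 come from maps out of the zero term, those of higher degree from
  -- `C`.
  cases j with
  | zero =>
    rw [mem_B_zero] at this
    exact ⟨0, fun x => LinearMap.congr_fun this ((C.toSh 0).symm x)⟩
  | succ j =>
    obtain ⟨β, hβ⟩ := mem_B_succ.1 this
    exact ⟨β ∘ₗ (C.toSh j).symm.toLinearMap, fun x => hβ ((C.toSh (j + 1)).symm x)⟩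

/-- A morphism `L → P`, as a map from the shift of `L`. -/
def Hom.shf (θ : Hom L P) (j : ℕ) : L.sh.X (j + 1) →ₗ[R] P.X j :=
  θ.f j ∘ₗ (L.toSh j).symm.toLinearMap

theorem Hom.shf_comm (θ : Hom L P) (j : ℕ) (l : L.sh.X (j + 2)) :
    P.d j (θ.shf (j + 1) l) = θ.shf j (L.sh.d (j + 1) l) := θ.comm j _

theorem Hom.shf_toSh (θ : Hom L P) (j : ℕ) (l : L.X j) : θ.shf j (L.toSh j l) = θ.f j l := rfl

/-- The mapping cone. -/
def cone (θ : Hom L P) : ProjComplex R where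
  X j := P.X j × L.sh.X j
  d j := LinearMap.prod
    (P.d j ∘ₗ LinearMap.fst R _ _ + θ.shf j ∘ₗ LinearMap.snd R _ _)
    -- The sign cancels the two terms with `θ` in the square of the differential.
    (-(L.sh.d j ∘ₗ LinearMap.snd R _ _))
  d_d j x := by
    refine Prod.ext ?_ ?_
    · simp [P.d_d, θ.shf_comm]
    · simp [L.sh.d_d]

section Cone

variable (θ : Hom L P) (j : ℕ)

/-- The first component of the cone. -/
def coneInl : P.X j →ₗ[R] (cone θ).X j := LinearMap.inl R (P.X j) (L.sh.X j)

/-- The second component of the cone. -/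
def coneInr : L.sh.X j →ₗ[R] (cone θ).X j := LinearMap.inr R (P.X j) (L.sh.X j)

/-- The projection to the first component of the cone. -/
def coneFst : (cone θ).X j →ₗ[R] P.X j := LinearMap.fst R (P.X j) (L.sh.X j)

/-- The projection to the second component of the cone. -/
def coneSnd : (cone θ).X j →ₗ[R] L.sh.X j := LinearMap.snd R (P.X j) (L.sh.X j)

@[simp] theorem coneFst_inl (p : P.X j) : coneFst θ j (coneInl θ j p) = p := rfl
@[simp] theorem coneSnd_inl (p : P.X j) : coneSnd θ j (coneInl θ j p) = 0 := rfl
@[simp] theorem coneFst_inr (l : L.sh.X j) : coneFst θ j (coneInr θ j l) = 0 := rfl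
@[simp] theorem coneSnd_inr (l : L.sh.X j) : coneSnd θ j (coneInr θ j l) = l := rfl

theorem cone_decomp (x : (cone θ).X j) :
    coneInl θ j (coneFst θ j x) + coneInr θ j (coneSnd θ j x) = x :=
  Prod.ext (add_zero _) (zero_add _)

theorem cone_ext {x y : (cone θ).X j} (h1 : coneFst θ j x = coneFst θ j y)
    (h2 : coneSnd θ j x = coneSnd θ j y) : x = y := Prod.ext h1 h2

@[simp] theorem coneFst_d (x : (cone θ).X (j + 1)) : coneFst θ j ((cone θ).d j x) =
    P.d j (coneFst θ (j + 1) x) + θ.shf j (coneSnd θ (j + 1) x) := rfl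

@[simp] theorem coneSnd_d (x : (cone θ).X (j + 1)) : coneSnd θ j ((cone θ).d j x) =
    -L.sh.d j (coneSnd θ (j + 1) x) := rfl

end Cone

/-- The inclusion of the target into the cone. -/
def coneIncl (θ : Hom L P) : Hom P (cone θ) where
  f j := coneInl θ j
  comm j x := cone_ext _ _ (by simp) (by simp)

section LongExact

/-- Exactness of the long exact sequence at `H(P)`: if the pullback of `α` to `L` is the coboundary
of `β`, then `α` on `P` and `β` on the shift of `L` together form a cocycle of the cone. -/
theorem exists_of_map_eq_zero (θ : Hom L P) (j : ℕ) (a : P.H W j) (h : θ.map W j a = 0) :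
    ∃ t, (coneIncl θ).map W j t = a := by
  obtain ⟨⟨α, hα⟩, rfl⟩ := cls_surjective j a
  rw [Hom.map_cls, cls_eq_zero] at h
  have hα' := mem_Z.1 hα
  suffices ∃ γ : (cone θ).X j →ₗ[R] W, γ ∈ (cone θ).Z W j ∧ ∀ p, γ (coneInl θ j p) = α p by
    obtain ⟨γ, hγ, h⟩ := this
    refine ⟨(cone θ).cls W j ⟨γ, hγ⟩, ?_⟩
    rw [Hom.map_cls]
    congr 1
    exact Subtype.ext (LinearMap.ext h)
  cases j with
  | zero =>
    rw [mem_B_zero] at h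
    refine ⟨α ∘ₗ coneFst θ 0, mem_Z.2 fun x => ?_, fun p => rfl⟩
    have : ∀ l, α (θ.shf 0 l) = 0 := fun l => LinearMap.congr_fun h ((L.toSh 0).symm l)
    simp [hα', this]
  | succ j =>
    obtain ⟨β, hβ⟩ := mem_B_succ.1 h
    refine ⟨α ∘ₗ coneFst θ (j + 1) + β ∘ₗ (L.toSh j).symm.toLinearMap ∘ₗ coneSnd θ (j + 1),
      mem_Z.2 fun x => ?_, fun p => by simp⟩
    have : ∀ l, α (θ.shf (j + 1) l) = β (L.d j ((L.toSh (j + 1)).symm l)) := fun l => hβ _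
    simp [hα', this, toSh_symm_d]

/-- The kernel comes from the cohomology of the shift of `L`: if `α` is a coboundary of `γ` on `P`,
then its other component, corrected by `γ ∘ θ`, is a cocycle on the shift of `L`. -/
theorem coneIncl_injective (θ : Hom L P) {j : ℕ} (hL : L.sh.Acyclic W j) :
    Function.Injective ((coneIncl θ).map W j) := by
  rw [injective_iff_map_eq_zero]
  intro a h
  obtain ⟨⟨α, hα⟩, rfl⟩ := cls_surjective j a
  rw [Hom.map_cls, cls_eq_zero] at h
  rw [cls_eq_zero]
  have hα' := mem_Z.1 hα
  cases j with
  | zero =>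
    rw [mem_B_zero] at h ⊢
    ext x
    rw [← cone_decomp θ 0 x, sh_zero _ (coneSnd θ 0 x), map_zero, add_zero]
    exact LinearMap.congr_fun h _
  | succ j =>
    obtain ⟨γ, hγ⟩ := mem_B_succ.1 h
    have hγ' : ∀ p, α (coneInl θ (j + 1) p) = γ (P.d j p) := hγ
    have hb := hL (x := α ∘ₗ coneInr θ (j + 1) - γ ∘ₗ θ.shf j) (mem_Z.2 fun l => by
      have h1 := hα' (coneInr θ (j + 2) l)
      rw [show (cone θ).d (j + 1) (coneInr θ (j + 2) l) = coneInl θ (j + 1) (θ.shf (j + 1) l) -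
        coneInr θ (j + 1) (L.sh.d (j + 1) l) from cone_ext _ _ (by simp) (by simp), map_sub, hγ',
        θ.shf_comm] at h1
      rw [LinearMap.sub_apply, LinearMap.comp_apply, LinearMap.comp_apply, ← neg_sub, h1, neg_zero])
    obtain ⟨c, hc⟩ := mem_B_succ.1 hb
    rw [mem_B_succ]
    -- The minus sign compensates the one in the differential of the cone.
    refine ⟨γ ∘ₗ coneFst θ j - c ∘ₗ coneSnd θ j, fun x => ?_⟩
    have h1 := hc (coneSnd θ (j + 1) x)
    rw [LinearMap.sub_apply, LinearMap.comp_apply, LinearMap.comp_apply, sub_eq_iff_eq_add] at h1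
    conv_lhs => rw [← cone_decomp θ (j + 1) x]
    rw [map_add, h1, hγ']
    simp
    abel

/-- The connecting map: `β`, extended by zero on `P`, is a cocycle of the cone. If it is the
coboundary of `γ`, then `γ` restricts on `P` to a cocycle whose pullback differs from `β` by a
coboundary. -/
theorem map_surjective_of_cone (θ : Hom L P) {j : ℕ} (h : (cone θ).Acyclic W (j + 1)) :
    Function.Surjective (θ.map W j) := by
  intro b
  obtain ⟨⟨β, hβ⟩, rfl⟩ := cls_surjective j b
  have hβ' := mem_Z.1 hβ
  have := h (x := β ∘ₗ (L.toSh j).symm.toLinearMap ∘ₗ coneSnd θ (j + 1))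
    (mem_Z.2 fun x => by simp [toSh_symm_d, hβ'])
  obtain ⟨γ, hγ⟩ := mem_B_succ.1 this
  simp only [LinearMap.comp_apply, LinearEquiv.coe_coe] at hγ
  have hγ1 : ∀ p, γ (coneInl θ j (P.d j p)) = 0 := fun p => by
    have := hγ (coneInl θ (j + 1) p)
    rw [show (cone θ).d j (coneInl θ (j + 1) p) = coneInl θ j (P.d j p) from
      cone_ext _ _ (by simp) (by simp)] at this
    rw [← this]
    simp
  refine ⟨P.cls W j ⟨γ ∘ₗ coneInl θ j, mem_Z.2 hγ1⟩, ?_⟩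
  rw [Hom.map_cls, cls_eq]
  have key : ∀ l : L.X j, γ (coneInl θ j (θ.f j l)) - β l =
      γ (coneInr θ j (L.sh.d j (L.toSh j l))) := fun l => by
    have h1 := hγ (coneInr θ (j + 1) (L.toSh j l))
    rw [show (cone θ).d j (coneInr θ (j + 1) (L.toSh j l)) = coneInl θ j (θ.f j l) -
      coneInr θ j (L.sh.d j (L.toSh j l)) from
      cone_ext _ _ (by simp [Hom.shf_toSh]) (by simp), map_sub, coneSnd_inr,
      LinearEquiv.symm_apply_apply] at h1
    rw [h1, sub_sub_cancel]
  cases j with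
  | zero =>
    rw [mem_B_zero]
    ext l
    refine (key l).trans ?_
    rw [sh_zero _ (L.sh.d 0 _), map_zero, map_zero, LinearMap.zero_apply]
  | succ j => exact mem_B_succ.2 ⟨γ ∘ₗ coneInr θ (j + 1) ∘ₗ (L.toSh j).toLinearMap, key⟩

theorem map_injective_of_cone (θ : Hom L P) {j : ℕ} (h : (cone θ).Acyclic W j) :
    Function.Injective (θ.map W j) := by
  rw [injective_iff_map_eq_zero]
  intro a ha
  obtain ⟨t, rfl⟩ := exists_of_map_eq_zero θ j a ha
  rw [h.cls_eq_zero t, map_zero]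

end LongExact

section Resolution

variable {A B N : Type} [AddCommGroup A] [Module R A] [AddCommGroup B] [Module R B]
  [AddCommGroup N] [Module R N]

/-- The second component is lifted first, and the first is then corrected. In `hL` the element `p`
is kept because in the lowest degree `l` is a boundary only thanks to the relation with `p`. -/
theorem cone_exact (θ : Hom L P) (j : ℕ) (hP : ∀ x, P.d j x = 0 → ∃ y, P.d (j + 1) y = x)
    (hL : ∀ p l, P.d j p + θ.shf j l = 0 → L.sh.d j l = 0 → ∃ l', L.sh.d (j + 1) l' = l)
    (x : (cone θ).X (j + 1)) (hx : (cone θ).d j x = 0) : ∃ y, (cone θ).d (j + 1) y = x := by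
  have h1 := congrArg (coneFst θ j) hx
  have h2 := congrArg (coneSnd θ j) hx
  rw [coneFst_d, map_zero] at h1
  rw [coneSnd_d, map_zero, neg_eq_zero] at h2
  obtain ⟨l', hl'⟩ := hL _ _ h1 h2
  obtain ⟨y, hy⟩ := hP (coneFst θ (j + 1) x + θ.shf (j + 1) l') (by
    rw [map_add, θ.shf_comm, hl', h1])
  refine ⟨coneInl θ _ y - coneInr θ _ l', cone_ext _ _ ?_ ?_⟩
  · simp [hy]
  · simp [hl']

/-- The cone of a lift of an injective map is a resolution of the cokernel. -/
theorem isRes_cone {ε : L.X 0 →ₗ[R] A} {δ : P.X 0 →ₗ[R] B} (hL : IsRes L ε) (hP : IsRes P δ)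
    (θ : Hom L P) (g : A →ₗ[R] B) (hθ : ∀ x, δ (θ.f 0 x) = g (ε x)) (hg : Function.Injective g)
    (π : B →ₗ[R] N) (hπ : Function.Surjective π) (hker : ∀ b, π b = 0 ↔ ∃ a, g a = b) :
    IsRes (cone θ) (π ∘ₗ δ ∘ₗ coneFst θ 0) where
  surj := by
    intro y
    obtain ⟨b, rfl⟩ := hπ y
    obtain ⟨x, rfl⟩ := hP.surj b
    exact ⟨coneInl θ 0 x, by simp⟩
  aug_d := by
    intro x
    rw [LinearMap.comp_apply, LinearMap.comp_apply, coneFst_d, map_add, hP.aug_d, zero_add, hker]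
    exact ⟨_, (hθ _).symm⟩
  exact_zero := by
    intro x h
    obtain ⟨a, ha⟩ := (hker _).1 h
    obtain ⟨l, rfl⟩ := hL.surj a
    rw [LinearMap.comp_apply, ← hθ] at ha
    obtain ⟨y, hy⟩ := hP.exact_zero (coneFst θ 0 x - θ.f 0 l) (by rw [map_sub, ha, sub_self])
    refine ⟨coneInl θ 1 y + coneInr θ 1 (L.toSh 0 l), cone_ext _ _ ?_ ?_⟩
    · simp [hy, Hom.shf_toSh]
    · rw [sh_zero _ (coneSnd θ 0 _), sh_zero _ (coneSnd θ 0 _)]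
  exact_succ := by
    intro j x
    refine cone_exact θ j (hP.exact_succ j) (fun p l h1 h2 => ?_) x
    obtain ⟨l, rfl⟩ := (L.toSh j).surjective l
    cases j with
    | zero =>
      obtain ⟨y, rfl⟩ := hL.exact_zero l (hg (by
        have := congrArg δ h1
        rwa [map_add, hP.aug_d, zero_add, map_zero, Hom.shf_toSh, hθ, ← map_zero g] at this))
      exact ⟨L.toSh 1 y, rfl⟩
    | succ j =>
      obtain ⟨y, rfl⟩ := hL.exact_succ j l ((L.toSh j).injective (by rw [← sh_d, h2, map_zero]))
      exact ⟨L.toSh (j + 2) y, rfl⟩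

/-- The cone of a morphism from the shift of a resolution of the first homology is a resolution
of the zeroth homology. -/
theorem isRes_cone_sh {ε : L.X 0 →ₗ[R] A} {δ : P.X 0 →ₗ[R] B} (hL : IsRes L ε)
    (surj : Function.Surjective δ) (aug_d : ∀ x, δ (P.d 0 x) = 0)
    (exact_zero : ∀ x, δ x = 0 → ∃ y, P.d 0 y = x)
    (exact_succ : ∀ j x, P.d (j + 1) x = 0 → ∃ y, P.d (j + 2) y = x)
    (ψ : Hom L.sh P)
    (hsurj : ∀ z, P.d 0 z = 0 → ∃ v w, ψ.f 1 (L.toSh 0 v) + P.d 1 w = z)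
    (hinj : ∀ v w, ψ.f 1 (L.toSh 0 v) + P.d 1 w = 0 → ε v = 0) :
    IsRes (cone ψ) (δ ∘ₗ coneFst ψ 0) where
  surj := by
    intro y
    obtain ⟨x, rfl⟩ := surj y
    exact ⟨coneInl ψ 0 x, by simp⟩
  aug_d := by
    intro x
    have h0 : ∀ l, ψ.shf 0 l = 0 := fun l => (congrArg (ψ.f 0) (sh_zero L _)).trans (map_zero _)
    rw [LinearMap.comp_apply, coneFst_d, map_add, aug_d, zero_add, h0, map_zero]
  exact_zero := by
    intro x h
    obtain ⟨y, hy⟩ := exact_zero _ h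
    refine ⟨coneInl ψ 1 y, cone_ext _ _ ?_ ?_⟩
    · simp [hy]
    · rw [sh_zero _ (coneSnd ψ 0 _), sh_zero _ (coneSnd ψ 0 _)]
  exact_succ := by
    -- In degree 1 the shifted part vanishes and the surjectivity onto the first homology of `P` is
    -- needed; in degree 2 it is the injectivity; above that both complexes are exact.
    rintro (_ | j) x hx
    · have h0 : coneSnd ψ 1 x = 0 :=
        (L.sh.toSh 0).symm.injective ((sh_zero L _).trans (map_zero _).symm)
      have h1 := congrArg (coneFst ψ 0) hx
      rw [coneFst_d, h0, map_zero, add_zero, map_zero] at h1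
      obtain ⟨v, w, h⟩ := hsurj _ h1
      refine ⟨coneInl ψ 2 w + coneInr ψ 2 (L.sh.toSh 1 (L.toSh 0 v)), cone_ext _ _ ?_ ?_⟩
      · rw [← h]
        simp [Hom.shf_toSh, add_comm]
      · refine (L.sh.toSh 0).symm.injective ((sh_zero L _).trans (sh_zero L _).symm)
    · refine cone_exact ψ (j + 1) (exact_succ j) (fun p l h1 h2 => ?_) x hx
      obtain ⟨l, rfl⟩ := (L.sh.toSh (j + 1)).surjective l
      obtain ⟨l, rfl⟩ := (L.toSh j).surjective l
      rw [Hom.shf_toSh] at h1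
      cases j with
      | zero =>
        obtain ⟨y, rfl⟩ := hL.exact_zero l (hinj l p (by rw [add_comm, h1]))
        exact ⟨L.sh.toSh 2 (L.toSh 1 y), rfl⟩
      | succ j =>
        obtain ⟨y, rfl⟩ := hL.exact_succ j l
          ((L.toSh j).injective ((L.sh.toSh (j + 1)).injective (by
          rw [← sh_d, ← sh_d, h2, map_zero, map_zero])))
        exact ⟨L.sh.toSh (j + 3) (L.toSh (j + 2) y), rfl⟩

end Resolution

end ProjComplex

end KoszulDuality

end

/-! ### Vanishing of Ext, Rees' theorem and regular sequences -/

noncomputable section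

namespace KoszulDuality

variable {R : Type} [CommRing R]

open ProjComplex

/-- The vanishing of `Extʲ(A, W)`. -/
def ExtVanish (R : Type) [CommRing R] (W : Type) [AddCommGroup W] [Module R W] (A : Type)
    [AddCommGroup A] [Module R A]
    (j : ℕ) : Prop :=
  ∀ (C : ProjComplex R) (ε : C.X 0 →ₗ[R] A), IsRes C ε → C.Acyclic W j

section

variable {W : Type} [AddCommGroup W] [Module R W] {A B N : Type} [AddCommGroup A] [Module R A]
  [AddCommGroup B] [Module R B] [AddCommGroup N] [Module R N]

namespace ProjComplex

theorem Acyclic.of_equiv {C : ProjComplex R} {V : Type} [AddCommGroup V] [Module R V]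
    (e : W ≃ₗ[R] V) {j : ℕ} (h : C.Acyclic W j) : C.Acyclic V j := by
  intro α hα
  have := h (x := e.symm.toLinearMap ∘ₗ α) (mem_Z.2 fun x => by simp [mem_Z.1 hα])
  cases j with
  | zero =>
    rw [mem_B_zero] at this ⊢
    ext x
    simpa using LinearMap.congr_fun this x
  | succ j =>
    rw [mem_B_succ] at this ⊢
    obtain ⟨β, hβ⟩ := this
    exact ⟨e.toLinearMap ∘ₗ β, fun x => by simp [← hβ]⟩

theorem Acyclic.pi {C : ProjComplex R} {ι : Type} {j : ℕ} (h : C.Acyclic W j) :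
    C.Acyclic (ι → W) j := by
  intro α hα
  have := fun i => h (x := LinearMap.proj i ∘ₗ α) (mem_Z.2 fun x => by simp [mem_Z.1 hα])
  cases j with
  | zero =>
    simp only [mem_B_zero] at this ⊢
    ext x i
    exact LinearMap.congr_fun (this i) x
  | succ j =>
    simp only [mem_B_succ] at this ⊢
    choose β hβ using this
    exact ⟨LinearMap.pi β, fun x => funext fun i => hβ i x⟩

theorem Acyclic.of_free {C : ProjComplex R} {j : ℕ} (h : C.Acyclic R j) [Module.Finite R W]
    [Module.Free R W] : C.Acyclic W j := by
  obtain ⟨⟨ι, b⟩⟩ := Module.Free.exists_basis (R := R) (M := W)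
  cases subsingleton_or_nontrivial R
  · have := Module.subsingleton R W
    intro α _
    rw [Subsingleton.elim α 0]
    exact Submodule.zero_mem _
  have := Module.Finite.finite_basis b
  let b' := b.reindex (Finite.equivFin _)
  exact (h.pi (ι := Fin _)).of_equiv b'.equivFun.symm

end ProjComplex

theorem ExtVanish.of_isRes {C : ProjComplex R} {ε : C.X 0 →ₗ[R] A} (hC : IsRes C ε) {j : ℕ}
    (h : C.Acyclic W j) : ExtVanish R W A j :=
  fun _ _ hD => acyclic_of_equiv hC hD (LinearEquiv.refl R A) h

theorem ExtVanish.of_equiv (e : A ≃ₗ[R] B) {j : ℕ} (h : ExtVanish R W A j) : ExtVanish R W B j := by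
  obtain ⟨C, ε, hC⟩ := exists_isRes (R := R) A
  exact fun _ _ hD => acyclic_of_equiv hC hD e (h C ε hC)

theorem ExtVanish.of_subsingleton [Subsingleton A] (j : ℕ) : ExtVanish R W A j := by
  intro C ε hC
  rw [acyclic_iff_subsingleton]
  refine subsingleton_of_forall_eq 0 fun a => ?_
  have := smul_eq_zero hC (r := 1) (fun b => Subsingleton.elim _ _) j a
  rwa [one_smul] at this

/-- The cone construction for a short exact sequence `0 → A → B → N → 0`. -/
theorem exists_cone {g : A →ₗ[R] B} (hg : Function.Injective g) {π : B →ₗ[R] N}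
    (hπ : Function.Surjective π) (hker : ∀ b, π b = 0 ↔ ∃ a, g a = b)
    {P : ProjComplex R} {δ : P.X 0 →ₗ[R] B} (hP : IsRes P δ) :
    ∃ (L : ProjComplex R) (ε : L.X 0 →ₗ[R] A) (θ : Hom L P), IsRes L ε ∧
      (∀ x, δ (θ.f 0 x) = g (ε x)) ∧ IsRes (cone θ) (π ∘ₗ δ ∘ₗ coneFst θ 0) := by
  obtain ⟨L, ε, hL⟩ := exists_isRes (R := R) A
  obtain ⟨θ, hθ⟩ := exists_hom (C := L) hP (g ∘ₗ ε) (by simp [hL.aug_d])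
  exact ⟨L, ε, θ, hL, hθ, isRes_cone hL hP θ g hθ hg π hπ hker⟩

/-- The exact sequence Extʲ(N) → Extʲ(B) → Extʲ(A), with the cone as a resolution of `N`. -/
theorem ExtVanish.mid {g : A →ₗ[R] B} (hg : Function.Injective g) {π : B →ₗ[R] N}
    (hπ : Function.Surjective π) (hker : ∀ b, π b = 0 ↔ ∃ a, g a = b) {j : ℕ}
    (hA : ExtVanish R W A j) (hN : ExtVanish R W N j) : ExtVanish R W B j := by
  intro P δ hP
  obtain ⟨L, ε, θ, hL, -, hT⟩ := exists_cone hg hπ hker hP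
  have := acyclic_iff_subsingleton.1 (hA L ε hL)
  rw [acyclic_iff_subsingleton]
  exact (map_injective_of_cone θ (hN _ _ hT)).subsingleton

/-- The exact sequence Extʲ(A) → Extʲ⁺¹(N) → Extʲ⁺¹(B). -/
theorem ExtVanish.right {g : A →ₗ[R] B} (hg : Function.Injective g) {π : B →ₗ[R] N}
    (hπ : Function.Surjective π) (hker : ∀ b, π b = 0 ↔ ∃ a, g a = b) {j : ℕ}
    (hA : ExtVanish R W A j) (hB : ExtVanish R W B (j + 1)) : ExtVanish R W N (j + 1) := by
  obtain ⟨P, δ, hP⟩ := exists_isRes (R := R) B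
  obtain ⟨L, ε, θ, hL, -, hT⟩ := exists_cone hg hπ hker hP
  refine .of_isRes hT ?_
  have := acyclic_iff_subsingleton.1 (hB P δ hP)
  rw [acyclic_iff_subsingleton]
  exact (coneIncl_injective θ (sh_acyclic_succ (hA L ε hL))).subsingleton

/-- The multiplication by `r` on `Ext(A, W)` factors through `Ext(rA, W)`. -/
theorem exists_smul_factor {P : ProjComplex R} {δ : P.X 0 →ₗ[R] A} (hP : IsRes P δ) (r : R) :
    ∃ (L : ProjComplex R) (ε : L.X 0 →ₗ[R] LinearMap.ker (LinearMap.lsmul R A r)) (θ : Hom L P)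
      (η : Hom (cone θ) P) (ζ : (cone η).X 0 →ₗ[R] A ⧸ LinearMap.range (LinearMap.lsmul R A r)),
      IsRes L ε ∧ IsRes (cone η) ζ ∧
      ∀ j (a : P.H W j), r • a = (coneIncl θ).map W j (η.map W j a) := by
  let g := LinearMap.lsmul R A r
  -- The cone of `θ` resolves `rA`, as the quotient of `A` by the kernel of `r`.
  obtain ⟨L, ε, θ, hL, hθ, hT⟩ := exists_cone (g := (LinearMap.ker g).subtype)
    Subtype.val_injective (π := g.rangeRestrict) g.surjective_rangeRestrict
    (fun b => ⟨fun h => ⟨⟨b, congrArg Subtype.val h⟩, rfl⟩, by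
      rintro ⟨⟨a, ha⟩, rfl⟩
      exact Subtype.ext ha⟩) hP
  -- `η` lifts the inclusion of `rA` in `A`, so its cone resolves `A/rA`.
  obtain ⟨η, hη⟩ := exists_hom (C := cone θ) hP
    ((LinearMap.range g).subtype ∘ₗ (g.rangeRestrict ∘ₗ δ ∘ₗ coneFst θ 0))
    (fun x => by rw [LinearMap.comp_apply, hT.aug_d, map_zero])
  have hU := isRes_cone hT hP η (LinearMap.range g).subtype hη Subtype.val_injective
    (LinearMap.range g).mkQ (Submodule.mkQ_surjective _) (fun b => by
      rw [Submodule.mkQ_apply, Submodule.Quotient.mk_eq_zero]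
      exact ⟨fun h => ⟨⟨b, h⟩, rfl⟩, by
        rintro ⟨a, rfl⟩
        exact a.2⟩)
  refine ⟨L, ε, θ, η, _, hL, hU, fun j a => ?_⟩
  rw [← Hom.map_comp, ← Hom.map_smul]
  refine LinearMap.congr_fun (map_eq_of_aug_eq hP _ _ (fun x => ?_) j) a
  refine Eq.trans ?_ (hη _).symm
  simp [Hom.smul, coneIncl, g]

/-- Of the factors Extʲ(A) → Extʲ(rA) → Extʲ(A), the first is onto because Extʲ⁺¹(A/rA) vanishes,
the second because Extʲ(ker r) vanishes. -/
theorem smul_surjective_of_extVanish {P : ProjComplex R} {δ : P.X 0 →ₗ[R] A} (hP : IsRes P δ)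
    {r : R} {j : ℕ} (hK : ExtVanish R W (LinearMap.ker (LinearMap.lsmul R A r)) j)
    (hQ : ExtVanish R W (A ⧸ LinearMap.range (LinearMap.lsmul R A r)) (j + 1)) :
    Function.Surjective fun a : P.H W j => r • a := by
  obtain ⟨L, ε, θ, η, ζ, hL, hU, h⟩ := exists_smul_factor (W := W) hP r
  simp only [h]
  refine Function.Surjective.comp (g := (coneIncl θ).map W j) ?_
    (map_surjective_of_cone η (hQ _ _ hU))
  intro a
  exact exists_of_map_eq_zero θ j a ((hK _ _ hL).cls_eq_zero _)

/-- The same factorization: Extʲ(A/rA) = 0 makes the first factor injective, Extʲ⁻¹(ker r) = 0 the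
second. The form of `hK` makes it vacuous for `j = 0`. -/
theorem smul_injective_of_extVanish {P : ProjComplex R} {δ : P.X 0 →ₗ[R] A} (hP : IsRes P δ)
    {r : R} {j : ℕ}
    (hK : ∀ i, i + 1 = j → ExtVanish R W (LinearMap.ker (LinearMap.lsmul R A r)) i)
    (hQ : ExtVanish R W (A ⧸ LinearMap.range (LinearMap.lsmul R A r)) j) :
    Function.Injective fun a : P.H W j => r • a := by
  obtain ⟨L, ε, θ, η, ζ, hL, hU, h⟩ := exists_smul_factor (W := W) hP r
  simp only [h]
  refine Function.Injective.comp (g := (coneIncl θ).map W j) ?_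
    (map_injective_of_cone η (hQ _ _ hU))
  apply coneIncl_injective
  cases j with
  | zero => exact sh_acyclic_zero
  | succ j => exact sh_acyclic_succ (hK j rfl _ _ hL)

open RingTheory.Sequence Pointwise

/-- Rees: a regular sequence of length `r` that kills `A` makes `Extʲ(A, B)` vanish for `j < r`. -/
theorem acyclic_of_isWeaklyRegular {P : ProjComplex R} {δ : P.X 0 →ₗ[R] A} (hP : IsRes P δ)
    (rs : List R) : ∀ (B : Type) [AddCommGroup B] [Module R B], IsWeaklyRegular B rs →
    (∀ r ∈ rs, ∀ a : A, r • a = 0) → ∀ j < rs.length, P.Acyclic B j := by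
  induction rs with
  | nil => simp
  | cons r rs ih =>
    intro B _ _ hreg hkill j hj α hα
    rw [isWeaklyRegular_cons_iff] at hreg
    obtain ⟨hr, hreg⟩ := hreg
    have ih' := ih (QuotSMulTop r B) hreg fun r hr => hkill r (List.mem_cons_of_mem _ hr)
    have hq : ∀ b : B, (r • ⊤ : Submodule R B).mkQ b = 0 ↔ ∃ c, r • c = b := fun b => by
      rw [Submodule.mkQ_apply, Submodule.Quotient.mk_eq_zero,
        Submodule.mem_smul_pointwise_iff_exists]
      simp
    -- `r` kills `A`, hence its Ext: `r • α` is a coboundary. It remains to divide a primitive of it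
    -- by `r`.
    have h0 := smul_eq_zero hP (hkill r List.mem_cons_self) j (P.cls B j ⟨α, hα⟩)
    rw [← map_smul, cls_eq_zero] at h0
    have hα' := mem_Z.1 hα
    cases j with
    | zero =>
      rw [mem_B_zero] at h0 ⊢
      ext x
      have : r • α x = 0 := LinearMap.congr_fun h0 x
      exact hr (this.trans (smul_zero r).symm)
    | succ j =>
      obtain ⟨β, hβ⟩ := mem_B_succ.1 h0
      have hβ' : ∀ x, r • α x = β (P.d j x) := hβ
      -- Only the values of `β` on boundaries matter, and `r` can be cancelled because it is regular
      -- on `B`.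
      suffices ∃ β' : P.X j →ₗ[R] B, ∀ x, β (P.d j x) = r • β' (P.d j x) by
        obtain ⟨β', h⟩ := this
        exact mem_B_succ.2 ⟨β', fun x => hr ((hβ' x).trans (h x))⟩
      have hb := ih' j (by simpa using hj) (x := (r • ⊤ : Submodule R B).mkQ ∘ₗ β)
        (mem_Z.2 fun x => (hq _).2 ⟨α x, hβ' x⟩)
      -- Modulo `r`, the map `β` is a cocycle, so by induction a coboundary; a lift `γ` of this
      -- coboundary to `B` can be subtracted without changing `β` on boundaries.
      suffices ∃ γ : P.X j →ₗ[R] B, (∀ x, γ (P.d j x) = 0) ∧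
          ∀ x, (r • ⊤ : Submodule R B).mkQ (β x - γ x) = 0 by
        obtain ⟨γ, h1, h2⟩ := this
        obtain ⟨β', h⟩ := exists_lift (β - γ) (LinearMap.lsmul R B r) fun x => (hq _).1 (h2 x)
        refine ⟨β', fun x => ?_⟩
        have := h (P.d j x)
        rw [LinearMap.sub_apply, h1, sub_zero] at this
        exact this.symm
      cases j with
      | zero =>
        rw [mem_B_zero] at hb
        refine ⟨0, fun x => rfl, fun x => ?_⟩
        simpa using LinearMap.congr_fun hb x
      | succ j =>
        obtain ⟨c, hc⟩ := mem_B_succ.1 hb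
        obtain ⟨γ, hγ⟩ := exists_lift c (r • ⊤ : Submodule R B).mkQ fun x =>
          Submodule.mkQ_surjective _ _
        exact ⟨γ ∘ₗ P.d j, fun x => by simp [P.d_d], fun x => by
          rw [map_sub, sub_eq_zero]
          exact (hc x).trans (hγ _).symm⟩

/-- The quotient by a regular sequence of length `r` raises the projective dimension by at
most `r`. -/
theorem ExtVanish.quot_isWeaklyRegular (rs : List R) : ∀ (A : Type) [AddCommGroup A] [Module R A]
    (m : ℕ), IsWeaklyRegular A rs → (∀ j, m < j → ExtVanish R W A j) →
    ∀ j, m + rs.length < j → ExtVanish R W (A ⧸ (Ideal.ofList rs • ⊤ : Submodule R A)) j := by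
  induction rs with
  | nil =>
    intro A _ _ m _ h j hj
    refine (h j hj).of_equiv (Submodule.quotEquivOfEqBot _ ?_).symm
    simp
  | cons r rs ih =>
    intro A _ _ m hreg h j hj
    rw [isWeaklyRegular_cons_iff] at hreg
    obtain ⟨hr, hreg⟩ := hreg
    -- The first element raises the bound from `m` to `m + 1`; the others are treated by induction.
    refine (ih (QuotSMulTop r A) (m + 1) hreg ?_ j (by simp at hj; omega)).of_equiv
      (Submodule.quotOfListConsSMulTopEquivQuotSMulTopInner A r rs).symm
    rintro (_ | j) hj
    · omega
    · refine ExtVanish.right (g := LinearMap.lsmul R A r) hr (π := (r • ⊤ : Submodule R A).mkQ)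
        (Submodule.mkQ_surjective _) (fun b => ?_) (h j (by omega)) (h (j + 1) (by omega))
      rw [Submodule.mkQ_apply, Submodule.Quotient.mk_eq_zero,
        Submodule.mem_smul_pointwise_iff_exists]
      simp

/-- A morphism from a resolution of a module `A` to a complex `T` such that `Extⁱ(A, Tᵢ)` vanishes
for all `i` induces zero on the zeroth homology. -/
theorem exists_eq_d_of_acyclic {P T : ProjComplex R} (θ : Hom P T)
    (h : ∀ i, P.Acyclic (T.X i) i) (r : ℕ) (hr : ∀ x : T.X r, x = 0) :
    ∃ s : P.X 0 →ₗ[R] T.X 1, ∀ x, θ.f 0 x = T.d 0 (s x) := by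
  -- Descending induction from the degree where `T` is zero: `θ` agrees on boundaries with `d ∘ s`.
  -- In degree `i + 1` the difference of `θ` and `d ∘ s` is then a cocycle with values in a term of
  -- `T`, so a coboundary, and its primitive serves in degree `i`.
  have key : ∀ i ≤ r, ∃ s : P.X i →ₗ[R] T.X (i + 1),
      ∀ x, θ.f i (P.d i x) = T.d i (s (P.d i x)) := by
    intro i hi
    induction hi using Nat.decreasingInduction with
    | self => exact ⟨0, fun x => (hr _).trans (hr _).symm⟩
    | of_succ i _ ih =>
      obtain ⟨s, hs⟩ := ih
      have := h (i + 1) (x := θ.f (i + 1) - T.d (i + 1) ∘ₗ s) (mem_Z.2 fun x => by simp [hs])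
      obtain ⟨s', hs'⟩ := mem_B_succ.1 this
      refine ⟨s', fun x => ?_⟩
      rw [← hs', LinearMap.sub_apply, LinearMap.comp_apply, map_sub, T.d_d, sub_zero, θ.comm]
  obtain ⟨s, hs⟩ := key 0 (Nat.zero_le r)
  -- In degree 0 there are no coboundaries but zero, so agreement on boundaries becomes equality.
  have := h 0 (x := θ.f 0 - T.d 0 ∘ₗ s) (mem_Z.2 fun x => by simp [hs])
  rw [mem_B_zero, sub_eq_zero] at this
  exact ⟨s, LinearMap.congr_fun this⟩

end

end KoszulDuality

end

/-! ### Modules supported at the origin, graded Nakayama, and multiplication by a linear form -/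

noncomputable section

namespace KoszulDuality

variable {n : ℕ}

open ProjComplex RingTheory.Sequence

theorem mem_maxIdeal_iff (p : PolyRing n) : p ∈ maxIdeal n ↔ p.coeff 0 = 0 := by
  rw [maxIdeal, ← Set.image_univ, MvPolynomial.mem_ideal_span_X_image]
  constructor
  · intro h
    by_contra h0
    obtain ⟨i, -, hi⟩ := h 0 (MvPolynomial.mem_support_iff.2 h0)
    exact hi rfl
  · intro h m hm
    by_contra! hm'
    have : m = 0 := by
      ext i
      exact hm' i trivial
    subst this
    exact MvPolynomial.mem_support_iff.1 hm h

instance maxIdeal_isMaximal : (maxIdeal n).IsMaximal := by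
  have : maxIdeal n = RingHom.ker (MvPolynomial.constantCoeff : PolyRing n →+* ℂ) := by
    ext p
    rw [mem_maxIdeal_iff, RingHom.mem_ker, MvPolynomial.constantCoeff_eq]
  rw [this]
  exact RingHom.ker_isMaximal_of_surjective _ fun c =>
    ⟨MvPolynomial.C c, MvPolynomial.constantCoeff_C _ c⟩

/-- Membership in an ideal generated by variables is tested on monomials, and multiplication by the
next variable does not change the exponents of the earlier ones. -/
theorem isWeaklyRegular_X :
    IsWeaklyRegular (PolyRing n) (List.ofFn (MvPolynomial.X : Fin n → PolyRing n)) := by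
  constructor
  intro i hi
  have hi' : i < n := by simpa using hi
  have hspan : Ideal.ofList ((List.ofFn (MvPolynomial.X : Fin n → PolyRing n)).take i) =
      Ideal.span (MvPolynomial.X '' {a : Fin n | a.1 < i}) := by
    rw [Ideal.ofList]
    congr 1
    ext p
    simp only [Set.mem_ofPred_eq, Set.mem_image, List.mem_take_iff_getElem, List.getElem_ofFn,
      List.length_ofFn]
    constructor
    · rintro ⟨a, ha, rfl⟩
      exact ⟨⟨a, by omega⟩, by simp; omega, rfl⟩
    · rintro ⟨a, ha, rfl⟩
      exact ⟨a.1, by omega, rfl⟩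
  rw [isSMulRegular_iff_right_eq_zero_of_smul]
  intro q hq
  obtain ⟨p, rfl⟩ := Submodule.Quotient.mk_surjective _ q
  rw [← Submodule.Quotient.mk_smul, Submodule.Quotient.mk_eq_zero] at hq
  rw [Submodule.Quotient.mk_eq_zero]
  rw [hspan, Ideal.smul_top_eq_map, Algebra.algebraMap_self, Ideal.map_id,
    Submodule.restrictScalars_mem, MvPolynomial.mem_ideal_span_X_image] at hq ⊢
  intro m hm
  rw [List.getElem_ofFn, smul_eq_mul] at hq
  obtain ⟨a, ha, h⟩ := hq (m + Finsupp.single ⟨i, hi'⟩ 1) (by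
    rw [MvPolynomial.mem_support_iff] at hm ⊢
    rwa [mul_comm, MvPolynomial.coeff_mul_X])
  refine ⟨a, ha, ?_⟩
  have : a ≠ ⟨i, hi'⟩ := by
    rintro rfl
    simp at ha
  simpa [Finsupp.single_apply, this.symm] using h

theorem ofList_X : Ideal.ofList (List.ofFn (MvPolynomial.X : Fin n → PolyRing n)) = maxIdeal n := by
  rw [Ideal.ofList, maxIdeal]
  congr 1
  ext p
  simp [List.mem_ofFn]

/-- A section of the augmentation gives an endomorphism of the resolution that lifts the identity
and is zero in positive degrees; it induces the same map as the identity. -/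
theorem ExtVanish.of_projective {R : Type} [CommRing R] (W A : Type) [AddCommGroup W] [Module R W]
    [AddCommGroup A] [Module R A] [Module.Projective R A] (j : ℕ) (hj : 0 < j) :
    ExtVanish R W A j := by
  intro C ε hC
  obtain ⟨σ, hσ⟩ := exists_lift (LinearMap.id : A →ₗ[R] A) ε fun x => hC.surj x
  let θ : Hom C C :=
    { f := fun
        | 0 => σ ∘ₗ ε
        | j + 1 => 0
      comm := fun
        | 0, x => by simp [hC.aug_d]
        | j + 1, x => by simp }
  obtain ⟨j, rfl⟩ : ∃ i, j = i + 1 := ⟨j - 1, by omega⟩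
  rw [acyclic_iff_subsingleton]
  refine subsingleton_of_forall_eq 0 fun a => ?_
  rw [← Hom.map_id (j + 1) a, map_eq_of_aug_eq hC (Hom.id C) θ fun x => (hσ _).symm]
  obtain ⟨α, rfl⟩ := cls_surjective _ a
  rw [Hom.map_cls, cls_eq_zero]
  convert Submodule.zero_mem _
  ext x
  exact map_zero α.1

instance (j : ℕ) : Module.Finite (PolyRing n) (forms n j) :=
  Module.Finite.of_basis (M := ⋀[PolyRing n]^j (KaehlerDifferential ℂ (PolyRing n)))
    ((dx n).exteriorPower j)

instance (j : ℕ) : Module.Free (PolyRing n) (forms n j) :=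
  Module.Free.of_basis (M := ⋀[PolyRing n]^j (KaehlerDifferential ℂ (PolyRing n)))
    ((dx n).exteriorPower j)

/-- The index of the volume form. -/
def univIndex (n : ℕ) : Set.powersetCard (Fin n) n := ⟨Finset.univ, by simp [Set.powersetCard]⟩

instance : Unique (Set.powersetCard (Fin n) n) where
  default := univIndex n
  uniq s := Subtype.ext (Finset.eq_univ_of_card s.1 (by rw [Fintype.card_fin]; exact s.2))

/-- The basis of monomial forms. -/
def formBasis (n j : ℕ) : Module.Basis (Set.powersetCard (Fin n) j) (PolyRing n) (forms n j) :=
  (dx n).exteriorPower j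

/-- `Ωⁿ` is free of rank one. -/
def topEquiv (n : ℕ) : forms n n ≃ₗ[PolyRing n] PolyRing n :=
  (formBasis n n).equivFun.trans (LinearEquiv.funUnique _ _ _)

/-- Below `n` this is Rees' theorem for the regular sequence of the variables; above `n` it is the
bound `n` for the projective dimension of the quotient by this sequence. -/
theorem extVanish_residue (j : ℕ) (hj : j ≠ n) :
    ExtVanish (PolyRing n) (forms n n) (PolyRing n ⧸ maxIdeal n) j := by
  intro C ε hC
  refine Acyclic.of_equiv (topEquiv n).symm ?_
  rcases lt_or_gt_of_ne hj with h | h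
  · refine acyclic_of_isWeaklyRegular hC _ _ isWeaklyRegular_X ?_ j (by simpa using h)
    intro r hr a
    obtain ⟨a, rfl⟩ := Submodule.mkQ_surjective (maxIdeal n) a
    have : r ∈ maxIdeal n := ofList_X (n := n) ▸ Ideal.subset_span hr
    rw [← map_smul, Submodule.mkQ_apply, Submodule.Quotient.mk_eq_zero]
    exact Ideal.mul_mem_right a _ this
  · have := ExtVanish.quot_isWeaklyRegular (W := PolyRing n) _ (PolyRing n) 0 isWeaklyRegular_X
      (ExtVanish.of_projective (PolyRing n) (PolyRing n)) j (by simpa using h)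
    refine this.of_equiv (Submodule.quotEquivOfEq _ _ ?_) C ε hC
    rw [ofList_X, Ideal.smul_top_eq_map, Algebra.algebraMap_self, Ideal.map_id,
      Submodule.restrictScalars_self]

/-- `Extʲ(E, Ωⁿ)` vanishes for `j ≠ n` if `E` has finite length and is supported at the origin. -/
theorem extVanish_of_pow_maxIdeal (E : Type) [AddCommGroup E] [Module (PolyRing n) E]
    [hE : Module.Finite (PolyRing n) E] (k : ℕ) (h : ∀ p ∈ maxIdeal n ^ k, ∀ e : E, p • e = 0)
    (j : ℕ) (hj : j ≠ n) : ExtVanish (PolyRing n) (forms n n) E j := by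
  induction hE using IsNoetherianRing.induction_on_isQuotientEquivQuotientPrime with
  | subsingleton N => exact .of_subsingleton j
  | quotient N p e =>
    -- A prime `p` with `R/p` killed by a power of 𝔪 contains 𝔪, so the only factor that occurs in
    -- the filtration is `R/𝔪`.
    have : maxIdeal n = p.1 := by
      refine (maxIdeal_isMaximal (n := n)).eq_of_le p.2.ne_top (p.2.le_of_pow_le (n := k) ?_)
      intro q hq
      have := h q hq (e.symm 1)
      rw [← map_smul, LinearEquiv.map_eq_zero_iff, Algebra.smul_def, mul_one,
        Ideal.Quotient.algebraMap_eq] at this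
      exact Ideal.Quotient.eq_zero_iff_mem.1 this
    exact (extVanish_residue j hj).of_equiv
      ((Submodule.quotEquivOfEq _ _ this).trans e.symm)
  | exact N₁ N₂ N₃ f g hf hg hfg h₁ h₃ =>
    refine ExtVanish.mid hf hg hfg (h₁ fun p hp e => ?_) (h₃ fun p hp e => ?_)
    · exact hf (by rw [map_smul, h p hp, map_zero])
    · obtain ⟨e, rfl⟩ := hg e
      rw [← map_smul, h p hp, map_zero]

namespace GrMod

theorem proj_smul_of_lt (A : GrMod n) {k l : ℤ} (hl : l < k) {a : A} (ha : a ∈ A.deg k)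
    (s : PolyRing n) : A.proj l (s • a) = 0 := by
  induction s using MvPolynomial.induction_on' with
  | monomial m c =>
    refine A.proj_ne l (m.degree + k) (by omega) _ (A.smul_mem _ _ _ _ ?_ ha)
    intro m' hm'
    rw [MvPolynomial.coeff_monomial] at hm'
    have : m = m' := by
      by_contra h
      simp [h] at hm'
    rw [this]
  | add p q hp hq => rw [add_smul, map_add, hp, hq, add_zero]

theorem proj_smul (A : GrMod n) {i : ℤ} {p : PolyRing n} (hp : p ∈ polyDeg n i) (k : ℤ) (a : A) :
    A.proj (k + i) (p • a) = p • A.proj k a :=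
  proj_map (A := A) (B := A) (DistribSMul.toAddMonoidHom A p) i
    (fun k a ha => by rw [add_comm]; exact A.smul_mem _ _ _ _ hp ha) k a

/-- The graded Nakayama lemma. -/
theorem eq_zero_of_smul_surjective (A : GrMod n) [Module.Finite (PolyRing n) A] {r : PolyRing n}
    (hr : r ∈ polyDeg n 1) (h : Function.Surjective fun a : A => r • a) (a : A) : a = 0 := by
  obtain ⟨s, hs, h0⟩ := Submodule.exists_sub_one_mem_and_smul_eq_zero_of_fg_of_le_smul
    (Ideal.span {r}) (⊤ : Submodule (PolyRing n) A) Module.Finite.fg_top (fun a _ => by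
      obtain ⟨b, rfl⟩ := h a
      exact Submodule.smul_mem_smul (Ideal.mem_span_singleton_self r) trivial)
  obtain ⟨t, ht⟩ := Ideal.mem_span_singleton'.1 hs
  refine A.eq_zero_of_proj a fun k => ?_
  have hk := A.proj_mem k a
  set b := A.proj k a
  -- The annihilating element is `1 + t r`. In degree `k` the second term contributes nothing, since
  -- `t • b` has no component in degree `k - 1`; so `b = 0`.
  have h1 : b + r • (t • b) = 0 := by
    rw [← h0 b trivial, ← sub_add_cancel s 1, ← ht, add_smul, one_smul, mul_comm, mul_smul,
      add_comm]
  have h2 := congrArg (A.proj k) h1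
  have h3 := A.proj_smul hr (k - 1) (t • b)
  rw [sub_add_cancel] at h3
  rwa [map_add, map_zero, h3, A.proj_smul_of_lt (by omega) hk, smul_zero, add_zero,
    A.proj_same k b hk] at h2

end GrMod

namespace FreeResolution

variable {A : GrMod n} (P : FreeResolution A)

/-- A graded free resolution, as a complex of projective modules. -/
def complex : ProjComplex (PolyRing n) where
  X j := P.X j
  projective j := Module.Projective.of_basis (GrMod.freeBasis (P.degs j))
  d := P.d
  d_d j x := by
    have : P.d (j + 1) x ∈ LinearMap.ker (P.d j) := P.exact_succ j ▸ LinearMap.mem_range_self _ x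
    exact this

theorem isRes : IsRes P.complex P.aug where
  surj := P.aug_surjective
  aug_d x := by
    have : P.d 0 x ∈ LinearMap.ker P.aug := P.exact_zero ▸ LinearMap.mem_range_self _ x
    exact this
  exact_zero x hx := by
    have : x ∈ LinearMap.range (P.d 0) := P.exact_zero ▸ hx
    exact this
  exact_succ j x hx := by
    have : x ∈ LinearMap.range (P.d (j + 1)) := P.exact_succ j ▸ hx
    exact this

theorem extB_eq (j : ℕ) : P.extB j = P.complex.B (forms n n) j := by
  cases j <;> rfl

/-- The module `Extʲ(A, Ωⁿ)` is the cohomology of the dual complex. -/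
def extEquiv (j : ℕ) : P.ext j ≃ₗ[PolyRing n] P.complex.H (forms n n) j :=
  Submodule.quotEquivOfEq ((P.extB j).submoduleOf (P.extZ j))
    ((P.complex.B (forms n n) j).submoduleOf (P.complex.Z (forms n n) j)) (by rw [extB_eq]; rfl)

instance (j : ℕ) : Module.Finite (PolyRing n) (P.X j) :=
  Module.Finite.of_basis (GrMod.freeBasis (P.degs j))

instance (j : ℕ) : Module.Free (PolyRing n) (P.X j) :=
  Module.Free.of_basis (GrMod.freeBasis (P.degs j))

instance (j : ℕ) : Module.Finite (PolyRing n) (P.ext j) := by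
  have : Module.Finite (PolyRing n) (P.complex.X j →ₗ[PolyRing n] forms n n) :=
    inferInstanceAs (Module.Finite (PolyRing n) (P.X j →ₗ[PolyRing n] forms n n))
  exact Module.Finite.equiv (P.extEquiv j).symm

end FreeResolution

section

variable {A : GrMod n} {ℓ : PolyRing n} (k : ℕ)

theorem extVanish_ker [Module.Finite (PolyRing n) A]
    (hker : ∀ p ∈ maxIdeal n ^ k, ∀ a : A, ℓ • a = 0 → p • a = 0) (j : ℕ) (hj : j ≠ n) :
    ExtVanish (PolyRing n) (forms n n) (LinearMap.ker (LinearMap.lsmul (PolyRing n) A ℓ)) j :=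
  extVanish_of_pow_maxIdeal _ k (fun p hp e => Subtype.ext (hker p hp e.1 e.2)) j hj

theorem extVanish_coker [Module.Finite (PolyRing n) A]
    (hcoker : ∀ p ∈ maxIdeal n ^ k, ∀ a : A, ∃ b : A, p • a = ℓ • b) (j : ℕ) (hj : j ≠ n) :
    ExtVanish (PolyRing n) (forms n n)
      (A ⧸ LinearMap.range (LinearMap.lsmul (PolyRing n) A ℓ)) j := by
  refine extVanish_of_pow_maxIdeal _ k (fun p hp e => ?_) j hj
  obtain ⟨a, rfl⟩ := Submodule.mkQ_surjective _ e
  rw [← map_smul, Submodule.mkQ_apply, Submodule.Quotient.mk_eq_zero]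
  obtain ⟨b, hb⟩ := hcoker p hp a
  exact ⟨b, hb.symm⟩

/-- The modules `Extʲ(A, Ωⁿ)` vanish for `j ≠ n - 1, n`, if `A` has dimension at most one. -/
theorem extVanish_of_linear_form [Module.Finite (PolyRing n) A] (hℓ : ℓ ∈ polyDeg n 1)
    (hker : ∀ p ∈ maxIdeal n ^ k, ∀ a : A, ℓ • a = 0 → p • a = 0)
    (hcoker : ∀ p ∈ maxIdeal n ^ k, ∀ a : A, ∃ b : A, p • a = ℓ • b)
    (j : ℕ) (h1 : j ≠ n) (h2 : j + 1 ≠ n) : ExtVanish (PolyRing n) (forms n n) A j := by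
  obtain ⟨P⟩ := FreeResolution.nonempty A
  refine .of_isRes P.isRes ?_
  -- `j ≠ n` serves for the kernel of `ℓ` and `j + 1 ≠ n` for its cokernel. The Ext module is
  -- finitely generated and graded, so Nakayama applies.
  have h := smul_surjective_of_extVanish P.isRes (extVanish_ker k hker j h1)
    (extVanish_coker k hcoker (j + 1) h2)
  have := GrMod.eq_zero_of_smul_surjective (P.ext j) hℓ (fun b => by
    obtain ⟨a, ha⟩ := h (P.extEquiv j b)
    exact ⟨(P.extEquiv j).symm a, (P.extEquiv j).injective (by simpa using ha)⟩)
  rw [acyclic_iff_subsingleton]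
  exact ⟨fun x y => (P.extEquiv j).symm.injective ((this _).trans (this _).symm)⟩

/-- If `ℓ` is injective, the condition from its kernel disappears, and with it the exception `j =
n`. -/
theorem extVanish_of_regular_linear_form [Module.Finite (PolyRing n) A] (hℓ : ℓ ∈ polyDeg n 1)
    (hker : ∀ a : A, ℓ • a = 0 → a = 0)
    (hcoker : ∀ p ∈ maxIdeal n ^ k, ∀ a : A, ∃ b : A, p • a = ℓ • b)
    (j : ℕ) (h2 : j + 1 ≠ n) : ExtVanish (PolyRing n) (forms n n) A j := by
  obtain ⟨P⟩ := FreeResolution.nonempty A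
  refine .of_isRes P.isRes ?_
  have : Subsingleton (LinearMap.ker (LinearMap.lsmul (PolyRing n) A ℓ)) :=
    ⟨fun x y => Subtype.ext ((hker _ x.2).trans (hker _ y.2).symm)⟩
  have h := smul_surjective_of_extVanish P.isRes (.of_subsingleton j)
    (extVanish_coker k hcoker (j + 1) h2)
  have := GrMod.eq_zero_of_smul_surjective (P.ext j) hℓ (fun b => by
    obtain ⟨a, ha⟩ := h (P.extEquiv j b)
    exact ⟨(P.extEquiv j).symm a, (P.extEquiv j).injective (by simpa using ha)⟩)
  rw [acyclic_iff_subsingleton]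
  exact ⟨fun x y => (P.extEquiv j).symm.injective ((this _).trans (this _).symm)⟩

end

end KoszulDuality

end

/-! ### The choice of a general linear form -/

noncomputable section

namespace KoszulDuality

variable {n : ℕ}

open MvPolynomial in
/-- Homogeneous ideals of `ℂ[x₁, …, xₙ]`. -/
def IsHomogeneousIdeal (J : Ideal (PolyRing n)) : Prop :=
  letI := MvPolynomial.gradedAlgebra (σ := Fin n) (R := ℂ)
  J.IsHomogeneous (homogeneousSubmodule (Fin n) ℂ)

/-- The constant term of an element of `J` lies in `J`; if it were nonzero it would be a unit. -/
theorem IsHomogeneousIdeal.le_maxIdeal {J : Ideal (PolyRing n)} (hJ : IsHomogeneousIdeal J)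
    (hne : J ≠ ⊤) : J ≤ maxIdeal n := by
  intro p hp
  rw [mem_maxIdeal_iff]
  by_contra h0
  apply hne
  let := MvPolynomial.gradedAlgebra (σ := Fin n) (R := ℂ)
  have h := hJ 0 hp
  rw [show (DirectSum.decompose (MvPolynomial.homogeneousSubmodule (Fin n) ℂ) p 0 : PolyRing n) =
    MvPolynomial.homogeneousComponent 0 p from MvPolynomial.decomposition.decompose'_apply p 0,
    MvPolynomial.homogeneousComponent_zero] at h
  exact J.eq_top_of_isUnit_mem h ((isUnit_iff_ne_zero.2 h0).map MvPolynomial.C)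

theorem singIdeal_homogeneous {d : ℕ} {f : PolyRing n} (hf : f.IsHomogeneous d) :
    IsHomogeneousIdeal (singIdeal f) := by
  let := MvPolynomial.gradedAlgebra (σ := Fin n) (R := ℂ)
  refine Ideal.homogeneous_span _ _ ?_
  rintro _ (rfl | ⟨i, rfl⟩)
  · exact ⟨d, hf⟩
  · exact ⟨d - 1, hf.pderiv⟩

theorem sum_C_mul_X_mem (c : Fin n → ℂ) :
    ∑ i, MvPolynomial.C (c i) * MvPolynomial.X i ∈ polyDeg n 1 := by
  refine sum_mem fun i _ => ?_
  have := polyDeg_mul 0 1 _ _ (C_mem_polyDeg (c i))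
    (mem_polyDeg_of_isHomogeneous (MvPolynomial.isHomogeneous_X ℂ i))
  simpa using this

/-- A general linear form is a parameter for a homogeneous ideal of dimension one. -/
theorem exists_linear_form {J : Ideal (PolyRing n)} (hJ : IsHomogeneousIdeal J)
    (hdim : ringKrullDim (PolyRing n ⧸ J) ≤ 1) :
    ∃ ℓ ∈ polyDeg n 1, ∃ k, maxIdeal n ^ k ≤ J ⊔ Ideal.span {ℓ} := by
  classical
  let L : (Fin n → ℂ) →ₗ[ℂ] PolyRing n :=
    { toFun := fun c => ∑ i, MvPolynomial.C (c i) * MvPolynomial.X i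
      map_add' := fun a b => by simp [add_mul, Finset.sum_add_distrib]
      map_smul' := fun a b => by
        simp [Finset.mul_sum, MvPolynomial.smul_eq_C_mul, mul_assoc] }
  have hfin : {p ∈ J.minimalPrimes | ¬ maxIdeal n ≤ p}.Finite :=
    (Ideal.finite_minimalPrimes_of_isNoetherianRing _ J).subset fun p hp => hp.1
  -- The coefficient vectors of the linear forms in `p`; a proper subspace of ℂⁿ unless `p` contains
  -- all variables.
  let V : Ideal (PolyRing n) → Subspace ℂ (Fin n → ℂ) := fun p =>
    (p.restrictScalars ℂ).comap L
  have hV : ⊤ ∉ hfin.toFinset.image V := by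
    intro h
    obtain ⟨p, hp, hp'⟩ := Finset.mem_image.1 h
    rw [Set.Finite.mem_toFinset] at hp
    apply hp.2
    rw [maxIdeal, Ideal.span_le]
    rintro _ ⟨i, rfl⟩
    have : Pi.single i 1 ∈ V p := hp' ▸ Submodule.mem_top
    have h2 : L (Pi.single i 1) = MvPolynomial.X i := by
      change ∑ j, MvPolynomial.C ((Pi.single i (1 : ℂ) : Fin n → ℂ) j) * MvPolynomial.X j = _
      rw [Finset.sum_eq_single i]
      · simp
      · intro b _ hb
        simp [hb]
      · simp
    exact h2 ▸ this
  -- A vector space over an infinite field is not a finite union of proper subspaces.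
  obtain ⟨c, hc⟩ := (Set.ne_univ_iff_exists_notMem _).1 (Subspace.biUnion_ne_univ_of_top_notMem hV)
  have hc' : ∀ p ∈ J.minimalPrimes, ¬ maxIdeal n ≤ p → L c ∉ p := by
    intro p hp hp' hcp
    apply hc
    simp only [Set.mem_iUnion]
    exact ⟨V p, Finset.mem_image_of_mem V (hfin.mem_toFinset.2 ⟨hp, hp'⟩), hcp⟩
  refine ⟨L c, sum_C_mul_X_mem c, ?_⟩
  refine Ideal.exists_pow_le_of_le_radical_of_fg ?_ (IsNoetherian.noetherian _)
  let := MvPolynomial.gradedAlgebra (σ := Fin n) (R := ℂ)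
  have hhom : (J ⊔ Ideal.span {L c}).IsHomogeneous
      (MvPolynomial.homogeneousSubmodule (Fin n) ℂ) := by
    refine Ideal.IsHomogeneous.sup hJ (Ideal.homogeneous_span _ _ ?_)
    rintro _ rfl
    refine ⟨1, fun m hm => ?_⟩
    have := sum_C_mul_X_mem c m hm
    rw [Finsupp.degree_eq_weight_one] at this
    exact_mod_cast this
  -- The radical of a homogeneous ideal is the intersection of the homogeneous primes above it, so
  -- only homogeneous primes `P` have to be shown to contain 𝔪.
  rw [hhom.radical_eq]
  refine le_sInf ?_
  rintro P ⟨hPh, hle, hP⟩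
  have hJP : J ≤ P := le_sup_left.trans hle
  have hℓP : L c ∈ P := hle (Ideal.mem_sup_right (Ideal.mem_span_singleton_self _))
  obtain ⟨p, hp, hpP⟩ := Ideal.exists_minimalPrimes_le hJP
  by_contra hmP
  have h1 : p < P := lt_of_le_of_ne hpP (by
    rintro rfl
    exact hc' p hp hmP hℓP)
  have h2 : P < maxIdeal n :=
    lt_of_le_of_ne (IsHomogeneousIdeal.le_maxIdeal hPh hP.ne_top) (fun h => hmP h.ge)
  rw [ringKrullDim_quotient] at hdim
  have hpJ : J ≤ p := hp.1.2
  -- The chain `p < P < 𝔪` above `J` would make the dimension at least 2.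
  let s : LTSeries (PrimeSpectrum.zeroLocus (R := PolyRing n) J) :=
    { length := 2
      toFun := ![⟨⟨p, hp.1.1⟩, hpJ⟩, ⟨⟨P, hP⟩, hJP⟩,
        ⟨⟨maxIdeal n, maxIdeal_isMaximal.isPrime⟩, hJP.trans h2.le⟩]
      step := by
        intro i
        fin_cases i
        · exact h1
        · exact h2 }
  have := (Order.LTSeries.length_le_krullDim s).trans hdim
  simp only [s] at this
  norm_cast at this

end KoszulDuality

end

/-! ### The wedge pairing and contraction with vector fields -/

noncomputable section

namespace KoszulDuality

variable {n : ℕ}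

/-- The inclusion of the `j`-forms into the exterior algebra. -/
def formVal (j : ℕ) :
    forms n j →ₗ[PolyRing n] ExteriorAlgebra (PolyRing n) (KaehlerDifferential ℂ (PolyRing n)) :=
  (⋀[PolyRing n]^j (KaehlerDifferential ℂ (PolyRing n))).subtype

theorem formVal_injective (j : ℕ) : Function.Injective (formVal (n := n) j) :=
  Subtype.val_injective

theorem formVal_mem {j : ℕ} (ω : forms n j) :
    formVal j ω ∈ ⋀[PolyRing n]^j (KaehlerDifferential ℂ (PolyRing n)) := ω.2

theorem exists_formVal {j : ℕ}
    {x : ExteriorAlgebra (PolyRing n) (KaehlerDifferential ℂ (PolyRing n))}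
    (h : x ∈ ⋀[PolyRing n]^j (KaehlerDifferential ℂ (PolyRing n))) :
    ∃ ω : forms n j, formVal j ω = x := ⟨⟨x, h⟩, rfl⟩

@[simp]
theorem formVal_wedge {i j k : ℕ} (h : i + j = k) (ω : forms n i) (η : forms n j) :
    formVal k (wedge h ω η) = formVal i ω * formVal j η := rfl

@[simp]
theorem formVal_dfWedge (f : PolyRing n) (j : ℕ) (ω : forms n j) :
    formVal (j + 1) (dfWedge f j ω) =
      ExteriorAlgebra.ι (PolyRing n) (KaehlerDifferential.D ℂ (PolyRing n) f) * formVal j ω := rfl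

/-- The wedge product, as a bilinear map. -/
def wedgeL {i j k : ℕ} (h : i + j = k) :
    forms n i →ₗ[PolyRing n] forms n j →ₗ[PolyRing n] forms n k :=
  LinearMap.mk₂ (PolyRing n) (wedge h)
    (fun _ _ _ => formVal_injective k (by simp [add_mul]))
    (fun _ _ _ => formVal_injective k (by simp))
    (fun _ _ _ => formVal_injective k (by simp [mul_add]))
    (fun _ _ _ => formVal_injective k (by simp))

@[simp]
theorem wedgeL_apply {i j k : ℕ} (h : i + j = k) (ω : forms n i) (η : forms n j) :
    wedgeL h ω η = wedge h ω η := rfl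

theorem formVal_formBasis {j : ℕ} (s : Set.powersetCard (Fin n) j) :
    formVal j (formBasis n j s) = ExteriorAlgebra.ιMulti_family (PolyRing n) j (dx n) s := by
  exact congrArg Subtype.val (exteriorPower.basis_apply _ _ (dx n) s)

theorem wedge_formBasis_not_disjoint {i j k : ℕ} (h : i + j = k) {s : Set.powersetCard (Fin n) i}
    {t : Set.powersetCard (Fin n) j} (hst : ¬ Disjoint s.val t.val) :
    wedge h (formBasis n i s) (formBasis n j t) = 0 := by
  apply formVal_injective
  rw [formVal_wedge, formVal_formBasis, formVal_formBasis,
    ExteriorAlgebra.ιMulti_family_mul_of_not_disjoint _ _ _ _ hst, map_zero]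

theorem exists_wedge_formBasis_disjoint {i j k : ℕ} (h : i + j = k)
    {s : Set.powersetCard (Fin n) i} {t : Set.powersetCard (Fin n) j}
    (hst : Disjoint s.val t.val) :
    ∃ (u : ℤˣ) (r : Set.powersetCard (Fin n) k),
      wedge h (formBasis n i s) (formBasis n j t) = (u : ℤ) • formBasis n k r := by
  subst h
  refine ⟨Equiv.Perm.sign (Set.powersetCard.permOfDisjoint hst),
    Set.powersetCard.disjUnion hst, formVal_injective _ ?_⟩
  rw [formVal_wedge, formVal_formBasis, formVal_formBasis,
    ExteriorAlgebra.ιMulti_family_mul_of_disjoint _ _ _ _ hst, map_zsmul, formVal_formBasis]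
  rfl

/-- The index of the complementary monomial form. -/
def complIndex {i j : ℕ} (h : i + j = n) :
    Set.powersetCard (Fin n) i ≃ Set.powersetCard (Fin n) j :=
  Set.powersetCard.compl (by simpa using (add_comm _ _).trans h)

theorem disjoint_complIndex {i j : ℕ} (h : i + j = n) (s : Set.powersetCard (Fin n) i)
    (t : Set.powersetCard (Fin n) j) : Disjoint s.val t.val ↔ t = complIndex h s := by
  constructor
  · intro hst
    apply Subtype.ext
    refine Finset.eq_of_subset_of_card_le ?_ ?_
    · intro a ha
      rw [complIndex, Set.powersetCard.mem_coe_iff, Set.powersetCard.mem_compl]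
      exact fun hs => Finset.disjoint_left.1 hst hs ha
    · rw [(complIndex h s).2, t.2]
  · rintro rfl
    rw [Finset.disjoint_left]
    intro a ha hb
    rw [complIndex, Set.powersetCard.mem_coe_iff, Set.powersetCard.mem_compl] at hb
    exact hb ha

/-- The sign of a monomial form and its complement. -/
theorem exists_sign {i j : ℕ} (h : i + j = n) : ∃ u : Set.powersetCard (Fin n) i → ℤˣ, ∀ s t,
    wedge h (formBasis n i s) (formBasis n j t) =
      if t = complIndex h s then ((u s : ℤ) : PolyRing n) • formBasis n n default else 0 := by
  have : ∀ s, ∃ u : ℤˣ, wedge h (formBasis n i s) (formBasis n j (complIndex h s)) =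
      ((u : ℤ) : PolyRing n) • formBasis n n default := fun s => by
    obtain ⟨u, r, hr⟩ := exists_wedge_formBasis_disjoint h ((disjoint_complIndex h s _).2 rfl)
    exact ⟨u, by rw [hr, Unique.eq_default r, Int.cast_smul_eq_zsmul]⟩
  choose u hu using this
  refine ⟨u, fun s t => ?_⟩
  split_ifs with hst
  · rw [hst, hu]
  · exact wedge_formBasis_not_disjoint h (mt (disjoint_complIndex h s t).1 hst)

theorem wedge_formBasis_apply {i j : ℕ} (h : i + j = n) {u : Set.powersetCard (Fin n) i → ℤˣ}
    (hu : ∀ s t, wedge h (formBasis n i s) (formBasis n j t) =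
      if t = complIndex h s then ((u s : ℤ) : PolyRing n) • formBasis n n default else 0)
    (ω : forms n i) (s : Set.powersetCard (Fin n) i) :
    wedge h ω (formBasis n j (complIndex h s)) =
      ((formBasis n i).repr ω s * ((u s : ℤ) : PolyRing n)) • formBasis n n default := by
  conv_lhs => rw [← (formBasis n i).sum_repr ω, ← wedgeL_apply]
  rw [map_sum, LinearMap.sum_apply, Finset.sum_eq_single s]
  · rw [map_smul, LinearMap.smul_apply, wedgeL_apply, hu, if_pos rfl, mul_smul]
  · intro t _ hts
    rw [map_smul, LinearMap.smul_apply, wedgeL_apply, hu, if_neg, smul_zero]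
    exact fun h' => hts ((complIndex h).injective h').symm
  · simp

theorem intUnit_mul_self (u : ℤˣ) : ((u : ℤ) : PolyRing n) * ((u : ℤ) : PolyRing n) = 1 := by
  rw [← Int.cast_mul, ← Units.val_mul, Int.units_mul_self, Units.val_one, Int.cast_one]

/-- Wedging with the complementary monomial form isolates one coefficient of `ω`, up to sign. -/
theorem wedge_left_injective {i j : ℕ} (h : i + j = n) {ω : forms n i}
    (hω : ∀ t, wedge h ω (formBasis n j t) = 0) : ω = 0 := by
  obtain ⟨u, hu⟩ := exists_sign h
  refine (formBasis n i).ext_elem fun s => ?_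
  have := wedge_formBasis_apply h hu ω s
  rw [hω, eq_comm, (formBasis n n).smul_eq_zero] at this
  rcases this with h0 | h0
  · have := congrArg (· * ((u s : ℤ) : PolyRing n)) h0
    simpa [mul_assoc, intUnit_mul_self] using this
  · exact absurd h0 ((formBasis n n).ne_zero _)

/-- The coefficients of `ω` are read off from the values of `α` on complementary monomial forms; the
signs are their own inverses. -/
theorem exists_wedge_eq {i j : ℕ} (h : i + j = n) (α : forms n j →ₗ[PolyRing n] forms n n) :
    ∃ ω : forms n i, ∀ η, wedge h ω η = α η := by
  obtain ⟨u, hu⟩ := exists_sign h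
  let ω : forms n i := (formBasis n i).equivFun.symm fun s =>
    (formBasis n n).repr (α (formBasis n j (complIndex h s))) default * ((u s : ℤ) : PolyRing n)
  refine ⟨ω, fun η => ?_⟩
  suffices wedgeL h ω = α from LinearMap.congr_fun this η
  refine (formBasis n j).ext fun t => ?_
  obtain ⟨s, rfl⟩ := (complIndex h).surjective t
  rw [wedgeL_apply, wedge_formBasis_apply h hu]
  have : (formBasis n i).repr ω s = (formBasis n n).repr (α (formBasis n j (complIndex h s)))
      default * ((u s : ℤ) : PolyRing n) := by
    change (formBasis n i).equivFun _ s = _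
    rw [LinearEquiv.apply_symm_apply]
  rw [this, mul_assoc, intUnit_mul_self, mul_one]
  conv_rhs => rw [← (formBasis n n).sum_repr (α _)]
  rw [Fintype.sum_unique]

/-- The wedge product identifies `Ωⁱ` with the dual of `Ωʲ`, if `i + j = n`. -/
def wedgeEquiv {i j : ℕ} (h : i + j = n) :
    forms n i ≃ₗ[PolyRing n] (forms n j →ₗ[PolyRing n] forms n n) :=
  LinearEquiv.ofBijective (wedgeL h)
    ⟨(injective_iff_map_eq_zero _).2 fun _ hω =>
      wedge_left_injective h fun _ => LinearMap.congr_fun hω _,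
    fun α => (exists_wedge_eq h α).imp fun _ hω => LinearMap.ext hω⟩

@[simp]
theorem wedgeEquiv_apply {i j : ℕ} (h : i + j = n) (ω : forms n i) (η : forms n j) :
    wedgeEquiv h ω η = wedge h ω η := rfl

theorem formBasis_mem {j : ℕ} (s : Set.powersetCard (Fin n) j) :
    formBasis n j s ∈ (forms n j).deg j := by
  have h : formBasis n j s = exteriorPower.ιMulti_family (PolyRing n) j (dx n) s :=
    exteriorPower.basis_apply _ _ (dx n) s
  rw [h]
  exact iotaMulti_mem _

theorem wedge_formBasis_mem {i j k : ℕ} (h : i + j = k) (s : Set.powersetCard (Fin n) i)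
    (t : Set.powersetCard (Fin n) j) :
    wedge h (formBasis n i s) (formBasis n j t) ∈ (forms n k).deg (i + j) := by
  by_cases hst : Disjoint s.val t.val
  · obtain ⟨u, r, hr⟩ := exists_wedge_formBasis_disjoint h hst
    rw [hr, ← Nat.cast_add, h]
    exact zsmul_mem (formBasis_mem r) _
  · rw [wedge_formBasis_not_disjoint h hst]
    exact zero_mem _

theorem repr_mem_of_mem {j : ℕ} {k : ℤ} {ω : forms n j} (hω : ω ∈ (forms n j).deg k)
    (s : Set.powersetCard (Fin n) j) : (formBasis n j).repr ω s ∈ polyDeg n (k - j) := hω s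

theorem wedge_mem {i j k : ℕ} (h : i + j = k) {a b : ℤ} {ω : forms n i} {η : forms n j}
    (hω : ω ∈ (forms n i).deg a) (hη : η ∈ (forms n j).deg b) :
    wedge h ω η ∈ (forms n k).deg (a + b) := by
  rw [← (formBasis n i).sum_repr ω, ← (formBasis n j).sum_repr η, ← wedgeL_apply,
    map_sum]
  refine sum_mem fun t _ => ?_
  rw [map_sum, LinearMap.sum_apply]
  refine sum_mem fun s _ => ?_
  rw [map_smul, map_smul, LinearMap.smul_apply, smul_smul]
  have := (forms n k).smul_mem _ _ _ _
    (polyDeg_mul _ _ _ _ (repr_mem_of_mem hη t) (repr_mem_of_mem hω s)) (wedge_formBasis_mem h s t)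
  rwa [show b - j + (a - i) + ((i : ℤ) + j) = a + b by ring] at this

theorem GrMod.mem_deg_of_proj (A : GrMod n) {k : ℤ} {a : A} (h : ∀ l ≠ k, A.proj l a = 0) :
    a ∈ A.deg k := by
  have : a - A.proj k a = 0 := by
    refine A.eq_zero_of_proj _ fun l => ?_
    rw [map_sub]
    by_cases hl : l = k
    · subst hl
      rw [A.proj_same _ _ (A.proj_mem _ a), sub_self]
    · rw [h l hl, A.proj_ne l k hl _ (A.proj_mem _ a), sub_self]
  rw [sub_eq_zero.1 this]
  exact A.proj_mem k a

/-- By nondegeneracy: the components of `ω` of other degrees pair to zero with all monomial forms,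
hence vanish. -/
theorem mem_deg_of_wedge {i j : ℕ} (h : i + j = n) {m : ℤ} {ω : forms n i}
    (hω : ∀ t, wedge h ω (formBasis n j t) ∈ (forms n n).deg (m + j)) :
    ω ∈ (forms n i).deg m := by
  refine GrMod.mem_deg_of_proj _ fun l hl => wedge_left_injective h fun t => ?_
  have := GrMod.proj_map (A := forms n i) (B := forms n n)
    ((wedgeL h).flip (formBasis n j t)).toAddMonoidHom j
    (fun k a ha => wedge_mem h ha (formBasis_mem t)) l ω
  refine this.symm.trans ?_
  exact (forms n n).proj_ne _ (m + j) (by omega) _ (hω t)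

section Commutation

variable {M R : Type*} [CommRing R] [AddCommGroup M] [Module R M]

theorem exteriorPower_mul_ι {i : ℕ} {x : ExteriorAlgebra R M} (hx : x ∈ ⋀[R]^i M) (v : M) :
    x * ExteriorAlgebra.ι R v = (-1) ^ i * (ExteriorAlgebra.ι R v * x) := by
  have hv : ∀ m : M, ExteriorAlgebra.ι R m * ExteriorAlgebra.ι R v =
      -(ExteriorAlgebra.ι R v * ExteriorAlgebra.ι R m) := fun m =>
    eq_neg_of_add_eq_zero_left (ExteriorAlgebra.ι_add_mul_swap m v)
  induction i generalizing x with
  | zero =>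
    rw [ExteriorAlgebra.exteriorPower, pow_zero] at hx
    obtain ⟨r, rfl⟩ := Submodule.mem_one.1 hx
    rw [pow_zero, one_mul, Algebra.commutes]
  | succ i ih =>
    rw [ExteriorAlgebra.exteriorPower, pow_succ'] at hx
    refine Submodule.mul_induction_on hx ?_ ?_
    · rintro _ ⟨m, rfl⟩ y hy
      rw [mul_assoc, ih hy, pow_succ, ← mul_assoc, ← (Commute.neg_one_left _).pow_left i |>.eq,
        mul_assoc, ← mul_assoc (ExteriorAlgebra.ι R m), hv]
      simp [mul_assoc]
    · intro x y hx hy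
      rw [add_mul, hx, hy, mul_add, mul_add]

theorem contractLeft_mem {i : ℕ} (δ : Module.Dual R M) {x : ExteriorAlgebra R M}
    (hx : x ∈ ⋀[R]^(i + 1) M) :
    CliffordAlgebra.contractLeft (Q := (0 : QuadraticForm R M)) δ x ∈ ⋀[R]^i M := by
  induction i generalizing x with
  | zero =>
    rw [ExteriorAlgebra.exteriorPower, zero_add, pow_one] at hx
    obtain ⟨m, rfl⟩ := hx
    rw [ExteriorAlgebra.exteriorPower, pow_zero]
    exact (CliffordAlgebra.contractLeft_ι 0 δ m) ▸ Submodule.algebraMap_mem _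
  | succ i ih =>
    rw [ExteriorAlgebra.exteriorPower, pow_succ'] at hx
    refine Submodule.mul_induction_on hx ?_ ?_
    · rintro _ ⟨m, rfl⟩ y hy
      refine (CliffordAlgebra.contractLeft_ι_mul (d := δ) (a := m) (b := y)).symm ▸ ?_
      refine Submodule.sub_mem _ (Submodule.smul_mem _ _ hy) ?_
      rw [ExteriorAlgebra.exteriorPower, pow_succ']
      exact Submodule.mul_mem_mul (LinearMap.mem_range_self _ m) (ih hy)
    · intro x y hx hy
      rw [map_add]
      exact Submodule.add_mem _ hx hy

end Commutation

/-- Moving the 1-form `df` past the `i`-form `τ` gives the sign. Under the wedge pairing the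
transpose of `df ∧` is thus `df ∧` up to sign. -/
theorem wedge_dfWedge (f : PolyRing n) {i j k : ℕ} (h : i + (j + 1) = k) (h' : i + 1 + j = k)
    (τ : forms n i) (η : forms n j) :
    wedge h τ (dfWedge f j η) = (-1 : PolyRing n) ^ i • wedge h' (dfWedge f i τ) η := by
  apply formVal_injective
  rw [map_smul, formVal_wedge, formVal_wedge, formVal_dfWedge, formVal_dfWedge, ← mul_assoc,
    exteriorPower_mul_ι (formVal_mem τ), mul_assoc, mul_assoc, Algebra.smul_def]
  simp

theorem dfWedge_dfWedge (f : PolyRing n) (j : ℕ) (ω : forms n j) :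
    dfWedge f (j + 1) (dfWedge f j ω) = 0 := by
  apply formVal_injective
  rw [formVal_dfWedge, formVal_dfWedge, ← mul_assoc, ExteriorAlgebra.ι_sq_zero, zero_mul, map_zero]

theorem D_repr (f : PolyRing n) (i : Fin n) :
    (dx n).coord i (KaehlerDifferential.D ℂ (PolyRing n) f) = MvPolynomial.pderiv i f := by
  simp [dx, KaehlerDifferential.mvPolynomialBasis_repr_apply]

/-- The contraction with ∂/∂xᵢ is an antiderivation that sends `df` to ∂f/∂xᵢ; so it is a homotopy
between multiplication by ∂f/∂xᵢ and zero. -/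
theorem pderiv_smul_formVal (f : PolyRing n) (i : Fin n)
    (x : ExteriorAlgebra (PolyRing n) (KaehlerDifferential ℂ (PolyRing n))) :
    MvPolynomial.pderiv i f • x =
      CliffordAlgebra.contractLeft (Q := (0 : QuadraticForm (PolyRing n) _)) ((dx n).coord i)
        (ExteriorAlgebra.ι (PolyRing n) (KaehlerDifferential.D ℂ (PolyRing n) f) * x) +
      ExteriorAlgebra.ι (PolyRing n) (KaehlerDifferential.D ℂ (PolyRing n) f) *
        CliffordAlgebra.contractLeft (Q := (0 : QuadraticForm (PolyRing n) _))
          ((dx n).coord i) x := by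
  have := CliffordAlgebra.contractLeft_ι_mul (Q := (0 : QuadraticForm (PolyRing n) _))
    (d := (dx n).coord i) (a := KaehlerDifferential.D ℂ (PolyRing n) f) (b := x)
  rw [D_repr] at this
  exact (sub_eq_iff_eq_add.1 this.symm)

/-- The partial derivatives of `f` kill the cohomology of the Koszul complex. -/
theorem pderiv_smul_mem_koszulB (f : PolyRing n) (d : ℕ) (i : Fin n) {j : ℕ} (ω : forms n j)
    (hω : dfWedge f j ω = 0) :
    (MvPolynomial.pderiv i f • ω : forms n j) ∈ koszulB f d j := by
  have h := pderiv_smul_formVal f i (formVal j ω)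
  rw [← formVal_dfWedge, hω, map_zero, map_zero, zero_add] at h
  cases j with
  | zero =>
    have h0 := formVal_mem ω
    rw [ExteriorAlgebra.exteriorPower, pow_zero] at h0
    obtain ⟨r, hr⟩ := Submodule.mem_one.1 h0
    rw [← hr] at h
    have h2 := CliffordAlgebra.contractLeft_algebraMap (0 : QuadraticForm (PolyRing n) _)
      ((dx n).coord i) r
    rw [show algebraMap (PolyRing n) (ExteriorAlgebra (PolyRing n) _) r =
      algebraMap (PolyRing n) (CliffordAlgebra (0 : QuadraticForm (PolyRing n) _)) r from rfl, h2,
      mul_zero] at h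
    have : MvPolynomial.pderiv i f • ω = 0 := formVal_injective 0 (by
      rw [map_smul, map_zero, ← hr, h])
    exact this
  | succ j =>
    obtain ⟨τ, hτ⟩ := exists_formVal (contractLeft_mem ((dx n).coord i) (formVal_mem ω))
    refine ⟨τ, formVal_injective _ ?_⟩
    refine (formVal_dfWedge f j τ).trans ?_
    rw [hτ, map_smul, h]

end KoszulDuality

end

/-! ### Truncated Koszul complexes and exactness below degree `n - 1` -/

noncomputable section

namespace KoszulDuality

variable {n : ℕ}

open ProjComplex

/-- Forms of equal degree. -/
def castForm {k k' : ℕ} (h : k = k') : forms n k →ₗ[PolyRing n] forms n k' := by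
  subst h
  exact LinearMap.id

/-- The terms of `kos` are products over this set. It has one element for `i ≤ m` and none for `i >
m`, where the term is therefore zero. -/
instance (m i : ℕ) : Subsingleton {k : ℕ // k + i = m} := ⟨fun a b => Subtype.ext (by omega)⟩

instance (m i : ℕ) : Finite {k : ℕ // k + i = m} := Finite.of_subsingleton

instance (m i : ℕ) : Module.Free (PolyRing n) (∀ k : {k : ℕ // k + i = m}, forms n k.1) := by
  have := Fintype.ofFinite {k : ℕ // k + i = m}
  infer_instance

/-- The truncated Koszul complex `Ωᵐ ← ⋯ ← Ω⁰`, with `Ωᵏ` in degree `i` for `k + i = m`. -/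
def kos (f : PolyRing n) (m : ℕ) : ProjComplex (PolyRing n) where
  X i := ∀ k : {k : ℕ // k + i = m}, forms n k.1
  d i := LinearMap.pi fun
    | ⟨0, _⟩ => 0
    | ⟨k + 1, h⟩ => dfWedge f k ∘ₗ LinearMap.proj (⟨k, by omega⟩ : {k : ℕ // k + (i + 1) = m})
  d_d i x := by
    funext ⟨k, hk⟩
    match k with
    | 0 => rfl
    | 1 => exact map_zero (dfWedge f 0)
    | k + 2 => exact dfWedge_dfWedge f k _

section Kos

variable (f : PolyRing n) {m : ℕ}

instance (i : ℕ) : Module.Finite (PolyRing n) ((kos f m).X i) :=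
  inferInstanceAs (Module.Finite (PolyRing n) (∀ k : {k : ℕ // k + i = m}, forms n k.1))

instance (i : ℕ) : Module.Free (PolyRing n) ((kos f m).X i) :=
  inferInstanceAs (Module.Free (PolyRing n) (∀ k : {k : ℕ // k + i = m}, forms n k.1))

/-- The component in `Ωᵏ`. -/
def kosOut {k i : ℕ} (h : k + i = m) : (kos f m).X i →ₗ[PolyRing n] forms n k :=
  LinearMap.proj (⟨k, h⟩ : {k : ℕ // k + i = m})

/-- The identification of `Ωᵏ` with a term of the complex. -/
def kosIn {k i : ℕ} (h : k + i = m) : forms n k →ₗ[PolyRing n] (kos f m).X i :=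
  LinearMap.pi fun k' => castForm (by omega)

@[simp]
theorem kosOut_kosIn {k i : ℕ} (h : k + i = m) (ω : forms n k) : kosOut f h (kosIn f h ω) = ω := rfl

@[simp]
theorem kosIn_kosOut {k i : ℕ} (h : k + i = m) (x : (kos f m).X i) :
    kosIn f h (kosOut f h x) = x := by
  funext ⟨k', h'⟩
  obtain rfl : k = k' := by omega
  rfl

theorem kosOut_injective {k i : ℕ} (h : k + i = m) : Function.Injective (kosOut (n := n) f h) :=
  fun x y hxy => by rw [← kosIn_kosOut f h x, hxy, kosIn_kosOut]

theorem kos_eq_zero {i : ℕ} (h : m < i) (x : (kos f m).X i) : x = 0 := by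
  funext ⟨k, hk⟩
  omega

theorem kos_d_kosIn {k i : ℕ} (h : k + (i + 1) = m) (h' : k + 1 + i = m) (ω : forms n k) :
    (kos f m).d i (kosIn f h ω) = kosIn f h' (dfWedge f k ω) :=
  kosOut_injective f h' rfl

theorem kosOut_d {k i : ℕ} (h : k + (i + 1) = m) (h' : k + 1 + i = m) (x : (kos f m).X (i + 1)) :
    kosOut f h' ((kos f m).d i x) = dfWedge f k (kosOut f h x) := rfl

theorem kos_exact (d : ℕ) (i : ℕ) (hex : ∀ k, k + (i + 1) = m → ∀ ω : forms n k,
    dfWedge f k ω = 0 → ω ∈ koszulB f d k) (x : (kos f m).X (i + 1)) (hx : (kos f m).d i x = 0) :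
    ∃ y, (kos f m).d (i + 1) y = x := by
  rcases lt_or_ge m (i + 1) with h | h
  · exact ⟨0, (map_zero _).trans (kos_eq_zero f h x).symm⟩
  · obtain ⟨k, hk⟩ : ∃ k, k + (i + 1) = m := ⟨m - (i + 1), by omega⟩
    have h1 := hex k hk (kosOut f hk x) (by
      rw [← kosOut_d f hk (by omega), hx, map_zero])
    cases k with
    | zero =>
      have h2 : kosOut f hk x = 0 := h1
      exact ⟨0, kosOut_injective f hk (by rw [h2, map_zero, map_zero])⟩
    | succ k =>
      obtain ⟨τ, hτ⟩ : ∃ τ : forms n k, dfWedge f k τ = kosOut f hk x := h1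
      exact ⟨kosIn f (by omega) τ, by rw [kos_d_kosIn f (by omega) hk, hτ, kosIn_kosOut]⟩

/-- The augmentation of the truncated Koszul complex. -/
def kosAug (m d : ℕ) : (kos f m).X 0 →ₗ[PolyRing n] koszulTerm n d m ⧸ koszulB f d m :=
  (koszulB f d m).mkQ ∘ₗ (show (kos f m).X 0 →ₗ[PolyRing n] koszulTerm n d m from
    kosOut f (add_zero m))

theorem kosAug_eq_zero_iff (d : ℕ) (x : (kos f m).X 0) :
    kosAug f m d x = 0 ↔ (kosOut f (add_zero m) x : forms n m) ∈ koszulB f d m :=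
  Submodule.Quotient.mk_eq_zero _

/-- Exactness below Ωᵐ makes the truncation a free resolution of length `m` of the cokernel, against
which modules with vanishing Ext can be tested. -/
theorem kosAug_isRes (d : ℕ)
    (hex : ∀ k < m, ∀ ω : forms n k, dfWedge f k ω = 0 → ω ∈ koszulB f d k) :
    IsRes (kos f m) (kosAug f m d) where
  surj y := by
    obtain ⟨ω, rfl⟩ := Submodule.mkQ_surjective _ y
    exact ⟨kosIn f (add_zero m) ω, rfl⟩
  aug_d x := by
    rw [kosAug_eq_zero_iff]
    cases m with
    | zero =>
      rw [kos_eq_zero f (by omega) x, map_zero, map_zero]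
      exact Submodule.zero_mem (koszulB f d 0)
    | succ m => exact ⟨_, (kosOut_d f rfl (add_zero _) x).symm⟩
  exact_zero x hx := by
    rw [kosAug_eq_zero_iff] at hx
    cases m with
    | zero =>
      have h2 : kosOut f (add_zero 0) x = 0 := hx
      exact ⟨0, kosOut_injective f (add_zero 0) (by rw [h2, map_zero, map_zero])⟩
    | succ m =>
      obtain ⟨τ, hτ⟩ : ∃ τ : forms n m, dfWedge f m τ = kosOut f (add_zero (m + 1)) x := hx
      refine ⟨kosIn f rfl τ, ?_⟩
      rw [kos_d_kosIn f rfl (add_zero _)]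
      exact kosOut_injective f (add_zero _) hτ
  exact_succ i := kos_exact f d i fun k hk => hex k (by omega)

/-- Modules with vanishing `Ext` have no maps to the cokernels of the Koszul complex. -/
theorem map_eq_zero_of_extVanish (d : ℕ)
    (hex : ∀ k < m, ∀ ω : forms n k, dfWedge f k ω = 0 → ω ∈ koszulB f d k)
    {E : Type} [AddCommGroup E] [Module (PolyRing n) E]
    (hE : ∀ i ≤ m, ExtVanish (PolyRing n) (forms n n) E i)
    (g : E →ₗ[PolyRing n] koszulTerm n d m ⧸ koszulB f d m) (e : E) : g e = 0 := by
  obtain ⟨P, ε, hP⟩ := exists_isRes (R := PolyRing n) E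
  have hK := kosAug_isRes f d hex
  obtain ⟨θ, hθ⟩ := exists_hom (C := P) hK (g ∘ₗ ε) (by simp [hP.aug_d])
  -- The terms of the truncation are finite free and `Ωⁿ` is free of rank one, so vanishing with
  -- values in `Ωⁿ` suffices; beyond degree `m` the terms are zero.
  obtain ⟨s, hs⟩ := exists_eq_d_of_acyclic θ (fun i => by
    rcases lt_or_ge m i with h | h
    · intro α _
      rw [show α = 0 from LinearMap.ext fun x => kos_eq_zero f h _]
      exact Submodule.zero_mem _
    · exact ((hE i h P ε hP).of_equiv (topEquiv n)).of_free) (m + 1)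
    (kos_eq_zero f (Nat.lt_succ_self m))
  obtain ⟨x, rfl⟩ := hP.surj e
  refine (hθ x).symm.trans ?_
  rw [hs, hK.aug_d]

end Kos

section Vanishing

variable {d : ℕ} {f : PolyRing n} (hf : f.IsHomogeneous d)

theorem koszulClass_surjective (j : ℕ) : Function.Surjective (koszulClass hf j) :=
  Submodule.mkQ_surjective _

theorem koszulClass_eq_zero_iff {j : ℕ} (ω : koszulZ f d j) :
    koszulClass hf j ω = 0 ↔ ω.1 ∈ koszulB f d j :=
  (Submodule.Quotient.mk_eq_zero _).trans Iff.rfl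

/-- The ideal of the singular locus kills the Koszul cohomology. -/
theorem singIdeal_smul_eq_zero (hd : 1 ≤ d) {p : PolyRing n} (hp : p ∈ singIdeal f) {j : ℕ}
    (a : koszulH hf j) : p • a = 0 := by
  have hpd : ∀ i, MvPolynomial.pderiv i f • a = 0 := fun i => by
    obtain ⟨ω, rfl⟩ := koszulClass_surjective hf j a
    rw [← map_smul, koszulClass_eq_zero_iff]
    exact pderiv_smul_mem_koszulB f d i ω.1 ω.2
  refine Submodule.span_induction ?_ (zero_smul _ a) ?_ ?_ hp
  · rintro q (hq | ⟨i, rfl⟩)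
    · rw [show q = f from hq]
      -- Euler's formula: `d f` is a combination of the partial derivatives, and `d` is invertible
      -- in ℂ.
      have h := hf.sum_X_mul_pderiv
      have h2 : (d : PolyRing n) • (f • a) = 0 := by
        rw [smul_smul, ← nsmul_eq_mul, ← h, Finset.sum_smul]
        exact Finset.sum_eq_zero fun i _ => by rw [mul_smul, hpd, smul_zero]
      have h3 : (MvPolynomial.C ((d : ℂ)⁻¹) : PolyRing n) * (d : PolyRing n) = 1 := by
        rw [← map_natCast (MvPolynomial.C : ℂ →+* PolyRing n), ← map_mul,
          inv_mul_cancel₀ (Nat.cast_ne_zero.2 (by omega)), map_one]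
      rw [← one_smul (PolyRing n) (f • a), ← h3, mul_smul, h2, smul_zero]
    · exact hpd i
  · intro x y _ _ hx hy
    rw [add_smul, hx, hy, add_zero]
  · intro c x _ hx
    rw [smul_assoc, hx, smul_zero]

variable {ℓ : PolyRing n} {k : ℕ}

/-- Modulo `J`, which acts as zero, the elements of 𝔪ᵏ are multiples of `ℓ`. -/
theorem smul_eq_zero_of_ker {J : Ideal (PolyRing n)} (hk : maxIdeal n ^ k ≤ J ⊔ Ideal.span {ℓ})
    {A : Type} [AddCommGroup A] [Module (PolyRing n) A] (hA : ∀ p ∈ J, ∀ a : A, p • a = 0) :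
    ∀ p ∈ maxIdeal n ^ k, ∀ a : A, ℓ • a = 0 → p • a = 0 := by
  intro p hp a ha
  obtain ⟨u, hu, v, hv, rfl⟩ := Submodule.mem_sup.1 (hk hp)
  obtain ⟨c, rfl⟩ := Ideal.mem_span_singleton'.1 hv
  rw [add_smul, hA u hu, mul_smul, ha, smul_zero, add_zero]

theorem exists_smul_eq {J : Ideal (PolyRing n)} (hk : maxIdeal n ^ k ≤ J ⊔ Ideal.span {ℓ})
    {A : Type} [AddCommGroup A] [Module (PolyRing n) A] (hA : ∀ p ∈ J, ∀ a : A, p • a = 0) :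
    ∀ p ∈ maxIdeal n ^ k, ∀ a : A, ∃ b : A, p • a = ℓ • b := by
  intro p hp a
  obtain ⟨u, hu, v, hv, rfl⟩ := Submodule.mem_sup.1 (hk hp)
  obtain ⟨c, rfl⟩ := Ideal.mem_span_singleton'.1 hv
  exact ⟨c • a, by rw [add_smul, hA u hu, zero_add, mul_comm, mul_smul]⟩

/-- The inclusion of the Koszul cohomology into the cokernel of the differential. -/
def koszulHIncl (j : ℕ) : koszulH hf j →ₗ[PolyRing n] koszulTerm n d j ⧸ koszulB f d j :=
  Submodule.mapQ _ _ (koszulZ f d j).subtype fun _ h => h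

theorem koszulHIncl_injective (j : ℕ) : Function.Injective (koszulHIncl hf j) := by
  rw [injective_iff_map_eq_zero]
  intro a ha
  obtain ⟨ω, rfl⟩ := koszulClass_surjective hf j a
  rw [koszulClass_eq_zero_iff]
  exact (Submodule.Quotient.mk_eq_zero _).1 ha

theorem extVanish_koszulH (hd : 1 ≤ d) (hℓ : ℓ ∈ polyDeg n 1)
    (hk : maxIdeal n ^ k ≤ singIdeal f ⊔ Ideal.span {ℓ}) (i j : ℕ)
    (h1 : j ≠ n) (h2 : j + 1 ≠ n) :
    ExtVanish (PolyRing n) (forms n n) (koszulH hf i) j :=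
  extVanish_of_linear_form k hℓ
    (smul_eq_zero_of_ker hk fun _ hp a => singIdeal_smul_eq_zero hf hd hp a)
    (exists_smul_eq hk fun _ hp a => singIdeal_smul_eq_zero hf hd hp a) j h1 h2

/-- The Koszul complex is exact at `Ωⁱ` for `i < n - 1`. -/
theorem koszul_exact {f : PolyRing n} (hf : f.IsHomogeneous d) (hd : 1 ≤ d) (hℓ : ℓ ∈ polyDeg n 1)
    (hk : maxIdeal n ^ k ≤ singIdeal f ⊔ Ideal.span {ℓ}) (i : ℕ) (hi : i + 1 < n)
    (ω : forms n i) (hω : dfWedge f i ω = 0) :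
    ω ∈ koszulB f d i := by
  induction i using Nat.strong_induction_on with
  | _ i ih =>
    -- By induction the truncation at `i` is a resolution of the cokernel, into which Hⁱ embeds. As
    -- `i < n - 1`, no exceptional degree of Ext is at most `i`, so this embedding is zero.
    have := map_eq_zero_of_extVanish f d (m := i) (fun i' hi' => ih i' hi' (by omega))
      (fun j hj => extVanish_koszulH hf hd hℓ hk i j (by omega) (by omega)) (koszulHIncl hf i)
      (koszulClass hf i ⟨ω, hω⟩)
    rw [← map_zero (koszulHIncl hf i)] at this
    exact (koszulClass_eq_zero_iff hf ⟨ω, hω⟩).1 (koszulHIncl_injective hf i this)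

/-- The kernel of `ℓ` on `N` is killed by a power of 𝔪, so its Ext vanishes below `n`; but `N`
embeds in a cokernel with a free resolution of length `n - 1`. -/
theorem modN_regular (hd : 1 ≤ d) (hℓ : ℓ ∈ polyDeg n 1)
    (hk : maxIdeal n ^ k ≤ singIdeal f ⊔ Ideal.span {ℓ}) (hn : 2 ≤ n)
    (a : modN hf) (ha : ℓ • a = 0) : a = 0 := by
  have hv := extVanish_ker (A := modN hf) k
    (smul_eq_zero_of_ker hk fun _ hp a => singIdeal_smul_eq_zero hf hd hp a)
  have := map_eq_zero_of_extVanish f d (m := n - 1)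
    (fun i hi => koszul_exact hf hd hℓ hk i (by omega)) (fun i hi => hv i (by omega))
    (koszulHIncl hf (n - 1) ∘ₗ (LinearMap.ker (LinearMap.lsmul (PolyRing n) (modN hf) ℓ)).subtype)
    ⟨a, ha⟩
  exact koszulHIncl_injective hf (n - 1) (this.trans (map_zero _).symm)

end Vanishing

end KoszulDuality

end

/-! ### Homogeneous components of maps, and the vanishing for `M`, `M'`, `M''`, `N` -/

noncomputable section

namespace KoszulDuality

variable {n : ℕ}

open ProjComplex

namespace GrMod

variable {A A' B B' : GrMod n}

theorem hom_ext_of_deg {M : Type} [AddCommGroup M] [Module (PolyRing n) M]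
    {g h : A →ₗ[PolyRing n] M} (H : ∀ k, ∀ a ∈ A.deg k, g a = h a) : g = h := by
  refine LinearMap.ext fun a => ?_
  rw [← A.sum_proj a, map_sum, map_sum]
  exact Finset.sum_congr rfl fun k _ => H k _ (A.proj_mem k a)

theorem proj_linearMap (g : A →ₗ[PolyRing n] B) (hg : ∀ k, ∀ a ∈ A.deg k, g a ∈ B.deg k) (k : ℤ)
    (a : A) : B.proj k (g a) = g (A.proj k a) := by
  have := proj_map g.toAddMonoidHom 0 (by simpa using hg) k a
  rw [add_zero] at this
  exact this

/-- A bijective linear map that preserves degrees is an isomorphism of graded modules. -/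
def Iso.ofBijective (g : A →ₗ[PolyRing n] B) (hg : ∀ k, ∀ a ∈ A.deg k, g a ∈ B.deg k)
    (hb : Function.Bijective g) : Iso A B where
  toLinearEquiv := LinearEquiv.ofBijective g hb
  mem_deg_iff k a := by
    refine ⟨fun h => mem_deg_of_proj A fun l hl => hb.1 ?_, hg k a⟩
    rw [← proj_linearMap g hg, map_zero]
    exact B.proj_ne _ _ hl _ h

/-- The inverse of an isomorphism of graded modules. -/
def Iso.symm (e : Iso A B) : Iso B A where
  toLinearEquiv := e.toLinearEquiv.symm
  mem_deg_iff k b := by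
    rw [← e.mem_deg_iff, LinearEquiv.apply_symm_apply]

/-- The composition of isomorphisms of graded modules. -/
def Iso.trans {C : GrMod n} (e : Iso A B) (e' : Iso B C) : Iso A C where
  toLinearEquiv := e.toLinearEquiv.trans e'.toLinearEquiv
  mem_deg_iff k a := (e'.mem_deg_iff k _).trans (e.mem_deg_iff k a)

/-- `g₀` is the homogeneous component of degree `0` of the linear map `g`. -/
def IsDegZero (g g₀ : A →ₗ[PolyRing n] B) : Prop := ∀ k, ∀ a ∈ A.deg k, g₀ a = B.proj k (g a)

theorem IsDegZero.mem {g g₀ : A →ₗ[PolyRing n] B} (h : IsDegZero g g₀) :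
    ∀ k, ∀ a ∈ A.deg k, g₀ a ∈ B.deg k := fun k a ha => by
  rw [h k a ha]
  exact B.proj_mem _ _

theorem isDegZero_self {g : A →ₗ[PolyRing n] B} (hg : ∀ k, ∀ a ∈ A.deg k, g a ∈ B.deg k) :
    IsDegZero g g := fun k a ha => (B.proj_same _ _ (hg k a ha)).symm

theorem isDegZero_zero : IsDegZero (0 : A →ₗ[PolyRing n] B) 0 :=
  isDegZero_self fun _ _ _ => zero_mem _

/-- Used to pass from a lift to its degree-zero component: a commutative square with homogeneous
sides stays commutative. -/
theorem IsDegZero.comm {g g₀ : A →ₗ[PolyRing n] B} {g' g₀' : A' →ₗ[PolyRing n] B'}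
    (h : IsDegZero g g₀) (h' : IsDegZero g' g₀') (a : A →ₗ[PolyRing n] A')
    (ha : ∀ k, ∀ v ∈ A.deg k, a v ∈ A'.deg k) (b : B →ₗ[PolyRing n] B')
    (hb : ∀ k, ∀ v ∈ B.deg k, b v ∈ B'.deg k) (H : ∀ v, b (g v) = g' (a v)) (v : A) :
    b (g₀ v) = g₀' (a v) := by
  refine LinearMap.congr_fun (f := b ∘ₗ g₀) (g := g₀' ∘ₗ a) (hom_ext_of_deg fun k v hv => ?_) v
  change b (g₀ v) = g₀' (a v)
  rw [h k v hv, h' k _ (ha k v hv), ← proj_linearMap b hb, H]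

/-- `b` is a basis of homogeneous elements, where `b i` has degree `δ i`. -/
def IsGradedBasis {ι : Type} (A : GrMod n) (b : Module.Basis ι (PolyRing n) A) (δ : ι → ℤ) : Prop :=
  ∀ k v, v ∈ A.deg k ↔ ∀ i, b.repr v i ∈ polyDeg n (k - δ i)

theorem IsGradedBasis.mem {ι : Type} {b : Module.Basis ι (PolyRing n) A} {δ : ι → ℤ}
    (hb : A.IsGradedBasis b δ) (i : ι) : b i ∈ A.deg (δ i) := by
  classical
  rw [hb]
  intro j
  rw [Module.Basis.repr_self, Finsupp.single_apply]
  split_ifs with h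
  · subst h
    rw [sub_self]
    exact C_mem_polyDeg 1
  · exact zero_mem _

/-- The component is prescribed on the homogeneous basis, where it is the projection of `g (b i)` to
degree `δ i`. -/
theorem IsGradedBasis.exists_isDegZero {ι : Type} [Finite ι] {b : Module.Basis ι (PolyRing n) A}
    {δ : ι → ℤ} (hb : A.IsGradedBasis b δ) (g : A →ₗ[PolyRing n] B) : ∃ g₀, IsDegZero g g₀ := by
  have := Fintype.ofFinite ι
  refine ⟨b.constr ℕ fun i => B.proj (δ i) (g (b i)), fun k v hv => ?_⟩
  conv_lhs => rw [← b.sum_repr v]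
  conv_rhs => rw [← b.sum_repr v]
  rw [map_sum, map_sum, map_sum]
  refine Finset.sum_congr rfl fun i _ => ?_
  rw [map_smul, map_smul, Module.Basis.constr_basis]
  have := B.proj_smul ((hb k v).1 hv i) (δ i) (g (b i))
  rw [← this]
  congr 2
  ring

theorem isGradedBasis_free {r : ℕ} (δ : Fin r → ℤ) :
    (free (n := n) δ).IsGradedBasis (freeBasis δ) δ := fun _ _ => Iff.rfl

end GrMod

/-- The standard basis of a term of the shifted Koszul complex. -/
def koszulBasis (n d j : ℕ) :
    Module.Basis (Set.powersetCard (Fin n) j) (PolyRing n) (koszulTerm n d j) :=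
  formBasis n j

theorem isGradedBasis_koszulTerm (d j : ℕ) :
    (koszulTerm n d j).IsGradedBasis (koszulBasis n d j) fun _ => j - ((j : ℤ) - n) * d := by
  intro k v
  refine Iff.trans (b := ∀ i, (formBasis n j).repr v i ∈ polyDeg n (k + ((j : ℤ) - n) * d - j))
    Iff.rfl (forall_congr' fun i => ?_)
  rw [show k + ((j : ℤ) - n) * d - j = k - (j - ((j : ℤ) - n) * d) by ring]
  rfl

/-- The quotient by the torsion has no torsion. -/
theorem smul_mem_torsion (A : GrMod n) {ℓ : PolyRing n} {k : ℕ}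
    (hker : ∀ p ∈ maxIdeal n ^ k, ∀ a : A, ℓ • a = 0 → p • a = 0) {a : A}
    (ha : ℓ • a ∈ A.torsion) : a ∈ A.torsion := by
  obtain ⟨N, hN⟩ := ha
  refine ⟨k + N, fun p hp => ?_⟩
  rw [pow_add] at hp
  refine Submodule.smul_induction_on hp (fun u hu v hv => ?_) fun x y hx hy => ?_
  · rw [smul_assoc]
    exact hker u hu _ (by rw [smul_comm, hN v hv])
  · rw [add_smul, hx, hy, add_zero]

section Torsion

variable (A : GrMod n) [Module.Finite (PolyRing n) A]

instance : IsNoetherian (PolyRing n) A := isNoetherian_of_isNoetherianRing_of_finite _ _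

theorem exists_pow_torsion : ∃ k, ∀ p ∈ maxIdeal n ^ k, ∀ a ∈ A.torsion, p • a = 0 := by
  obtain ⟨S, hS⟩ : A.torsion.FG := IsNoetherian.noetherian _
  have h : ∀ s : A, ∃ k, s ∈ S → ∀ p ∈ maxIdeal n ^ k, p • s = 0 := fun s => by
    by_cases hs : s ∈ S
    · obtain ⟨k, hk⟩ : s ∈ A.torsion := hS ▸ Submodule.subset_span hs
      exact ⟨k, fun _ => hk⟩
    · exact ⟨0, fun h => absurd h hs⟩
  choose k hk using h
  refine ⟨∑ s ∈ S, k s, fun p hp a ha => ?_⟩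
  rw [← hS] at ha
  induction ha using Submodule.span_induction with
  | mem s hs =>
    exact hk s hs p (Ideal.pow_le_pow_right (Finset.single_le_sum (fun _ _ => Nat.zero_le _) hs) hp)
  | zero => rw [smul_zero]
  | add x y _ _ hx hy => rw [smul_add, hx, hy, add_zero]
  | smul c x _ hx => rw [smul_comm, hx, smul_zero]

end Torsion

section Vanishing

variable {d : ℕ} {f : PolyRing n} (hf : f.IsHomogeneous d) {ℓ : PolyRing n} {k : ℕ}

theorem modM''_regular (hd : 1 ≤ d) (hk : maxIdeal n ^ k ≤ singIdeal f ⊔ Ideal.span {ℓ})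
    (a : modM'' hf) (ha : ℓ • a = 0) : a = 0 := by
  obtain ⟨x, rfl⟩ := Submodule.mkQ_surjective (modM hf).torsion a
  have h : (modM hf).torsion.mkQ (ℓ • x) = 0 := ((modM hf).torsion.mkQ.map_smul ℓ x).trans ha
  have h1 : ℓ • x ∈ (modM hf).torsion := (Submodule.Quotient.mk_eq_zero _).1 h
  exact (Submodule.Quotient.mk_eq_zero _).2 (smul_mem_torsion (modM hf)
    (smul_eq_zero_of_ker hk fun _ hp a => singIdeal_smul_eq_zero hf hd hp a) h1)

theorem singIdeal_smul_modM'' (hd : 1 ≤ d) {p : PolyRing n} (hp : p ∈ singIdeal f)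
    (a : modM'' hf) : p • a = 0 := by
  obtain ⟨x, rfl⟩ := Submodule.mkQ_surjective (modM hf).torsion a
  refine ((modM hf).torsion.mkQ.map_smul p x).symm.trans ?_
  have : p • x = 0 := singIdeal_smul_eq_zero hf hd hp x
  rw [this]
  exact map_zero _

theorem extVanish_modM' (j : ℕ) (hj : j ≠ n) :
    ExtVanish (PolyRing n) (forms n n) (modM' hf) j := by
  obtain ⟨k, hk⟩ := exists_pow_torsion (modM hf)
  exact extVanish_of_pow_maxIdeal (modM' hf) k (fun p hp a => Subtype.ext (hk p hp _ a.2)) j hj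

theorem extVanish_modM'' (hd : 1 ≤ d) (hℓ : ℓ ∈ polyDeg n 1)
    (hk : maxIdeal n ^ k ≤ singIdeal f ⊔ Ideal.span {ℓ}) (j : ℕ) (hj : j + 1 ≠ n) :
    ExtVanish (PolyRing n) (forms n n) (modM'' hf) j :=
  extVanish_of_regular_linear_form k hℓ (modM''_regular hf hd hk)
    (exists_smul_eq hk fun _ hp a => singIdeal_smul_modM'' hf hd hp a) j hj

theorem extVanish_modN (hn : 2 ≤ n) (hd : 1 ≤ d) (hℓ : ℓ ∈ polyDeg n 1)
    (hk : maxIdeal n ^ k ≤ singIdeal f ⊔ Ideal.span {ℓ}) (j : ℕ) (hj : j + 1 ≠ n) :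
    ExtVanish (PolyRing n) (forms n n) (modN hf) j :=
  extVanish_of_regular_linear_form k hℓ (modN_regular hf hd hℓ hk hn)
    (exists_smul_eq hk fun _ hp a => singIdeal_smul_eq_zero hf hd hp a) j hj

theorem extVanish_modM (hd : 1 ≤ d) (hℓ : ℓ ∈ polyDeg n 1)
    (hk : maxIdeal n ^ k ≤ singIdeal f ⊔ Ideal.span {ℓ}) (j : ℕ) (h1 : j ≠ n) (h2 : j + 1 ≠ n) :
    ExtVanish (PolyRing n) (forms n n) (modM hf) j :=
  extVanish_koszulH hf hd hℓ hk n j h1 h2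

end Vanishing

namespace FreeResolution

variable {A B : GrMod n} (P : FreeResolution A) (Q : FreeResolution B)

theorem acyclic_of_extVanish {j : ℕ} (h : ExtVanish (PolyRing n) (forms n n) A j) :
    P.complex.Acyclic (forms n n) j :=
  h P.complex P.aug P.isRes

theorem ext_subsingleton {j : ℕ} (h : ExtVanish (PolyRing n) (forms n n) A j) :
    Subsingleton (P.ext j) := by
  have := acyclic_iff_subsingleton.1 (P.acyclic_of_extVanish h)
  exact (P.extEquiv j).toEquiv.subsingleton

variable {P Q}

/-- A morphism of resolutions as a morphism of complexes. -/
def _root_.KoszulDuality.IsLift.hom {g : A →ₗ[PolyRing n] B} {θ : ∀ j, P.X j →ₗ[PolyRing n] Q.X j}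
    (h : IsLift P Q g θ) : P.complex.Hom Q.complex := ⟨θ, h.comm⟩

theorem exists_isLift (g : A →ₗ[PolyRing n] B) : ∃ θ, IsLift P Q g θ := by
  obtain ⟨θ, hθ⟩ := exists_hom (C := P.complex) Q.isRes (g ∘ₗ P.aug) fun x => by
    have h : P.aug (P.complex.d 0 x) = 0 := P.isRes.aug_d x
    exact (congrArg g h).trans (map_zero g)
  exact ⟨θ.f, hθ, θ.comm⟩

/-- `IsLift` does not mention degrees; the degree-zero component of any lift is again a lift, since
augmentations and differentials are homogeneous. -/
theorem exists_isLift_deg (g : A →ₗ[PolyRing n] B) (hg : ∀ k, ∀ a ∈ A.deg k, g a ∈ B.deg k) :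
    ∃ θ, IsLift P Q g θ ∧ ∀ j k, ∀ v ∈ (P.X j).deg k, θ j v ∈ (Q.X j).deg k := by
  obtain ⟨θ, hθ⟩ := exists_isLift (P := P) (Q := Q) g
  choose θ₀ h₀ using fun j => (GrMod.isGradedBasis_free (P.degs j)).exists_isDegZero (θ j)
  refine ⟨θ₀, ⟨?_, fun j => ?_⟩, fun j => (h₀ j).mem⟩
  · exact (h₀ 0).comm (GrMod.isDegZero_self hg) P.aug P.aug_mem Q.aug Q.aug_mem hθ.aug
  · exact (h₀ (j + 1)).comm (h₀ j) (P.d j) (P.d_mem j) (Q.d j) (Q.d_mem j) (hθ.comm j)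

theorem exists_extClass {j : ℕ} {k : ℤ} {a : P.ext j} (ha : a ∈ (P.ext j).deg k) :
    ∃ α : P.extZ j, P.extClass j α = a ∧
      ∀ e, ∀ v ∈ (P.X j).deg e, P.eval α v ∈ (forms n n).deg (e + k) := by
  obtain ⟨α, hα, rfl⟩ := ha
  exact ⟨α, rfl, hα⟩

theorem extClass_mem {j : ℕ} {k : ℤ} {α : P.extZ j}
    (hα : ∀ e, ∀ v ∈ (P.X j).deg e, P.eval α v ∈ (forms n n).deg (e + k)) :
    P.extClass j α ∈ (P.ext j).deg k :=
  ⟨α, hα, rfl⟩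

/-- The map is defined by one homogeneous lift, which controls the degrees. All lifts are homotopic,
so the formula on cocycles holds for each of them. -/
theorem exists_ext_iso (g : A →ₗ[PolyRing n] B) (hg : ∀ k, ∀ a ∈ A.deg k, g a ∈ B.deg k) (j : ℕ)
    (hb : ∀ θ : P.complex.Hom Q.complex, (∀ x, Q.aug (θ.f 0 x) = g (P.aug x)) →
      Function.Bijective (θ.map (forms n n) j)) :
    (∃ θ, IsLift P Q g θ) ∧ ∃ e : GrMod.Iso (Q.ext j) (P.ext j),
      ∀ θ, IsLift P Q g θ → ∀ α : Q.extZ j, ∃ β : P.extZ j,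
        (∀ v, P.eval β v = Q.eval α (θ j v)) ∧
        e.toLinearEquiv (Q.extClass j α) = P.extClass j β := by
  obtain ⟨θ, hθ, hdeg⟩ := exists_isLift_deg (P := P) (Q := Q) g hg
  let E : Q.ext j →ₗ[PolyRing n] P.ext j := (P.extEquiv j).symm.toLinearMap ∘ₗ
    hθ.hom.map (forms n n) j ∘ₗ (Q.extEquiv j).toLinearMap
  have hE : ∀ θ' (hθ' : IsLift P Q g θ') (α : Q.extZ j),
      E (Q.extClass j α) = P.extClass j (hθ'.hom.mapZ (forms n n) j α) := fun θ' hθ' α => by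
    have h1 := map_eq_of_aug_eq (W := forms n n) Q.isRes hθ.hom hθ'.hom
      (fun x => (hθ.aug x).trans (hθ'.aug x).symm) j
    have h2 : hθ'.hom.map (forms n n) j (Q.complex.cls (forms n n) j α) =
      P.complex.cls (forms n n) j (hθ'.hom.mapZ (forms n n) j α) := rfl
    refine (P.extEquiv j).symm_apply_eq.2 ?_
    exact (LinearMap.congr_fun h1 _).trans h2
  refine ⟨⟨θ, hθ⟩, GrMod.Iso.ofBijective E ?_ ?_, fun θ' hθ' α => ⟨_, fun v => rfl, hE θ' hθ' α⟩⟩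
  · intro k a ha
    obtain ⟨α, rfl, hα⟩ := exists_extClass ha
    rw [hE θ hθ]
    exact extClass_mem fun e v hv => hα e _ (hdeg j e v hv)
  · exact (P.extEquiv j).symm.bijective.comp ((hb hθ.hom hθ.aug).comp (Q.extEquiv j).bijective)

end FreeResolution

end KoszulDuality

end

/-! ### The sequence `M' → M → M''`, and the dual of the Koszul complex -/

noncomputable section

namespace KoszulDuality

variable {n : ℕ}

open ProjComplex

section Torsion

variable {d : ℕ} {f : PolyRing n} {hf : f.IsHomogeneous d} {ℓ : PolyRing n} {k : ℕ}

theorem cone_inclM'_isRes (PM : FreeResolution (modM hf)) (PM' : FreeResolution (modM' hf))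
    (θ : PM'.complex.Hom PM.complex) (hθ : ∀ x, PM.aug (θ.f 0 x) = inclM' hf (PM'.aug x)) :
    IsRes (cone θ) (projM'' hf ∘ₗ PM.aug ∘ₗ coneFst θ 0) :=
  isRes_cone PM'.isRes PM.isRes θ (inclM' hf) hθ Subtype.val_injective (projM'' hf)
    (Submodule.mkQ_surjective _) fun b => (Submodule.Quotient.mk_eq_zero _).trans
      ⟨fun h => ⟨⟨b, h⟩, rfl⟩, fun ⟨a, h⟩ => h ▸ a.2⟩

/-- The neighbours of Extⁿ(M) → Extⁿ(M') in the long exact sequence are Extⁿ and Extⁿ⁺¹ of `M''`,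
which vanish. -/
theorem inclM'_map_bijective (hd : 1 ≤ d) (hℓ : ℓ ∈ polyDeg n 1)
    (hk : maxIdeal n ^ k ≤ singIdeal f ⊔ Ideal.span {ℓ})
    (PM : FreeResolution (modM hf)) (PM' : FreeResolution (modM' hf))
    (θ : PM'.complex.Hom PM.complex) (hθ : ∀ x, PM.aug (θ.f 0 x) = inclM' hf (PM'.aug x)) :
    Function.Bijective (θ.map (forms n n) n) := by
  have h := cone_inclM'_isRes PM PM' θ hθ
  exact ⟨map_injective_of_cone θ (extVanish_modM'' hf hd hℓ hk n (by omega) _ _ h),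
    map_surjective_of_cone θ (extVanish_modM'' hf hd hℓ hk (n + 1) (by omega) _ _ h)⟩

/-- The neighbours of Extⁿ⁻¹(M'') → Extⁿ⁻¹(M) are Extⁿ⁻² and Extⁿ⁻¹ of `M'`, which vanish. The map
is compared with the inclusion into the cone that resolves `M''`. -/
theorem projM''_map_bijective (hn : 2 ≤ n)
    (PM : FreeResolution (modM hf)) (PM' : FreeResolution (modM' hf))
    (PM'' : FreeResolution (modM'' hf))
    (θ : PM.complex.Hom PM''.complex) (hθ : ∀ x, PM''.aug (θ.f 0 x) = projM'' hf (PM.aug x)) :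
    Function.Bijective (θ.map (forms n n) (n - 1)) := by
  obtain ⟨η, hη⟩ := FreeResolution.exists_isLift (P := PM') (Q := PM) (inclM' hf)
  have hcone := cone_inclM'_isRes PM PM' hη.hom hη.aug
  obtain ⟨κ, hκ⟩ := exists_hom (C := cone hη.hom) PM''.isRes _ hcone.aug_d
  have h1 := map_bijective (W := forms n n) hcone PM''.isRes (LinearEquiv.refl _ _) κ hκ (n - 1)
  have h2 : ∀ a, θ.map (forms n n) (n - 1) a =
      (coneIncl hη.hom).map (forms n n) (n - 1) (κ.map (forms n n) (n - 1) a) := fun a => by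
    rw [← Hom.map_comp]
    refine LinearMap.congr_fun (map_eq_of_aug_eq PM''.isRes θ ((coneIncl hη.hom).comp κ)
      (fun x => ?_) (n - 1)) a
    exact (hθ x).trans (hκ (coneInl hη.hom 0 x)).symm
  have h3 : Function.Injective ((coneIncl hη.hom).map (forms n n) (n - 1)) := by
    refine coneIncl_injective _ ?_
    rw [show n - 1 = n - 2 + 1 by omega]
    exact sh_acyclic_succ (PM'.acyclic_of_extVanish (extVanish_modM' hf _ (by omega)))
  have h4 : Function.Surjective ((coneIncl hη.hom).map (forms n n) (n - 1)) := fun a =>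
    exists_of_map_eq_zero _ _ a
      ((PM'.acyclic_of_extVanish (extVanish_modM' hf _ (by omega))).cls_eq_zero _)
  rw [show ⇑(θ.map (forms n n) (n - 1)) = _ ∘ _ from funext h2]
  exact Function.Bijective.comp ⟨h3, h4⟩ h1

end Torsion

section KoszulDual

variable {d : ℕ} {f : PolyRing n} (hf : f.IsHomogeneous d)

theorem forms_eq_zero {j : ℕ} (hj : n < j) (ω : forms n j) : ω = 0 := by
  refine (formBasis n j).ext_elem fun s => ?_
  have h1 := s.2
  have h2 := Finset.card_le_univ s.1
  rw [Fintype.card_fin] at h2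
  rw [Set.powersetCard.mem_iff] at h1
  omega

theorem mem_koszulZ_top (ω : koszulTerm n d n) : ω ∈ koszulZ f d n :=
  forms_eq_zero (Nat.lt_succ_self n) _

/-- The projection from the top forms to `M`. -/
def topClass : koszulTerm n d n →ₗ[PolyRing n] modM hf :=
  koszulClass hf n ∘ₗ LinearMap.id.codRestrict (koszulZ f d n) mem_koszulZ_top

theorem topClass_eq_zero_iff (ω : koszulTerm n d n) : topClass hf ω = 0 ↔ ω ∈ koszulB f d n :=
  koszulClass_eq_zero_iff hf ⟨ω, mem_koszulZ_top ω⟩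

theorem topClass_surjective : Function.Surjective (topClass hf) := fun a => by
  obtain ⟨ω, rfl⟩ := koszulClass_surjective hf n a
  exact ⟨ω.1, rfl⟩

theorem koszulClass_mem {j : ℕ} {q : ℤ} {ω : koszulZ f d j} (h : ω.1 ∈ (koszulTerm n d j).deg q) :
    koszulClass hf j ω ∈ (koszulH hf j).deg q := ⟨ω, h, rfl⟩

theorem topClass_mem {q : ℤ} {ω : koszulTerm n d n} (h : ω ∈ (koszulTerm n d n).deg q) :
    topClass hf ω ∈ (modM hf).deg q := koszulClass_mem (ω := ⟨ω, mem_koszulZ_top ω⟩) hf h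

/-- The augmentation of the Koszul complex to `M`. -/
def kosAugM : (kos f n).X 0 →ₗ[PolyRing n] modM hf :=
  topClass hf ∘ₗ (show (kos f n).X 0 →ₗ[PolyRing n] koszulTerm n d n from kosOut f (add_zero n))

/-- The linear equivalence between `Ωᵏ` and a term of the Koszul complex. -/
def kosEquiv (f : PolyRing n) {k i m : ℕ} (h : k + i = m) :
    forms n k ≃ₗ[PolyRing n] (kos f m).X i :=
  LinearEquiv.ofLinearMap (kosIn f h) (kosOut f h) (LinearMap.ext (kosIn_kosOut f h))
    (LinearMap.ext (kosOut_kosIn f h))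

/-- The wedge product identifies the dual of the Koszul complex with the Koszul complex. -/
def kosDualForm (f : PolyRing n) {k j : ℕ} (h : k + j = n) :
    ((kos f n).X j →ₗ[PolyRing n] forms n n) ≃ₗ[PolyRing n] forms n j :=
  (LinearEquiv.congrLeft (forms n n) (PolyRing n) (kosEquiv f h)).symm.trans
    (wedgeEquiv ((add_comm j k).trans h)).symm

theorem wedge_kosDualForm {k j : ℕ} (h : k + j = n) (α : (kos f n).X j →ₗ[PolyRing n] forms n n)
    (η : forms n k) :
    wedge ((add_comm j k).trans h) (kosDualForm f h α) η = α (kosIn f h η) := by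
  have := (wedgeEquiv ((add_comm j k).trans h)).apply_symm_apply
    ((LinearEquiv.congrLeft (forms n n) (PolyRing n) (kosEquiv f h)).symm α)
  exact LinearMap.congr_fun this η

/-- The sign that comes from `wedge_dfWedge` is harmless: it changes neither cocycles nor
coboundaries. -/
theorem kosDualForm_comp_d {k j : ℕ} (h : k + (j + 1) = n) (h' : k + 1 + j = n)
    (β : (kos f n).X j →ₗ[PolyRing n] forms n n) :
    kosDualForm f h (β ∘ₗ (kos f n).d j) =
      (-1 : PolyRing n) ^ j • dfWedge f j (kosDualForm f h' β) := by
  have h'' : j + 1 + k = n := by omega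
  refine (wedgeEquiv h'').injective (LinearMap.ext fun η => ?_)
  rw [map_smul, LinearMap.smul_apply, wedgeEquiv_apply, wedgeEquiv_apply]
  refine (wedge_kosDualForm h _ η).trans ?_
  rw [LinearMap.comp_apply, kos_d_kosIn f h h', ← wedge_kosDualForm h' β]
  exact wedge_dfWedge f _ h'' _ η

theorem neg_one_pow_smul_smul {M : Type} [AddCommGroup M] [Module (PolyRing n) M] (j : ℕ) (x : M) :
    (-1 : PolyRing n) ^ j • (-1 : PolyRing n) ^ j • x = x := by
  rw [smul_smul, ← mul_pow, neg_one_mul, neg_neg, one_pow, one_smul]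

theorem kosDualForm_mem_koszulZ_iff {k j : ℕ} (h : k + j = n)
    (α : (kos f n).X j →ₗ[PolyRing n] forms n n) :
    kosDualForm f h α ∈ koszulZ f d j ↔ α ∈ (kos f n).Z (forms n n) j := by
  cases k with
  | zero =>
    obtain rfl : j = n := by omega
    refine iff_of_true (mem_koszulZ_top _) (mem_Z.2 fun x => ?_)
    rw [kos_eq_zero f (Nat.lt_succ_self j) x, map_zero, map_zero]
  | succ k =>
    have h' : k + (j + 1) = n := by omega
    have key := kosDualForm_comp_d h' h α
    constructor
    · intro hω
      have hω' : dfWedge f j (kosDualForm f h α) = 0 := hω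
      rw [hω', smul_zero, LinearEquiv.map_eq_zero_iff] at key
      exact mem_Z.2 fun x => LinearMap.congr_fun key x
    · intro hα
      have h1 : α ∘ₗ (kos f n).d j = 0 := LinearMap.ext (mem_Z.1 hα)
      rw [h1, map_zero] at key
      have h2 := neg_one_pow_smul_smul (n := n) j (dfWedge f j (kosDualForm f h α))
      rw [← key, smul_zero] at h2
      exact h2.symm

theorem kosDualForm_mem_koszulB_iff {k j : ℕ} (h : k + j = n)
    (α : (kos f n).X j →ₗ[PolyRing n] forms n n) :
    kosDualForm f h α ∈ koszulB f d j ↔ α ∈ (kos f n).B (forms n n) j := by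
  cases j with
  | zero =>
    rw [mem_B_zero, ← (kosDualForm f h).map_eq_zero_iff]
    exact Iff.rfl
  | succ j =>
    have h' : k + 1 + j = n := by omega
    rw [mem_B_succ]
    constructor
    · intro hω
      obtain ⟨τ, hτ⟩ : ∃ τ : forms n j, dfWedge f j τ = kosDualForm f h α := hω
      -- The sign is absorbed into the primitive.
      have key := kosDualForm_comp_d h h' ((kosDualForm f h').symm ((-1 : PolyRing n) ^ j • τ))
      rw [LinearEquiv.apply_symm_apply, map_smul (dfWedge f j), neg_one_pow_smul_smul, hτ] at key
      exact ⟨(kosDualForm f h').symm ((-1 : PolyRing n) ^ j • τ), fun x =>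
        (LinearMap.congr_fun ((kosDualForm f h).injective key) x).symm⟩
    · rintro ⟨β, hβ⟩
      have key := kosDualForm_comp_d h h' β
      rw [← map_smul, ← show α = β ∘ₗ (kos f n).d j from LinearMap.ext hβ] at key
      exact ⟨_, key.symm⟩

/-- The identification of the cohomology of the dual of the Koszul complex with that of the Koszul
complex. -/
def kosDual {k j : ℕ} (h : k + j = n) : (kos f n).H (forms n n) j →ₗ[PolyRing n] koszulH hf j :=
  Submodule.liftQ _ (koszulClass hf j ∘ₗ LinearMap.codRestrict (koszulZ f d j)
    (show (kos f n).Z (forms n n) j →ₗ[PolyRing n] koszulTerm n d j from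
      (kosDualForm f h).toLinearMap ∘ₗ Submodule.subtype _)
    fun α => (kosDualForm_mem_koszulZ_iff h α.1).2 α.2) fun α hα =>
      (koszulClass_eq_zero_iff hf ⟨_, (kosDualForm_mem_koszulZ_iff h α.1).2 α.2⟩).2
        ((kosDualForm_mem_koszulB_iff h α.1).2 hα)

theorem kosDual_cls {k j : ℕ} (h : k + j = n) (α : (kos f n).Z (forms n n) j) :
    kosDual hf h ((kos f n).cls (forms n n) j α) = koszulClass hf j
      ⟨kosDualForm f h α.1, (kosDualForm_mem_koszulZ_iff h α.1).2 α.2⟩ := rfl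

theorem kosDual_bijective {k j : ℕ} (h : k + j = n) : Function.Bijective (kosDual hf h) := by
  constructor
  · rw [injective_iff_map_eq_zero]
    intro a ha
    obtain ⟨α, rfl⟩ := cls_surjective (C := kos f n) (W := forms n n) j a
    rw [kosDual_cls, koszulClass_eq_zero_iff] at ha
    exact cls_eq_zero.2 ((kosDualForm_mem_koszulB_iff h α.1).1 ha)
  · intro a
    obtain ⟨ω, rfl⟩ := koszulClass_surjective hf j a
    have h1 := (kosDualForm f h).apply_symm_apply ω.1
    refine ⟨(kos f n).cls (forms n n) j ⟨(kosDualForm f h).symm ω.1,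
      (kosDualForm_mem_koszulZ_iff (d := d) h _).1 ?_⟩, ?_⟩
    · exact (congrArg (· ∈ koszulZ f d j) h1).mpr ω.2
    · exact congrArg (koszulClass hf j) (Subtype.ext h1)

end KoszulDual

end KoszulDuality

end

/-! ### Morphisms between the Koszul complex and resolutions of `M` and `N` -/

noncomputable section

namespace KoszulDuality

variable {n : ℕ}

open ProjComplex

variable {d : ℕ} {f : PolyRing n} {hf : f.IsHomogeneous d}

section FromKoszul

variable {P : FreeResolution (modM hf)}

/-- A map from a term of the Koszul complex, given by a map from forms. -/
def kosDesc {m j : ℕ} {E : Type} [AddCommGroup E] [Module (PolyRing n) E]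
    (g : ∀ i, i + j = m → (forms n i →ₗ[PolyRing n] E)) : (kos f m).X j →ₗ[PolyRing n] E :=
  if hj : j ≤ m then g (m - j) (Nat.sub_add_cancel hj) ∘ₗ kosOut f (Nat.sub_add_cancel hj) else 0

theorem kosDesc_apply {m j : ℕ} {E : Type} [AddCommGroup E] [Module (PolyRing n) E]
    (g : ∀ i, i + j = m → (forms n i →ₗ[PolyRing n] E)) {i : ℕ} (h : i + j = m)
    (x : (kos f m).X j) : kosDesc g x = g i h (kosOut f h x) := by
  obtain rfl : i = m - j := by omega
  unfold kosDesc
  rw [dif_pos (by omega)]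
  rfl

/-- A morphism from the Koszul complex to a resolution, as a morphism of complexes. -/
def IsLiftFromKoszul.hom {φ : ∀ i j, i + j = n → (forms n i →ₗ[PolyRing n] P.X j)}
    (h : IsLiftFromKoszul hf P φ) : (kos f n).Hom P.complex where
  f j := kosDesc fun i hi => φ i j hi
  comm j x := by
    rcases lt_or_ge n (j + 1) with hj | hj
    · rw [kos_eq_zero f hj x, map_zero, map_zero, map_zero, map_zero]
    · obtain ⟨i, hi⟩ : ∃ i, i + 1 + j = n := ⟨n - (j + 1), by omega⟩
      have hi' : i + (j + 1) = n := by omega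
      have h1 := kosDesc_apply (f := f) (fun i hi => φ i (j + 1) hi) hi' x
      have h2 := kosDesc_apply (f := f) (fun i hi => φ i j hi) hi ((kos f n).d j x)
      rw [kosOut_d f hi' hi] at h2
      exact (congrArg (P.d j) h1).trans ((h.comm i j hi _).trans h2.symm)

theorem IsLiftFromKoszul.hom_kosIn {φ : ∀ i j, i + j = n → (forms n i →ₗ[PolyRing n] P.X j)}
    (h : IsLiftFromKoszul hf P φ) {i j : ℕ} (hij : i + j = n) (η : forms n i) :
    h.hom.f j (kosIn f hij η) = φ i j hij η :=
  kosDesc_apply (f := f) (fun i hi => φ i j hi) hij _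

theorem IsLiftFromKoszul.aug_hom {φ : ∀ i j, i + j = n → (forms n i →ₗ[PolyRing n] P.X j)}
    (h : IsLiftFromKoszul hf P φ) (x : (kos f n).X 0) : P.aug (h.hom.f 0 x) = kosAugM hf x := by
  rw [← kosIn_kosOut f (add_zero n) x]
  refine (congrArg P.aug (h.hom_kosIn (add_zero n) _)).trans ?_
  exact h.aug ⟨kosOut f (add_zero n) x, mem_koszulZ_top _⟩

theorem kosAugM_d (x : (kos f n).X 1) (hn : 1 ≤ n) : kosAugM hf ((kos f n).d 0 x) = 0 := by
  obtain ⟨m, rfl⟩ : ∃ m, n = m + 1 := ⟨n - 1, by omega⟩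
  exact (topClass_eq_zero_iff hf _).2 ⟨kosOut f rfl x, (kosOut_d f rfl (add_zero _) x).symm⟩

theorem exists_isLiftFromKoszul (hn : 1 ≤ n) : ∃ φ, IsLiftFromKoszul hf P φ := by
  obtain ⟨θ, hθ⟩ := exists_hom (C := kos f n) P.isRes (kosAugM hf) fun x => kosAugM_d x hn
  refine ⟨fun i j h => θ.f j ∘ₗ kosIn f h, fun ω => hθ _, fun i j h ω => ?_⟩
  have h1 := θ.comm j (kosIn f (show i + (j + 1) = n by omega) ω)
  rw [kos_d_kosIn f _ h] at h1
  exact h1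

/-- In the shifted grading `df ∧` has degree 0, so the degree-zero components of a lift form a lift.
-/
theorem exists_isLiftFromKoszul_deg (hn : 1 ≤ n) : ∃ φ, IsLiftFromKoszul hf P φ ∧
    ∀ i j h k, ∀ ω ∈ (koszulTerm n d i).deg k, φ i j h ω ∈ (P.X j).deg k := by
  obtain ⟨φ, hφ⟩ := exists_isLiftFromKoszul (P := P) hn
  choose φ₀ h₀ using fun i j h => (isGradedBasis_koszulTerm d i).exists_isDegZero
    (B := P.X j) (show koszulTerm n d i →ₗ[PolyRing n] P.X j from φ i j h)
  refine ⟨φ₀, ⟨fun ω => ?_, fun i j h ω => ?_⟩, fun i j h => (h₀ i j h).mem⟩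
  · exact (h₀ n 0 rfl).comm (B' := modM hf)
      (GrMod.isDegZero_self (g := topClass hf) fun k a => topClass_mem hf)
      LinearMap.id (fun _ _ h => h) P.aug P.aug_mem (fun ω => hφ.aug ⟨ω, mem_koszulZ_top _⟩) ω.1
  · exact (h₀ i (j + 1) (by omega)).comm (h₀ (i + 1) j h) (koszulD f d i) (koszulD_mem hf i)
      (P.d j) (P.d_mem j) (hφ.comm i j h) ω

end FromKoszul

section ToKoszul

variable {Q : FreeResolution (modN hf)}

/-- A morphism from a shifted resolution to the Koszul complex, as a morphism of complexes. -/
def IsLiftToKoszul.hom {ψ : ∀ i j, i + j + 1 = n → (Q.X j →ₗ[PolyRing n] forms n i)}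
    (h : IsLiftToKoszul hf Q ψ) : Q.complex.sh.Hom (kos f n) where
  f
    | 0 => 0
    | j + 1 => LinearMap.pi fun i => ψ i.1 j i.2 ∘ₗ (Q.complex.toSh j).symm.toLinearMap
  comm
    | 0, x => by
      funext ⟨i, hi⟩
      cases i with
      | zero => rfl
      | succ i =>
        obtain rfl : n = i + 1 := hi.symm
        -- In the lowest degree the compatibility says that the image of `Q₀` consists of cocycles,
        -- which is part of the condition on the augmentation.
        obtain ⟨ω, hω, -⟩ := h.aug rfl ((Q.complex.toSh 0).symm x)
        have h1 : dfWedge f i ω.1 = 0 := ω.2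
        exact (congrArg (dfWedge f i) hω).symm.trans h1
    | j + 1, x => by
      funext ⟨i, hi⟩
      cases i with
      | zero => exact (h.comm_last j hi _).symm
      | succ i => exact h.comm i j (by omega) _

/-- A morphism from a shifted resolution to the Koszul complex, as a morphism to the truncated
complex. -/
def IsLiftToKoszul.truncHom {ψ : ∀ i j, i + j + 1 = n → (Q.X j →ₗ[PolyRing n] forms n i)}
    (h : IsLiftToKoszul hf Q ψ) (hn : 1 ≤ n) : Q.complex.Hom (kos f (n - 1)) where
  f j := LinearMap.pi fun i => ψ i.1 j (by have := i.2; omega)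
  comm j x := by
    funext ⟨i, hi⟩
    cases i with
    | zero => exact (h.comm_last j (by omega) _).symm
    | succ i => exact h.comm i j (by omega) _

theorem koszulB_le_koszulZ (f : PolyRing n) (d j : ℕ) : koszulB f d j ≤ koszulZ f d j := by
  cases j with
  | zero => exact bot_le
  | succ j =>
    rintro _ ⟨τ, rfl⟩
    exact dfWedge_dfWedge f j τ

/-- A form that is congruent to a cocycle modulo coboundaries is itself a cocycle, because
coboundaries are cocycles. -/
theorem exists_koszulClass_eq {j : ℕ} {τ : koszulTerm n d j} {a : koszulH hf j}
    (h : (koszulB f d j).mkQ τ = koszulHIncl hf j a) :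
    ∃ ω : koszulZ f d j, ω.1 = τ ∧ koszulClass hf j ω = a := by
  obtain ⟨ω, rfl⟩ := koszulClass_surjective hf j a
  have h2 : τ - ω.1 ∈ koszulB f d j := (Submodule.Quotient.eq _).1 h
  have h3 : τ ∈ koszulZ f d j := by
    rw [← sub_add_cancel τ ω.1]
    exact add_mem (koszulB_le_koszulZ f d _ h2) ω.2
  refine ⟨⟨τ, h3⟩, rfl, ?_⟩
  rw [← sub_eq_zero, ← map_sub]
  exact (koszulClass_eq_zero_iff hf _).2 h2

/-- The cokernel of the Koszul differential, as a graded module. -/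
def koszulCoker (hf : f.IsHomogeneous d) (j : ℕ) : GrMod n :=
  (koszulTerm n d j).quot (koszulB f d j) (koszulB_homogeneous hf j)

theorem koszulHIncl_mem (j : ℕ) (k : ℤ) (a : koszulH hf j) (ha : a ∈ (koszulH hf j).deg k) :
    (show koszulCoker hf j from koszulHIncl hf j a) ∈ (koszulCoker hf j).deg k := by
  obtain ⟨ω, hω, rfl⟩ := ha
  exact ⟨ω.1, hω, rfl⟩

/-- The truncation at `n - 1` resolves Ωⁿ⁻¹/df∧Ωⁿ⁻², so the inclusion of `N` in this cokernel lifts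
to it. The last condition holds because the truncation is zero beyond Ω⁰. -/
theorem exists_isLiftToKoszul (hn : 1 ≤ n)
    (hex : ∀ k < n - 1, ∀ ω : forms n k, dfWedge f k ω = 0 → ω ∈ koszulB f d k) :
    ∃ ψ, IsLiftToKoszul hf Q ψ := by
  obtain ⟨θ, hθ⟩ := exists_hom (C := Q.complex) (kosAug_isRes f d hex)
    (koszulHIncl hf (n - 1) ∘ₗ Q.aug) fun x => by
      have h : Q.aug (Q.complex.d 0 x) = 0 := Q.isRes.aug_d x
      exact (congrArg (koszulHIncl hf (n - 1)) h).trans (map_zero _)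
  refine ⟨fun i j h => kosOut f (show i + j = n - 1 by omega) ∘ₗ θ.f j, fun h v => ?_,
    fun i j h v => ?_, fun j h v => ?_⟩
  · exact exists_koszulClass_eq (hθ v)
  · have h1 := θ.comm j v
    exact (kosOut_d f (show i + (j + 1) = n - 1 by omega) (by omega) _).symm.trans
      (congrArg (kosOut f (show i + 1 + j = n - 1 by omega)) h1)
  · have h1 := θ.comm j v
    rw [kos_eq_zero f (by omega) (θ.f (j + 1) v), map_zero] at h1
    exact (congrArg (kosOut f (show 0 + j = n - 1 by omega)) h1.symm).trans (map_zero _)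

theorem IsLiftToKoszul.aug_truncHom {ψ : ∀ i j, i + j + 1 = n → (Q.X j →ₗ[PolyRing n] forms n i)}
    (h : IsLiftToKoszul hf Q ψ) (hn : 1 ≤ n) (v : Q.complex.X 0) :
    kosAug f (n - 1) d ((h.truncHom hn).f 0 v) = koszulHIncl hf (n - 1) (Q.aug v) := by
  obtain ⟨ω, hω, h1⟩ := h.aug (by omega) v
  rw [← h1]
  exact congrArg (koszulB f d (n - 1)).mkQ hω.symm

theorem exists_isLiftToKoszul_deg (hn : 1 ≤ n)
    (hex : ∀ k < n - 1, ∀ ω : forms n k, dfWedge f k ω = 0 → ω ∈ koszulB f d k) :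
    ∃ ψ, IsLiftToKoszul hf Q ψ ∧ ∀ i j h k, ∀ v ∈ (Q.X j).deg k,
      (show koszulTerm n d i from ψ i j h v) ∈ (koszulTerm n d i).deg k := by
  obtain ⟨ψ, hψ⟩ := exists_isLiftToKoszul (Q := Q) hn hex
  choose ψ₀ h₀ using fun i j h => (GrMod.isGradedBasis_free (Q.degs j)).exists_isDegZero
    (B := koszulTerm n d i) (show Q.X j →ₗ[PolyRing n] koszulTerm n d i from ψ i j h)
  refine ⟨ψ₀, ⟨fun h v => ?_, fun i j h v => ?_, fun j h v => ?_⟩, fun i j h => (h₀ i j h).mem⟩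
  · have h1 := (h₀ (n - 1) 0 h).comm (GrMod.isDegZero_self (B := koszulCoker hf (n - 1))
      (g := koszulHIncl hf (n - 1)) (koszulHIncl_mem (n - 1))) Q.aug Q.aug_mem
      (koszulB f d (n - 1)).mkQ (fun k τ hτ => ⟨τ, hτ, rfl⟩) (fun v => by
        obtain ⟨ω, hω, h1⟩ := hψ.aug h v
        exact (congrArg (koszulB f d (n - 1)).mkQ hω.symm).trans
          (congrArg (koszulHIncl hf (n - 1)) h1)) v
    exact exists_koszulClass_eq h1
  · exact (h₀ i (j + 1) (by omega)).comm (h₀ (i + 1) j (by omega)) (Q.d j) (Q.d_mem j)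
      (koszulD f d i) (koszulD_mem hf i) (hψ.comm i j h) v
  · exact ((GrMod.isDegZero_zero (A := Q.X (j + 1)) (B := koszulTerm n d 0)).comm (h₀ 0 j h) (Q.d j)
      (Q.d_mem j) LinearMap.id (fun _ _ h => h) (fun v => (hψ.comm_last j h v).symm) v).symm

end ToKoszul

end KoszulDuality

end

/-! ### The triangle `N[1]` → Koszul complex → `M` and its dual -/

noncomputable section

namespace KoszulDuality

variable {n : ℕ}

open ProjComplex

variable {d : ℕ} {f : PolyRing n} {hf : f.IsHomogeneous d} {ℓ : PolyRing n} {k : ℕ}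
  {PM : FreeResolution (modM hf)} {PN : FreeResolution (modN hf)}
  {ψ : ∀ i j, i + j + 1 = n → (PN.X j →ₗ[PolyRing n] forms n i)}
  {φ : ∀ i j, i + j = n → (forms n i →ₗ[PolyRing n] PM.X j)}

theorem kosAugM_surjective : Function.Surjective (kosAugM hf) := fun a => by
  obtain ⟨ω, rfl⟩ := topClass_surjective hf a
  exact ⟨kosIn f (add_zero n) ω, rfl⟩

/-- The cone of the morphism from the shifted resolution of `N` to the Koszul complex resolves
`M`. -/
theorem cone_koszul_isRes (hn : 2 ≤ n) (hψ : IsLiftToKoszul hf PN ψ)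
    (hex : ∀ k < n - 1, ∀ ω : forms n k, dfWedge f k ω = 0 → ω ∈ koszulB f d k) :
    IsRes (cone hψ.hom) (kosAugM hf ∘ₗ coneFst hψ.hom 0) := by
  obtain ⟨m, rfl⟩ : ∃ m, n = m + 2 := ⟨n - 2, by omega⟩
  have e0 : m + 1 + 1 + 0 = m + 2 := rfl
  have e1 : m + 1 + (0 + 1) = m + 2 := rfl
  have e1' : m + 1 + 1 = m + 2 := rfl
  have e2 : m + (1 + 1) = m + 2 := rfl
  have key : ∀ v : PN.X 0, ∃ ω : koszulZ f d (m + 1), koszulClass hf (m + 1) ω = PN.aug v ∧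
      ω.1 = kosOut f e1' (hψ.hom.f 1 (PN.complex.toSh 0 v)) := fun v => by
    obtain ⟨ω, hω, h⟩ := hψ.aug rfl v
    exact ⟨ω, h, hω⟩
  refine isRes_cone_sh PN.isRes kosAugM_surjective (fun x => kosAugM_d x (by omega)) ?_ ?_ hψ.hom
    ?_ ?_
  · intro x hx
    obtain ⟨τ, hτ⟩ : ∃ τ : forms (m + 2) (m + 1), dfWedge f (m + 1) τ = kosOut f e0 x :=
      (topClass_eq_zero_iff hf _).1 hx
    exact ⟨kosIn f e1 τ, by rw [kos_d_kosIn f e1 e0, hτ, kosIn_kosOut]⟩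
  · exact fun j => kos_exact f d (j + 1) fun k hk => hex k (by omega)
  -- A cycle in Ωⁿ⁻¹ has a class in `N`, which is reached by an element of the resolution; the
  -- difference is a coboundary.
  · intro z hz
    have h1 : dfWedge f (m + 1) (kosOut f e1 z) = 0 := by
      rw [← kosOut_d f e1 e0, hz, map_zero]
    let ζ : koszulZ f d (m + 1) := ⟨(show forms (m + 2) (m + 1) from kosOut f e1 z), h1⟩
    obtain ⟨v, hv⟩ := PN.aug_surjective (koszulClass hf (m + 1) ζ)
    obtain ⟨ω, hcl, hω⟩ := key v
    have h2 : koszulClass hf (m + 1) (ζ - ω) = 0 :=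
      (map_sub _ _ _).trans (sub_eq_zero.2 (hv.symm.trans hcl.symm))
    obtain ⟨τ, hτ⟩ : ∃ τ : forms (m + 2) m, dfWedge f m τ =
        kosOut f e1 z - kosOut f e1' (hψ.hom.f 1 (PN.complex.toSh 0 v)) := by
      rw [← hω]
      exact (koszulClass_eq_zero_iff hf _).1 h2
    refine ⟨v, kosIn f e2 τ, kosOut_injective f e1' ?_⟩
    rw [map_add, kos_d_kosIn f e2 e1', kosOut_kosIn, hτ, add_sub_cancel]
  · intro v w h
    obtain ⟨ω, hcl, hω⟩ := key v
    refine hcl.symm.trans ((koszulClass_eq_zero_iff hf ω).2 ?_)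
    have h1 := congrArg (kosOut f e1') h
    rw [map_add, map_zero, kosOut_d f e2 e1'] at h1
    have h2 := eq_neg_of_add_eq_zero_left h1
    rw [← map_neg] at h2
    exact ⟨-kosOut f e2 w, h2.symm.trans hω.symm⟩

/-- The comparison of the Koszul complex with a resolution of `M` factors through the cone. -/
theorem exists_map_koszul_eq (hn : 2 ≤ n) (hψ : IsLiftToKoszul hf PN ψ)
    (hex : ∀ k < n - 1, ∀ ω : forms n k, dfWedge f k ω = 0 → ω ∈ koszulB f d k)
    (hφ : IsLiftFromKoszul hf PM φ) (j : ℕ) :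
    ∃ κ : PM.complex.H (forms n n) j → (cone hψ.hom).H (forms n n) j, Function.Bijective κ ∧
      ∀ a, hφ.hom.map (forms n n) j a = (coneIncl hψ.hom).map (forms n n) j (κ a) := by
  have hres := cone_koszul_isRes hn hψ hex
  obtain ⟨Θ, hΘ⟩ := exists_hom PM.isRes _ hres.aug_d
  refine ⟨Θ.map (forms n n) j,
    map_bijective hres PM.isRes (LinearEquiv.refl _ _) Θ hΘ j, fun a => ?_⟩
  rw [← Hom.map_comp]
  refine LinearMap.congr_fun (map_eq_of_aug_eq PM.isRes hφ.hom ((coneIncl hψ.hom).comp Θ)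
    (fun x => ?_) j) a
  exact (hφ.aug_hom x).trans (hΘ (coneInl hψ.hom 0 x)).symm

/-- `D₁(M)` is dual to `N`. -/
theorem map_koszul_bijective (hn : 2 ≤ n) (hd : 1 ≤ d) (hℓ : ℓ ∈ polyDeg n 1)
    (hk : maxIdeal n ^ k ≤ singIdeal f ⊔ Ideal.span {ℓ})
    (hψ : IsLiftToKoszul hf PN ψ) (hφ : IsLiftFromKoszul hf PM φ) :
    Function.Bijective (hφ.hom.map (forms n n) (n - 1)) := by
  obtain ⟨κ, hκ, h⟩ := exists_map_koszul_eq hn hψ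
    (fun i hi => koszul_exact hf hd hℓ hk i (by omega)) hφ (n - 1)
  -- This is Extⁿ⁻²(N) = 0, which gives surjectivity; `h1` is Extⁿ⁻³(N) = 0, which gives injectivity
  -- and is void for `n = 2`.
  have h0 : PN.complex.sh.Acyclic (forms n n) (n - 1) := by
    rw [show n - 1 = n - 2 + 1 by omega]
    exact sh_acyclic_succ (PN.acyclic_of_extVanish (extVanish_modN hf hn hd hℓ hk _ (by omega)))
  have h1 : PN.complex.sh.sh.Acyclic (forms n n) (n - 1) := by
    rw [show n - 1 = n - 2 + 1 by omega]
    refine sh_acyclic_succ ?_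
    rcases Nat.lt_or_ge 2 n with h3 | h3
    · rw [show n - 2 = n - 3 + 1 by omega]
      exact sh_acyclic_succ (PN.acyclic_of_extVanish (extVanish_modN hf hn hd hℓ hk _ (by omega)))
    · rw [show n - 2 = 0 by omega]
      exact sh_acyclic_zero
  rw [show ⇑(hφ.hom.map (forms n n) (n - 1)) = _ ∘ _ from funext h]
  exact Function.Bijective.comp ⟨coneIncl_injective _ h1, fun a =>
    exists_of_map_eq_zero _ _ a (h0.cls_eq_zero _)⟩ hκ

/-- In degree `n` the kernel comes from Extⁿ⁻²(N) = 0. -/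
theorem map_koszul_injective (hn : 2 ≤ n) (hd : 1 ≤ d) (hℓ : ℓ ∈ polyDeg n 1)
    (hk : maxIdeal n ^ k ≤ singIdeal f ⊔ Ideal.span {ℓ})
    (hψ : IsLiftToKoszul hf PN ψ) (hφ : IsLiftFromKoszul hf PM φ) :
    Function.Injective (hφ.hom.map (forms n n) n) := by
  obtain ⟨κ, hκ, h⟩ := exists_map_koszul_eq hn hψ
    (fun i hi => koszul_exact hf hd hℓ hk i (by omega)) hφ n
  have h1 : ∀ m, m + 2 = n → PN.complex.sh.sh.Acyclic (forms n n) (m + 2) := fun m hm =>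
    sh_acyclic_succ (sh_acyclic_succ
      (PN.acyclic_of_extVanish (extVanish_modN hf hn hd hℓ hk _ (by omega))))
  have h2 : PN.complex.sh.sh.Acyclic (forms n n) n := by
    have := h1 (n - 2) (by omega)
    rwa [show n - 2 + 2 = n by omega] at this
  rw [show ⇑(hφ.hom.map (forms n n) n) = _ ∘ _ from funext h]
  exact (coneIncl_injective _ h2).comp hκ.1

theorem exists_map_koszul_eq_of_map_eq_zero (hn : 2 ≤ n) (hd : 1 ≤ d) (hℓ : ℓ ∈ polyDeg n 1)
    (hk : maxIdeal n ^ k ≤ singIdeal f ⊔ Ideal.span {ℓ})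
    (hψ : IsLiftToKoszul hf PN ψ) (hφ : IsLiftFromKoszul hf PM φ) (x : (kos f n).H (forms n n) n)
    (hx : hψ.hom.map (forms n n) n x = 0) : ∃ a, hφ.hom.map (forms n n) n a = x := by
  obtain ⟨κ, hκ, h⟩ := exists_map_koszul_eq hn hψ
    (fun i hi => koszul_exact hf hd hℓ hk i (by omega)) hφ n
  obtain ⟨t, rfl⟩ := exists_of_map_eq_zero _ _ x hx
  obtain ⟨a, rfl⟩ := hκ.2 t
  exact ⟨a, h a⟩

/-- The obstruction lies in Extⁿ⁺¹(M) = 0. The target is Extⁿ⁻¹(N), shifted by one. -/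
theorem map_shift_surjective (hn : 2 ≤ n) (hd : 1 ≤ d) (hℓ : ℓ ∈ polyDeg n 1)
    (hk : maxIdeal n ^ k ≤ singIdeal f ⊔ Ideal.span {ℓ}) (hψ : IsLiftToKoszul hf PN ψ) :
    Function.Surjective (hψ.hom.map (forms n n) n) :=
  map_surjective_of_cone _ (extVanish_modM hf hd hℓ hk (n + 1) (by omega) (by omega) _ _
    (cone_koszul_isRes hn hψ fun i hi => koszul_exact hf hd hℓ hk i (by omega)))

variable (PM) in
-- Extⁿ(M) is isomorphic to Extⁿ(M'), which is killed by every scalar that kills `M'`.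
theorem exists_pow_smul_eq_zero (hd : 1 ≤ d) (hℓ : ℓ ∈ polyDeg n 1)
    (hk : maxIdeal n ^ k ≤ singIdeal f ⊔ Ideal.span {ℓ}) :
    ∃ N, ∀ p ∈ maxIdeal n ^ N, ∀ a : PM.complex.H (forms n n) n, p • a = 0 := by
  obtain ⟨N, hN⟩ := exists_pow_torsion (modM hf)
  obtain ⟨PM'⟩ := FreeResolution.nonempty (modM' hf)
  obtain ⟨θ, hθ⟩ := FreeResolution.exists_isLift (P := PM') (Q := PM) (inclM' hf)
  refine ⟨N, fun p hp a => (inclM'_map_bijective hd hℓ hk PM PM' hθ.hom hθ.aug).1 ?_⟩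
  rw [_root_.map_smul, map_zero]
  exact ProjComplex.smul_eq_zero PM'.isRes (fun b => Subtype.ext (hN p hp _ b.2)) n _

end KoszulDuality

end

/-! ### The isomorphisms `D₁(M) = N(nd)` and `D₀(M) = M'(nd)` -/

noncomputable section

namespace KoszulDuality

variable {n : ℕ}

open ProjComplex

namespace ProjComplex

variable {R : Type} [CommRing R] (C : ProjComplex R) (W : Type) [AddCommGroup W] [Module R W]

/-- The cohomology of the shifted complex. -/
def shH (j : ℕ) : C.sh.H W (j + 1) →ₗ[R] C.H W j :=
  Submodule.liftQ _ (C.cls W j ∘ₗ (show C.sh.Z W (j + 1) →ₗ[R] C.Z W j from LinearMap.id)) <| by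
    intro α hα
    refine cls_eq_zero.2 ?_
    cases j with
    | zero =>
      obtain ⟨β, hβ⟩ := mem_B_succ.1 hα
      exact mem_B_zero.2 (LinearMap.ext fun x => (hβ x).trans (map_zero β))
    | succ j => exact hα

theorem shH_bijective (j : ℕ) : Function.Bijective (C.shH W j) := by
  constructor
  · rw [injective_iff_map_eq_zero]
    intro a ha
    obtain ⟨α, rfl⟩ := cls_surjective (C := C.sh) (W := W) (j + 1) a
    have h := cls_eq_zero.1 ha
    refine cls_eq_zero.2 ?_
    cases j with
    | zero =>
      have h1 : α.1 = 0 := mem_B_zero.1 h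
      rw [h1]
      exact Submodule.zero_mem _
    | succ j => exact h
  · intro a
    obtain ⟨α, rfl⟩ := cls_surjective (C := C) (W := W) j a
    exact ⟨C.sh.cls W (j + 1) α, rfl⟩

theorem sh_smul_injective {j : ℕ} {r : R} (h : Function.Injective fun a : C.H W j => r • a) :
    Function.Injective fun a : C.sh.H W (j + 1) => r • a := fun a b hab => by
  refine (C.shH_bijective W j).1 (h ?_)
  change r • _ = r • _
  rw [← _root_.map_smul, ← _root_.map_smul]
  exact congrArg (C.shH W j) hab

end ProjComplex

variable {d : ℕ} {f : PolyRing n} {hf : f.IsHomogeneous d} {ℓ : PolyRing n} {k : ℕ}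
  {PM : FreeResolution (modM hf)} {PN : FreeResolution (modN hf)}

/-- Pullback to the Koszul complex followed by wedge duality. The degrees come from a homogeneous
`φ₀`; any other `φ` induces the same map on cohomology. -/
theorem exists_linearMap_koszulH (hn : 1 ≤ n) {i j : ℕ} (h : i + j = n) :
    ∃ E : PM.ext j →ₗ[PolyRing n] koszulH hf j,
      (∀ m, ∀ a ∈ (PM.ext j).deg m, E a ∈ (koszulH hf j).deg (m + n * d)) ∧
      ∀ φ (hφ : IsLiftFromKoszul hf PM φ),
        (∀ a, E a = kosDual hf h (hφ.hom.map (forms n n) j (PM.extEquiv j a))) ∧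
        ∀ α : PM.extZ j, ∃ ω : koszulZ f d j,
          (∀ η : forms n i, wedge ((add_comm j i).trans h) ω.1 η = PM.eval α (φ i j h η)) ∧
          E (PM.extClass j α) = koszulClass hf j ω := by
  obtain ⟨φ₀, hφ₀, hdeg⟩ := exists_isLiftFromKoszul_deg (P := PM) hn
  let E : PM.ext j →ₗ[PolyRing n] koszulH hf j := kosDual hf h ∘ₗ
    hφ₀.hom.map (forms n n) j ∘ₗ (PM.extEquiv j).toLinearMap
  have hE : ∀ φ (hφ : IsLiftFromKoszul hf PM φ),
      ∀ a, E a = kosDual hf h (hφ.hom.map (forms n n) j (PM.extEquiv j a)) := fun φ hφ a => by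
    have h1 := map_eq_of_aug_eq (W := forms n n) PM.isRes hφ₀.hom hφ.hom
      (fun x => (hφ₀.aug_hom x).trans (hφ.aug_hom x).symm) j
    exact congrArg (kosDual hf h) (LinearMap.congr_fun h1 _)
  have hspec : ∀ φ (hφ : IsLiftFromKoszul hf PM φ), ∀ α : PM.extZ j, ∃ ω : koszulZ f d j,
      (∀ η : forms n i, wedge ((add_comm j i).trans h) ω.1 η = PM.eval α (φ i j h η)) ∧
      E (PM.extClass j α) = koszulClass hf j ω := fun φ hφ α => by
    refine ⟨_, fun η => ?_, (hE φ hφ _).trans (kosDual_cls hf h (hφ.hom.mapZ (forms n n) j α))⟩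
    refine (wedge_kosDualForm h _ η).trans ?_
    exact congrArg (PM.eval α) (hφ.hom_kosIn h η)
  refine ⟨E, fun m a ha => ?_, fun φ hφ => ⟨hE φ hφ, hspec φ hφ⟩⟩
  obtain ⟨α, rfl, hα⟩ := FreeResolution.exists_extClass ha
  obtain ⟨ω, hω, h1⟩ := hspec φ₀ hφ₀ α
  rw [h1]
  refine koszulClass_mem hf ?_
  refine mem_deg_of_wedge ((add_comm j i).trans h) (ω := ω.1) fun t => ?_
  rw [hω]
  have hb : (formBasis n i t : forms n i) ∈ (koszulTerm n d i).deg (i - ((i : ℤ) - n) * d) :=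
    (isGradedBasis_koszulTerm d i).mem t
  have h2 := hα _ _ (hdeg i j h _ _ hb)
  -- Both degrees are `m + i + j d`: the shift by `n d` on one side and the shifts of the Koszul
  -- terms on the other.
  have h3 : (n : ℤ) = i + j := by exact_mod_cast h.symm
  convert h2 using 2
  rw [h3]
  ring

theorem exists_iso_modN (PM : FreeResolution (modM hf)) (hn : 2 ≤ n) (hd : 1 ≤ d)
    (hℓ : ℓ ∈ polyDeg n 1) (hk : maxIdeal n ^ k ≤ singIdeal f ⊔ Ideal.span {ℓ})
    (h : n - 1 + 1 = n) (h' : 1 + (n - 1) = n) :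
    ∃ e : GrMod.Iso (PM.D 1) ((modN hf).shift (n * d)),
      ∀ φ, IsLiftFromKoszul hf PM φ → ∀ α : PM.extZ (n - 1), ∃ ω : koszulZ f d (n - 1),
        (∀ η : forms n 1, wedge h ω.1 η = PM.eval α (φ 1 (n - 1) h' η)) ∧
        e.toLinearEquiv (PM.extClass (n - 1) α) = koszulClass hf (n - 1) ω := by
  obtain ⟨PN⟩ := FreeResolution.nonempty (modN hf)
  obtain ⟨ψ, hψ⟩ := exists_isLiftToKoszul (Q := PN) (by omega)
    fun i hi => koszul_exact hf hd hℓ hk i (by omega)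
  obtain ⟨φ₀, hφ₀⟩ := exists_isLiftFromKoszul (P := PM) (by omega)
  obtain ⟨E, hdeg, hE⟩ := exists_linearMap_koszulH (PM := PM) (i := 1) (j := n - 1) (by omega)
    (by omega)
  have hb : Function.Bijective E := by
    rw [show ⇑E = _ from funext (hE φ₀ hφ₀).1]
    exact (kosDual_bijective hf _).comp ((map_koszul_bijective hn hd hℓ hk hψ hφ₀).comp
      (PM.extEquiv _).bijective)
  exact ⟨GrMod.Iso.ofBijective (B := (modN hf).shift (n * d)) E hdeg hb, fun φ hφ => (hE φ hφ).2⟩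

/-- On Extⁿ⁻¹(N) the form `ℓ` is injective, because Extⁿ⁻¹(N/ℓN) and Extⁿ⁻² of the kernel of `ℓ`
vanish. -/
theorem smul_injective_shH (hn : 2 ≤ n) (hd : 1 ≤ d)
    (hk : maxIdeal n ^ k ≤ singIdeal f ⊔ Ideal.span {ℓ}) :
    Function.Injective fun a : PN.complex.sh.H (forms n n) n => ℓ • a := by
  have h1 : ∀ m, m + 1 = n →
      Function.Injective fun a : PN.complex.sh.H (forms n n) (m + 1) => ℓ • a := fun m hm =>
    sh_smul_injective _ _ (smul_injective_of_extVanish PN.isRes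
      (fun i hi => extVanish_ker k
        (smul_eq_zero_of_ker hk fun _ hp a => singIdeal_smul_eq_zero hf hd hp a) i (by omega))
      (extVanish_coker k
        (exists_smul_eq hk fun _ hp a => singIdeal_smul_eq_zero hf hd hp a) m (by omega)))
  have := h1 (n - 1) (by omega)
  rwa [show n - 1 + 1 = n by omega] at this

variable {ψ : ∀ i j, i + j + 1 = n → (PN.X j →ₗ[PolyRing n] forms n i)}

/-- The kernel of M → Extⁿ⁻¹(N) is the image of Extⁿ(M), hence killed by a power of 𝔪. Conversely a
torsion element is killed by a power of `ℓ`, which is injective on the target. -/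
theorem map_shift_eq_zero_iff (hn : 2 ≤ n) (hd : 1 ≤ d) (hℓ : ℓ ∈ polyDeg n 1)
    (hk : maxIdeal n ^ k ≤ singIdeal f ⊔ Ideal.span {ℓ}) (hψ : IsLiftToKoszul hf PN ψ)
    (x : (kos f n).H (forms n n) n) :
    hψ.hom.map (forms n n) n x = 0 ↔ kosDual hf (zero_add n) x ∈ (modM hf).torsion := by
  constructor
  · intro hx
    obtain ⟨PM⟩ := FreeResolution.nonempty (modM hf)
    obtain ⟨φ, hφ⟩ := exists_isLiftFromKoszul (P := PM) (by omega)
    obtain ⟨a, rfl⟩ := exists_map_koszul_eq_of_map_eq_zero hn hd hℓ hk hψ hφ x hx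
    obtain ⟨N, hN⟩ := exists_pow_smul_eq_zero PM hd hℓ hk
    refine ⟨N, fun p hp => ?_⟩
    refine ((kosDual hf (zero_add n)).map_smul p _).symm.trans ?_
    rw [← _root_.map_smul, hN p hp, map_zero, map_zero]
    rfl
  · rintro ⟨N, hN⟩
    have hmem : ℓ ^ N ∈ maxIdeal n ^ N := by
      refine Ideal.pow_mem_pow ?_ N
      rw [mem_maxIdeal_iff]
      by_contra h
      have := hℓ 0 h
      simp at this
    have h1 : ℓ ^ N • x = 0 := (kosDual_bijective hf (zero_add n)).1
      ((((kosDual hf (zero_add n)).map_smul _ _).trans (hN _ hmem)).trans (map_zero _).symm)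
    have h2 : ℓ ^ N • hψ.hom.map (forms n n) n x = 0 := by
      rw [← _root_.map_smul, h1, map_zero]
    have h3 : ∀ (i : ℕ) (y : PN.complex.sh.H (forms n n) n), ℓ ^ i • y = 0 → y = 0 := fun i => by
      induction i with
      | zero => exact fun y hy => by rwa [pow_zero, one_smul] at hy
      | succ i ih =>
        intro y hy
        rw [pow_succ, mul_smul] at hy
        exact smul_injective_shH hn hd hk ((ih _ hy).trans (smul_zero ℓ).symm)
    exact h3 N _ h2

theorem exists_iso_modM' (PM : FreeResolution (modM hf)) (hn : 2 ≤ n) (hd : 1 ≤ d)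
    (hℓ : ℓ ∈ polyDeg n 1) (hk : maxIdeal n ^ k ≤ singIdeal f ⊔ Ideal.span {ℓ}) :
    ∃ e : GrMod.Iso (PM.D 0) ((modM' hf).shift (n * d)),
      ∀ φ, IsLiftFromKoszul hf PM φ → ∀ α : PM.extZ n, ∃ ω : koszulZ f d n,
        (∀ η : forms n 0, wedge (add_zero n) ω.1 η = PM.eval α (φ 0 n (zero_add n) η)) ∧
        inclM' hf (e.toLinearEquiv (PM.extClass n α)) = koszulClass hf n ω := by
  obtain ⟨PN⟩ := FreeResolution.nonempty (modN hf)
  obtain ⟨ψ, hψ⟩ := exists_isLiftToKoszul (Q := PN) (by omega)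
    fun i hi => koszul_exact hf hd hℓ hk i (by omega)
  obtain ⟨φ₀, hφ₀⟩ := exists_isLiftFromKoszul (P := PM) (by omega)
  obtain ⟨E, hdeg, hE⟩ := exists_linearMap_koszulH (PM := PM) (by omega) (zero_add n)
  obtain ⟨N, hN⟩ := exists_pow_smul_eq_zero PM hd hℓ hk
  have hmem : ∀ a, (show modM hf from E a) ∈ (modM hf).torsion := fun a => by
    refine ⟨N, fun p hp => ?_⟩
    have h1 : p • a = 0 := (PM.extEquiv n).injective (by
      rw [map_zero, _root_.map_smul]
      exact hN p hp _)
    exact (E.map_smul p a).symm.trans ((congrArg E h1).trans (map_zero E))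
  let E' : PM.ext n →ₗ[PolyRing n] modM' hf :=
    LinearMap.codRestrict (modM hf).torsion (show PM.ext n →ₗ[PolyRing n] modM hf from E) hmem
  have hb : Function.Bijective E' := by
    constructor
    · intro a b hab
      have h1 : E a = E b := congrArg Subtype.val hab
      rw [(hE φ₀ hφ₀).1, (hE φ₀ hφ₀).1] at h1
      exact (PM.extEquiv n).injective
        (map_koszul_injective hn hd hℓ hk hψ hφ₀ ((kosDual_bijective hf _).1 h1))
    · rintro ⟨x, hx⟩
      obtain ⟨y, hy⟩ := (kosDual_bijective hf (zero_add n)).2 x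
      have h1 := (map_shift_eq_zero_iff hn hd hℓ hk hψ y).2
        ((congrArg (· ∈ (modM hf).torsion) hy).mpr hx)
      obtain ⟨a, ha⟩ := exists_map_koszul_eq_of_map_eq_zero hn hd hℓ hk hψ hφ₀ y h1
      obtain ⟨b, rfl⟩ := (PM.extEquiv n).surjective a
      exact ⟨b, Subtype.ext (((hE φ₀ hφ₀).1 b).trans ((congrArg _ ha).trans hy))⟩
  exact ⟨GrMod.Iso.ofBijective (B := (modM' hf).shift (n * d)) E' hdeg hb,
    fun φ hφ => (hE φ hφ).2⟩

end KoszulDuality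

end

/-! ### The isomorphism `D₁(N) = M''(nd)` -/

noncomputable section

namespace KoszulDuality

variable {n : ℕ}

open ProjComplex

variable {d : ℕ} {f : PolyRing n} {hf : f.IsHomogeneous d} {ℓ : PolyRing n} {k : ℕ}
  {PN : FreeResolution (modN hf)}
  {ψ : ∀ i j, i + j + 1 = n → (PN.X j →ₗ[PolyRing n] forms n i)}

/-- The cocycle of the resolution of `N` given by a top form. -/
def IsLiftToKoszul.cocycle (hψ : IsLiftToKoszul hf PN ψ) (hn : 1 ≤ n) :
    koszulTerm n d n →ₗ[PolyRing n] PN.extZ (n - 1) :=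
  LinearMap.codRestrict (PN.extZ (n - 1))
    (show forms n n →ₗ[PolyRing n] PN.dualTerm (n - 1) from
      (LinearMap.lcomp (PolyRing n) (forms n n) (ψ 0 (n - 1) (by omega))) ∘ₗ wedgeL (add_zero n))
    fun ω => LinearMap.ext fun v => by
      have h1 := hψ.comm_last (n - 1) (by omega) v
      exact (congrArg (wedgeL (add_zero n) (show forms n n from ω)) h1).trans (map_zero _)

/-- The cocycle of the truncated Koszul complex given by a top form. -/
def truncCocycle (f : PolyRing n) (ω : koszulTerm n d n) :
    (kos f (n - 1)).Z (forms n n) (n - 1) :=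
  ⟨wedgeL (add_zero n) (show forms n n from ω) ∘ₗ kosOut f (zero_add (n - 1)), mem_Z.2 fun x => by
    rw [kos_eq_zero f (by omega) x, map_zero, map_zero]⟩

/-- Two lifts are homotopic as morphisms to the truncation at `n - 1`, which, unlike the full Koszul
complex, is a resolution. Both classes are pullbacks of the class of `truncCocycle`. -/
theorem extClass_cocycle_eq (hn : 1 ≤ n)
    (hex : ∀ k < n - 1, ∀ ω : forms n k, dfWedge f k ω = 0 → ω ∈ koszulB f d k)
    {ψ' : ∀ i j, i + j + 1 = n → (PN.X j →ₗ[PolyRing n] forms n i)}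
    (hψ : IsLiftToKoszul hf PN ψ) (hψ' : IsLiftToKoszul hf PN ψ') (ω : koszulTerm n d n) :
    PN.extClass (n - 1) (hψ.cocycle hn ω) = PN.extClass (n - 1) (hψ'.cocycle hn ω) := by
  have h1 := map_eq_of_aug_eq (W := forms n n) (kosAug_isRes f d hex) (hψ.truncHom hn)
    (hψ'.truncHom hn) (fun x => (hψ.aug_truncHom hn x).trans (hψ'.aug_truncHom hn x).symm) (n - 1)
  have h2 := LinearMap.congr_fun h1 ((kos f (n - 1)).cls (forms n n) (n - 1)
    (truncCocycle f ω))
  exact (PN.extEquiv (n - 1)).injective h2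

/-- The cocycle of the Koszul complex given by a top form. -/
def kosCocycle (f : PolyRing n) (ω : koszulTerm n d n) : (kos f n).Z (forms n n) n :=
  ⟨wedgeL (add_zero n) (show forms n n from ω) ∘ₗ kosOut f (zero_add n), mem_Z.2 fun x => by
    rw [kos_eq_zero f (by omega) x, map_zero, map_zero]⟩

theorem kosDual_kosCocycle (ω : koszulTerm n d n) :
    kosDual hf (zero_add n) ((kos f n).cls (forms n n) n (kosCocycle f ω)) = topClass hf ω := by
  refine (kosDual_cls hf _ _).trans (congrArg (koszulClass hf n) (Subtype.ext ?_))
  refine (wedgeEquiv (add_zero n)).injective (LinearMap.ext fun η => ?_)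
  exact wedge_kosDualForm (zero_add n) _ η

/-- The identification of the cohomology of the shift with Extⁿ⁻¹(N) turns the map induced by `ψ`
into the explicit cocycle v ↦ ω ∧ ψ(v). -/
theorem exists_shH_map_kosCocycle (hψ : IsLiftToKoszul hf PN ψ) (hn : 1 ≤ n) :
    ∃ σ : PN.complex.sh.H (forms n n) n → PN.ext (n - 1), Function.Bijective σ ∧ σ 0 = 0 ∧
      ∀ ω : koszulTerm n d n, σ (hψ.hom.map (forms n n) n
        ((kos f n).cls (forms n n) n (kosCocycle f ω))) =
          PN.extClass (n - 1) (hψ.cocycle hn ω) := by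
  obtain ⟨m, rfl⟩ : ∃ m, n = m + 1 := ⟨n - 1, by omega⟩
  refine ⟨(PN.extEquiv m).symm.toLinearMap ∘ₗ PN.complex.shH (forms (m + 1) (m + 1)) m,
    (PN.extEquiv m).symm.bijective.comp (shH_bijective _ _ m), map_zero _, fun ω => ?_⟩
  refine (PN.extEquiv m).symm_apply_eq.2 ?_
  rfl

/-- The top forms map onto both Extⁿ⁻¹(N) and `M''`, with the same kernel: the forms whose class in
`M` is torsion. -/
theorem exists_iso_modM'' (PN : FreeResolution (modN hf)) (hn : 2 ≤ n) (hd : 1 ≤ d)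
    (hℓ : ℓ ∈ polyDeg n 1) (hk : maxIdeal n ^ k ≤ singIdeal f ⊔ Ideal.span {ℓ})
    (h : 0 + (n - 1) + 1 = n) :
    (∃ ψ, IsLiftToKoszul hf PN ψ) ∧
      ∃ e : GrMod.Iso (PN.D 1) ((modM'' hf).shift (n * d)),
        ∀ ψ, IsLiftToKoszul hf PN ψ → ∀ ω : koszulZ f d n, ∃ α : PN.extZ (n - 1),
          (∀ v, PN.eval α v = wedge (add_zero n) ω.1 (ψ 0 (n - 1) h v)) ∧
          e.toLinearEquiv (PN.extClass (n - 1) α) = projM'' hf (koszulClass hf n ω) := by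
  have hn1 : 1 ≤ n := by omega
  have hex : ∀ k < n - 1, ∀ ω : forms n k, dfWedge f k ω = 0 → ω ∈ koszulB f d k :=
    fun i hi => koszul_exact hf hd hℓ hk i (by omega)
  obtain ⟨ψ, hψ, hdeg⟩ := exists_isLiftToKoszul_deg (Q := PN) hn1 hex
  obtain ⟨σ, hσ, hσ0, hσω⟩ := exists_shH_map_kosCocycle hψ hn1
  let p : koszulTerm n d n →ₗ[PolyRing n] PN.ext (n - 1) := PN.extClass (n - 1) ∘ₗ hψ.cocycle hn1
  let q : koszulTerm n d n →ₗ[PolyRing n] modM'' hf := projM'' hf ∘ₗ topClass hf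
  have hp : Function.Surjective p := fun a => by
    obtain ⟨y, rfl⟩ := hσ.2 a
    obtain ⟨x, rfl⟩ := map_shift_surjective hn hd hℓ hk hψ y
    obtain ⟨ω, hω⟩ := topClass_surjective hf (kosDual hf (zero_add n) x)
    refine ⟨ω, (hσω ω).symm.trans ?_⟩
    rw [(kosDual_bijective hf (zero_add n)).1 ((kosDual_kosCocycle ω).trans hω)]
  have hq : Function.Surjective q := (Submodule.mkQ_surjective _).comp (topClass_surjective hf)
  have hpq : LinearMap.ker p = LinearMap.ker q := by
    ext ω
    have h1 : q ω = 0 ↔ topClass hf ω ∈ (modM hf).torsion := Submodule.Quotient.mk_eq_zero _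
    have h2 : σ _ = p ω := hσω ω
    have h3 := map_shift_eq_zero_iff hn hd hℓ hk hψ
      ((kos f n).cls (forms n n) n (kosCocycle f ω))
    have h4 := iff_of_eq (congrArg (· ∈ (modM hf).torsion) (kosDual_kosCocycle (hf := hf) ω))
    refine Iff.trans ?_ (h3.trans (h4.trans h1.symm))
    rw [LinearMap.mem_ker, ← h2, ← hσ0, hσ.1.eq_iff]
  let e : modM'' hf ≃ₗ[PolyRing n] PN.ext (n - 1) :=
    (q.quotKerEquivOfSurjective hq).symm.trans
      ((Submodule.quotEquivOfEq _ _ hpq.symm).trans (p.quotKerEquivOfSurjective hp))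
  have he : ∀ ω, e (q ω) = p ω := fun ω => by
    have h1 : (q.quotKerEquivOfSurjective hq).symm (q ω) = (LinearMap.ker q).mkQ ω :=
      (LinearEquiv.symm_apply_eq _).2 rfl
    exact congrArg (fun x => p.quotKerEquivOfSurjective hp
      (Submodule.quotEquivOfEq _ _ hpq.symm x)) h1
  -- The shift by `n d` is the one of the term Ω⁰ of the Koszul complex, in which `ψ 0 (n - 1)`
  -- takes its values; Ωⁿ is not shifted.
  have hdege : ∀ m, ∀ a ∈ ((modM'' hf).shift (n * d)).deg m, e a ∈ (PN.ext (n - 1)).deg m := by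
    rintro m _ ⟨_, ⟨ω, hω, rfl⟩, rfl⟩
    refine (congrArg (· ∈ (PN.ext (n - 1)).deg m) (he ω.1)).mpr ?_
    refine FreeResolution.extClass_mem fun t v hv => ?_
    have h1 := hdeg 0 (n - 1) (by omega) t v hv
    have h2 := wedge_mem (add_zero n) (show ω.1 ∈ (forms n n).deg _ from hω) h1
    refine (congrArg (_ ∈ (forms n n).deg ·) ?_).mp h2
    push_cast
    ring
  let e₁ : GrMod.Iso ((modM'' hf).shift (n * d)) (PN.ext (n - 1)) :=
    GrMod.Iso.ofBijective (A := (modM'' hf).shift (n * d)) e.toLinearMap hdege e.bijective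
  refine ⟨⟨ψ, hψ⟩, e₁.symm, fun ψ' hψ' ω => ⟨hψ'.cocycle hn1 ω.1, fun v => rfl, ?_⟩⟩
  refine (LinearEquiv.symm_apply_eq _).2 ?_
  exact (extClass_cocycle_eq hn1 hex hψ' hψ ω.1).trans (he ω.1).symm

end KoszulDuality

end

/-! ### Dimension, depth and the Cohen–Macaulay property -/

noncomputable section

namespace KoszulDuality

variable {n : ℕ}

section Dimension

variable {R A : Type} [CommRing R] [AddCommGroup A] [Module R A] {J : Ideal R}

theorem supportDim_le_ringKrullDim_quotient (hJ : ∀ r ∈ J, ∀ a : A, r • a = 0) :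
    Module.supportDim R A ≤ ringKrullDim (R ⧸ J) := by
  rw [ringKrullDim_quotient]
  refine Order.krullDim_le_of_strictMono (fun p => ⟨p.1, ?_⟩) fun _ _ h => h
  exact le_trans (fun r hr => Module.mem_annihilator.2 (hJ r hr))
    (Module.annihilator_le_of_mem_support p.2)

/-- Contraction embeds the primes of the localization in those of `R`, and maps the support into the
zero locus of `J`. -/
theorem supportDim_atPrime_le_ringKrullDim_quotient (hJ : ∀ r ∈ J, ∀ a : A, r • a = 0)
    (p : Ideal R) [p.IsPrime] :
    Module.supportDim (Localization.AtPrime p) (LocalizedModule.AtPrime p A) ≤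
      ringKrullDim (R ⧸ J) := by
  have h1 : ∀ r ∈ J, ∀ a : LocalizedModule.AtPrime p A,
      algebraMap R (Localization.AtPrime p) r • a = 0 := fun r hr a => by
    induction a using LocalizedModule.induction_on with
    | h m s => rw [algebraMap_smul, LocalizedModule.smul'_mk, hJ r hr, LocalizedModule.zero_mk]
  rw [ringKrullDim_quotient]
  refine Order.krullDim_le_of_strictMono
    (fun q => ⟨PrimeSpectrum.comap (algebraMap R _) q.1, ?_⟩) ?_
  · exact fun r hr => Module.annihilator_le_of_mem_support q.2 (Module.mem_annihilator.2 (h1 r hr))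
  · exact fun q q' h => lt_of_le_of_ne (Ideal.comap_mono h.le) fun h2 => h.ne
      (Subtype.ext (PrimeSpectrum.localization_comap_injective _ p.primeCompl
        (congrArg Subtype.val h2)))

theorem zero_le_supportDim [Nontrivial A] : 0 ≤ Module.supportDim R A := by
  obtain ⟨s, hs⟩ := WithBot.ne_bot_iff_exists.1 (Module.supportDim_ne_bot_of_nontrivial R A)
  rw [← hs]
  exact WithBot.coe_le_coe.2 (zero_le (a := s))

theorem length_le_depth [IsLocalRing R] {l : List R} (hl : RingTheory.Sequence.IsRegular A l)
    (hm : ∀ a ∈ l, a ∈ IsLocalRing.maximalIdeal R) : (l.length : ℕ∞) ≤ depth R A :=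
  le_iSup_of_le l (le_iSup_of_le hm (le_iSup_of_le hl le_rfl))

theorem depth_le_supportDim [IsLocalRing R] [IsNoetherianRing R] [Module.Finite R A]
    [Nontrivial A] : (depth R A : WithBot ℕ∞) ≤ Module.supportDim R A := by
  obtain ⟨s, hs⟩ := WithBot.ne_bot_iff_exists.1 (Module.supportDim_ne_bot_of_nontrivial R A)
  rw [← hs, WithBot.coe_le_coe]
  refine iSup_le fun l => iSup_le fun hm => iSup_le fun hl => ?_
  have h1 := Module.supportDim_add_length_eq_supportDim_of_isRegular l hl
  have := hl.quot_ofList_smul_nontrivial ⊤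
  obtain ⟨t, ht⟩ := WithBot.ne_bot_iff_exists.1
    (Module.supportDim_ne_bot_of_nontrivial R (A ⧸ Ideal.ofList l • (⊤ : Submodule R A)))
  rw [← ht, ← hs] at h1
  have h2 : t + (l.length : ℕ∞) = s := by exact_mod_cast h1
  rw [← h2]
  exact le_add_self

theorem supportDim_eq_depth [IsLocalRing R] [IsNoetherianRing R] [Module.Finite R A]
    {l : List R} (hl : RingTheory.Sequence.IsRegular A l)
    (hm : ∀ a ∈ l, a ∈ IsLocalRing.maximalIdeal R)
    (hd : Module.supportDim R A ≤ (l.length : ℕ∞)) : Module.supportDim R A = depth R A := by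
  have := hl.nontrivial
  exact le_antisymm (hd.trans (WithBot.coe_le_coe.2 (length_le_depth hl hm))) depth_le_supportDim

/-- At each maximal ideal of the support, the localized sequence of length `s` gives depth at least
`s`, and depth ≤ dimension ≤ `s` does the rest. -/
theorem isCohenMacaulay_of_exists_regular [IsNoetherianRing R] [Module.Finite R A] (s : ℕ)
    (hdim : ∀ p : Ideal R, [p.IsPrime] →
      Module.supportDim (Localization.AtPrime p) (LocalizedModule.AtPrime p A) ≤ (s : ℕ∞))
    (hreg : ∀ p : Ideal R, p.IsMaximal → ∃ l : List R, l.length = s ∧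
      RingTheory.Sequence.IsWeaklyRegular A l ∧ ∀ a ∈ l, a ∈ p) :
    IsCohenMacaulay R A := by
  intro p hp hpm
  obtain ⟨l, hls, hl, hlp⟩ := hreg p.asIdeal hpm
  have : Nontrivial (LocalizedModule.AtPrime p.asIdeal A) := hp
  have hl' := hl.isRegular_of_isLocalizedModule_of_mem (Localization.AtPrime p.asIdeal) p.asIdeal
    (LocalizedModule.mkLinearMap p.asIdeal.primeCompl A) hlp
  refine supportDim_eq_depth hl' (fun a ha => ?_) ?_
  · obtain ⟨r, hr, rfl⟩ := List.mem_map.1 ha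
    exact (IsLocalization.AtPrime.to_map_mem_maximal_iff _ p.asIdeal r).2 (hlp r hr)
  · rw [List.length_map, hls]
    exact hdim p.asIdeal

end Dimension

theorem ringKrullDim_quotient_pow_maxIdeal (k : ℕ) :
    ringKrullDim (PolyRing n ⧸ maxIdeal n ^ k) ≤ 0 := by
  rw [ringKrullDim_quotient]
  have : Subsingleton (PrimeSpectrum.zeroLocus
      ((maxIdeal n ^ k : Ideal (PolyRing n)) : Set (PolyRing n))) := by
    have key : ∀ q ∈ PrimeSpectrum.zeroLocus
        ((maxIdeal n ^ k : Ideal (PolyRing n)) : Set (PolyRing n)), maxIdeal n = q.asIdeal :=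
      fun q hq => maxIdeal_isMaximal.eq_of_le q.isPrime.ne_top (q.isPrime.le_of_pow_le hq)
    exact ⟨fun q q' => Subtype.ext (PrimeSpectrum.ext ((key q.1 q.2).symm.trans (key q'.1 q'.2)))⟩
  exact Order.krullDim_nonpos_of_subsingleton

/-- A linear form minus a nonzero constant is regular on graded modules. -/
theorem GrMod.eq_zero_of_smul_eq_smul (A : GrMod n) {ℓ : PolyRing n} (hℓ : ℓ ∈ polyDeg n 1) {c : ℂ}
    (hc : c ≠ 0) {a : A} (h : ℓ • a = (MvPolynomial.C c : PolyRing n) • a) : a = 0 := by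
  by_contra ha
  have hne : (A.proj_fin a).toFinset.Nonempty := by
    rw [Finset.nonempty_iff_ne_empty]
    intro h1
    apply ha
    rw [← A.sum_proj a, h1, Finset.sum_empty]
  have h1 : A.proj ((A.proj_fin a).toFinset.min' hne) a ≠ 0 := by
    have := (A.proj_fin a).toFinset.min'_mem hne
    rwa [Set.Finite.mem_toFinset] at this
  -- The lowest degree of `a`: there `ℓ • a` has no component, while `c • a` has `c` times that of
  -- `a`.
  set m := (A.proj_fin a).toFinset.min' hne with hm
  have h2 : A.proj (m - 1) a = 0 := by
    by_contra h3
    have := (A.proj_fin a).toFinset.min'_le (m - 1) ((Set.Finite.mem_toFinset _).2 h3)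
    omega
  have h3 := A.proj_smul hℓ (m - 1) a
  rw [h2, smul_zero, h, sub_add_cancel] at h3
  have h4 := A.proj_smul (C_mem_polyDeg c) m a
  rw [add_zero] at h4
  apply h1
  have h5 : (MvPolynomial.C c⁻¹ : PolyRing n) •
      (MvPolynomial.C c : PolyRing n) • A.proj m a = 0 := by
    rw [← h4, h3, smul_zero]
  rwa [smul_smul, ← map_mul, inv_mul_cancel₀ hc, map_one, one_smul] at h5

/-- By the Nullstellensatz `p` is the ideal of a point `z`, and `ℓ - ℓ(z)` lies in it. If `ℓ(z)` is
zero this is `ℓ`; otherwise it is regular on any graded module. -/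
theorem exists_regular_mem_maximal (A : GrMod n) {ℓ : PolyRing n} (hℓ : ℓ ∈ polyDeg n 1)
    (hreg : ∀ a : A, ℓ • a = 0 → a = 0) (p : Ideal (PolyRing n)) (hp : p.IsMaximal) :
    ∃ x ∈ p, IsSMulRegular A x := by
  obtain ⟨z, rfl⟩ := MvPolynomial.isMaximal_iff_eq_vanishingIdeal_singleton.1 hp
  refine ⟨ℓ - MvPolynomial.C (MvPolynomial.eval z ℓ), ?_, ?_⟩
  · simp
  · refine (isSMulRegular_iff_right_eq_zero_of_smul).2 fun a ha => ?_
    by_cases h : MvPolynomial.eval z ℓ = 0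
    · rw [h, map_zero, sub_zero] at ha
      exact hreg a ha
    · rw [sub_smul, sub_eq_zero] at ha
      exact A.eq_zero_of_smul_eq_smul hℓ h ha

open scoped Pointwise in
theorem isCohenMacaulay_of_linear_form (A : GrMod n) [Module.Finite (PolyRing n) A]
    {J : Ideal (PolyRing n)} (hJ : ∀ r ∈ J, ∀ a : A, r • a = 0)
    (hdim : ringKrullDim (PolyRing n ⧸ J) ≤ 1) {ℓ : PolyRing n} (hℓ : ℓ ∈ polyDeg n 1)
    (hreg : ∀ a : A, ℓ • a = 0 → a = 0) :
    IsCohenMacaulay (PolyRing n) A ∧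
      (Nontrivial A → Module.supportDim (PolyRing n) A = 1) := by
  constructor
  · refine isCohenMacaulay_of_exists_regular 1 (fun p _ => ?_) fun p hp => ?_
    · exact (supportDim_atPrime_le_ringKrullDim_quotient hJ p).trans hdim
    · obtain ⟨x, hx, h⟩ := exists_regular_mem_maximal A hℓ hreg p hp
      exact ⟨[x], rfl, (RingTheory.Sequence.isWeaklyRegular_singleton_iff A x).2 h,
        by simpa using hx⟩
  · intro hA
    refine le_antisymm ((supportDim_le_ringKrullDim_quotient hJ).trans hdim) ?_
    have h1 : IsSMulRegular A ℓ := isSMulRegular_iff_right_eq_zero_of_smul.2 hreg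
    -- A regular element lies in no minimal prime of the support, so it lowers the dimension by at
    -- least one; the quotient is nonzero by the graded Nakayama lemma.
    have h2 := Module.supportDim_quotSMulTop_succ_le_of_notMem_minimalPrimes (R := PolyRing n)
      (M := A) (x := ℓ) fun _ hp => h1.notMem_of_mem_minimalPrimes hp
    refine le_trans ?_ h2
    have h3 : Nontrivial (QuotSMulTop ℓ A) := by
      refine Submodule.Quotient.nontrivial_iff.2 fun h4 => ?_
      obtain ⟨a, ha⟩ := exists_ne (0 : A)
      refine ha (A.eq_zero_of_smul_surjective hℓ (fun b => ?_) a)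
      have hb : b ∈ ℓ • (⊤ : Submodule (PolyRing n) A) := by
        rw [h4]
        exact Submodule.mem_top
      obtain ⟨c, -, hc⟩ := hb
      exact ⟨c, hc⟩
    have h4 := zero_le_supportDim (R := PolyRing n) (A := QuotSMulTop ℓ A)
    calc (1 : WithBot ℕ∞) = 0 + 1 := (zero_add 1).symm
      _ ≤ _ := by gcongr

theorem isCohenMacaulay_of_pow_maxIdeal (A : Type) [AddCommGroup A] [Module (PolyRing n) A]
    [Module.Finite (PolyRing n) A]
    {k : ℕ} (hk : ∀ r ∈ maxIdeal n ^ k, ∀ a : A, r • a = 0) :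
    IsCohenMacaulay (PolyRing n) A ∧
      (Nontrivial A → Module.supportDim (PolyRing n) A = 0) := by
  constructor
  · refine isCohenMacaulay_of_exists_regular 0 (fun p _ => ?_) fun p hp => ?_
    · exact (supportDim_atPrime_le_ringKrullDim_quotient hk p).trans
        (ringKrullDim_quotient_pow_maxIdeal k)
    · exact ⟨[], rfl, RingTheory.Sequence.IsWeaklyRegular.nil _ A, by simp⟩
  · intro hA
    refine le_antisymm ((supportDim_le_ringKrullDim_quotient hk).trans
      (ringKrullDim_quotient_pow_maxIdeal k)) zero_le_supportDim

end KoszulDuality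

end

/-! ### The theorem -/

theorem theorem1 (n d : ℕ) (hn : 2 ≤ n) (hd : 1 ≤ d) (f : MvPolynomial (Fin n) ℂ)
    (hf : f.IsHomogeneous d)
    -- the singular locus of `f⁻¹(0)` has dimension at most `1`
    (hA : ringKrullDim (MvPolynomial (Fin n) ℂ ⧸ singIdeal f) ≤ 1)
    -- graded free resolutions, which compute the dual modules `D_i`
    (PM : FreeResolution (modM hf)) (PM' : FreeResolution (modM' hf))
    (PM'' : FreeResolution (modM'' hf)) (PN : FreeResolution (modN hf)) :
    -- `D_0(M) = D_0(M')`, by restriction along the inclusion `M' → M`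
    ((∃ θ, IsLift PM' PM (inclM' hf) θ) ∧
      ∃ e : GrMod.Iso (PM.D 0) (PM'.D 0),
        ∀ θ, IsLift PM' PM (inclM' hf) θ → ∀ α : PM.extZ n, ∃ β : PM'.extZ n,
          (∀ v, PM'.eval β v = PM.eval α (θ n v)) ∧
          e.toLinearEquiv (PM.extClass n α) = PM'.extClass n β) ∧
    -- `D_1(M'') = D_1(M)`, by composition with the projection `M → M''`
    ((∃ θ, IsLift PM PM'' (projM'' hf) θ) ∧
      ∃ e : GrMod.Iso (PM''.D 1) (PM.D 1),
        ∀ θ, IsLift PM PM'' (projM'' hf) θ → ∀ α : PM''.extZ (n - 1), ∃ β : PM.extZ (n - 1),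
          (∀ v, PM.eval β v = PM''.eval α (θ (n - 1) v)) ∧
          e.toLinearEquiv (PM''.extClass (n - 1) α) = PM.extClass (n - 1) β) ∧
    -- `D_0(M) = M'(nd)` and `D_1(M) = N(nd)`, induced by the morphism from the shifted Koszul
    -- complex to its cohomology `M` in degree `0` and by the self-duality of the Koszul complex
    (∃ φ, IsLiftFromKoszul hf PM φ) ∧
    (∃ e : GrMod.Iso (PM.D 0) ((modM' hf).shift (n * d)),
      ∀ φ, IsLiftFromKoszul hf PM φ → ∀ α : PM.extZ n, ∃ ω : koszulZ f d n,
        (∀ η : forms n 0, wedge (add_zero n) ω.1 η = PM.eval α (φ 0 n (zero_add n) η)) ∧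
        inclM' hf (e.toLinearEquiv (PM.extClass n α)) = koszulClass hf n ω) ∧
    (∃ e : GrMod.Iso (PM.D 1) ((modN hf).shift (n * d)),
      ∀ φ, IsLiftFromKoszul hf PM φ → ∀ α : PM.extZ (n - 1), ∃ ω : koszulZ f d (n - 1),
        (∀ η : forms n 1, wedge (k := n) (by omega) ω.1 η =
          PM.eval α (φ 1 (n - 1) (by omega) η)) ∧
        e.toLinearEquiv (PM.extClass (n - 1) α) = koszulClass hf (n - 1) ω) ∧
    -- `D_1(N) = M''(nd)`, induced by the morphism from `N[1]` to the shifted Koszul complex and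
    -- by the self-duality of the Koszul complex
    ((∃ ψ, IsLiftToKoszul hf PN ψ) ∧
      ∃ e : GrMod.Iso (PN.D 1) ((modM'' hf).shift (n * d)),
        ∀ ψ, IsLiftToKoszul hf PN ψ → ∀ ω : koszulZ f d n, ∃ α : PN.extZ (n - 1),
          (∀ v, PN.eval α v = wedge (add_zero n) ω.1 (ψ 0 (n - 1) (by omega) v)) ∧
          e.toLinearEquiv (PN.extClass (n - 1) α) = projM'' hf (koszulClass hf n ω)) ∧
    -- the other `D_i = Extⁿ⁻ⁱ` vanish
    (∀ j, j ≠ n → j ≠ n - 1 → Subsingleton (PM.ext j)) ∧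
    (∀ j, j ≠ n → Subsingleton (PM'.ext j)) ∧
    (∀ j, j ≠ n - 1 → Subsingleton (PM''.ext j)) ∧
    (∀ j, j ≠ n - 1 → Subsingleton (PN.ext j)) ∧
    -- `M'`, `M''`, `N` are Cohen-Macaulay of dimensions `0`, `1`, `1`, unless they are zero
    (IsCohenMacaulay (MvPolynomial (Fin n) ℂ) (modM' hf) ∧
      (Nontrivial (modM' hf) → Module.supportDim (MvPolynomial (Fin n) ℂ) (modM' hf) = 0)) ∧
    (IsCohenMacaulay (MvPolynomial (Fin n) ℂ) (modM'' hf) ∧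
      (Nontrivial (modM'' hf) → Module.supportDim (MvPolynomial (Fin n) ℂ) (modM'' hf) = 1)) ∧
    (IsCohenMacaulay (MvPolynomial (Fin n) ℂ) (modN hf) ∧
      (Nontrivial (modN hf) → Module.supportDim (MvPolynomial (Fin n) ℂ) (modN hf) = 1)) ∧
    -- `M'` is self-dual, and `M''` and `N` are dual to each other, up to a shift by `nd`
    Nonempty (GrMod.Iso (PM'.D 0) ((modM' hf).shift (n * d))) ∧
    Nonempty (GrMod.Iso (PM''.D 1) ((modN hf).shift (n * d))) := by
  obtain ⟨ℓ, hℓ, k, hk⟩ := exists_linear_form (singIdeal_homogeneous hf) hA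
  have hincl := FreeResolution.exists_ext_iso (P := PM') (Q := PM) (inclM' hf)
    (fun _ _ h => h) n (inclM'_map_bijective hd hℓ hk PM PM')
  have hproj := FreeResolution.exists_ext_iso (P := PM) (Q := PM'') (projM'' hf)
    (fun _ a h => ⟨a, h, rfl⟩) (n - 1) (projM''_map_bijective hn PM PM' PM'')
  have hM := exists_iso_modM' PM hn hd hℓ hk
  have hN := exists_iso_modN PM hn hd hℓ hk (by omega) (by omega)
  obtain ⟨N, hN'⟩ := exists_pow_torsion (modM hf)
  refine ⟨hincl, hproj, exists_isLiftFromKoszul (by omega), hM, hN,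
    exists_iso_modM'' PN hn hd hℓ hk (by omega),
    fun j h1 h2 => PM.ext_subsingleton (extVanish_modM hf hd hℓ hk j h1 (by omega)),
    fun j h => PM'.ext_subsingleton (extVanish_modM' hf j h),
    fun j h => PM''.ext_subsingleton (extVanish_modM'' hf hd hℓ hk j (by omega)),
    fun j h => PN.ext_subsingleton (extVanish_modN hf hn hd hℓ hk j (by omega)),
    isCohenMacaulay_of_pow_maxIdeal (modM' hf) fun p hp a => Subtype.ext (hN' p hp _ a.2),
    isCohenMacaulay_of_linear_form (modM'' hf)
      (fun _ hp a => singIdeal_smul_modM'' hf hd hp a) hA hℓ (modM''_regular hf hd hk),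
    isCohenMacaulay_of_linear_form (modN hf)
      (fun _ hp a => singIdeal_smul_eq_zero hf hd hp a) hA hℓ (modN_regular hf hd hℓ hk hn), ?_, ?_⟩
  · obtain ⟨-, e, -⟩ := hincl
    obtain ⟨e', -⟩ := hM
    exact ⟨e.symm.trans e'⟩
  · obtain ⟨-, e, -⟩ := hproj
    obtain ⟨e', -⟩ := hN
    exact ⟨e.trans e'⟩
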